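/- Let $d\in\{2,3\}$, let $\Omega\subset\mathbb R^d$ be a convex polygonal/polyhedral domain, and let $\gamma,q,B$ be real constants. **Mesh.** Let $\mathcal T_h$ be a finite conforming partition of $\Omega$ into open elements $\kappa=\mathsf F_\kappa((-1,1)^d)$, with $\mathsf F_\kappa$ affine and invertible, and let $h_\kappa$ be the diameter of $\kappa$. Assume that $\mathcal T_h$ is shape-regular with constant $\gamma$ (each $\kappa$ contains a ball of some radius $r>0$ with $h_\kappa\le\gamma r$) and quasi-uniform with constant $q$ ($h_\kappa\le q\,h_{\kappa'}$ for all $\kappa,\kappa'$). Let $\mathcal F_h$ be the set of its faces and $\mathcal F_h^I$ the set of faces shared by two elements $\kappa^+,\kappa^-$. With $\mathbf n^\pm$ the outward unit normals of $\kappa^\pm$, on an internal face put $[v]=v^+\mathbf n^++v^-\mathbf n^-$, $[\boldsymbol\tau]=\boldsymbol\tau^+\cdot\mathbf n^++\boldsymbol\tau^-\cdot\mathbf n^-$ and $\{\boldsymbol\tau\}=\frac12(\boldsymbol\tau^++\boldsymbol\tau^-)$; on a boundary face put $[v]=v\,\mathbf n$ and $\{\boldsymbol\tau\}=\boldsymbol\tau$.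 **Spaces.** Let $p>1$ be an integer, $\mathbb Q^p$ the polynomials of degree at most $p$ in each variable, and $V_{hp}=\{v\in L^2(\Omega): v|_\kappa\circ\mathsf F_\kappa\in\mathbb Q^p\ \forall\kappa\in\mathcal T_h\}$. Let $\mathcal N(\kappa)$ be the image under $\mathsf F_\kappa$ of the tensor grid of the $p+1$ Gauss–Legendre–Lobatto nodes of $[-1,1]$. Let $V^B_{hp}$ be the space of those $v\in V_{hp}$ that vanish at all points of $\mathcal N(\kappa)$ interior to $\kappa$, for every $\kappa$, and let $V^C_{hp}$ be the space of those $v\in V_{hp}$ that are continuous on $\overline\Omega$ and vanish on $\partial\Omega$. **Bilinear form.** For $\alpha\ge1$ let $\sigma|_F=\alpha p^2/\min(h_{\kappa^+},h_{\kappa^-})$ on internal faces and $\sigma|_F=\alpha p^2/h_\kappa$ on boundary faces. Let $\boldsymbol\beta$ assign a vector of $\mathbb R^d$ to each face. The liftings $r_F(\boldsymbol\tau),l_F(w)\in[V_{hp}]^d$ are defined by $\int_\Omega r_F(\boldsymbol\tau)\cdot\boldsymbol\eta=-\int_F\boldsymbol\tau\cdot\{\boldsymbol\eta\}$ for $F\in\mathcal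 F_h$ and $\int_\Omega l_F(w)\cdot\boldsymbol\eta=-\int_F w[\boldsymbol\eta]$ for $F\in\mathcal F_h^I$, for all $\boldsymbol\eta\in[V_{hp}]^d$. Put $\Lambda(v)=\sum_{F\in\mathcal F_h}r_F([v])+\sum_{F\in\mathcal F_h^I}l_F(\boldsymbol\beta\cdot[v])$ and, with $\nabla$ taken elementwise, $$\mathcal A(u,v)=\int_\Omega\nabla u\cdot\nabla v+\int_\Omega\nabla u\cdot\Lambda(v)+\int_\Omega\Lambda(u)\cdot\nabla v+\sum_{F\in\mathcal F_h}\int_F\sigma[u]\cdot[v]+\theta\int_\Omega\Lambda(u)\cdot\Lambda(v).$$ **Oswald operator.** For $v\in V_{hp}$ let $\mathsf Q_hv\in V_{hp}$ be the function whose restriction to each $\kappa$ takes at $\xi\in\mathcal N(\kappa)$ the value $0$ if $\xi\in\partial\Omega$, and otherwise the arithmetic mean of the values $v|_{\kappa'}(\xi)$ over all $\kappa'\in\mathcal T_h$ with $\xi\in\overline{\kappa'}$. **Theorem.** There exist constants $\alpha_0$ and $C>0$, depending only on $d,\Omega,\gamma,q,B$, such that the following holds for every such mesh $\mathcal T_h$,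 every integer $p>1$, and every choice of $\alpha,\theta,\boldsymbol\beta$ of one of the two kinds - SIPG: $\theta=0$, $\boldsymbol\beta=\mathbf 0$, $\alpha\ge1$ and $\alpha\ge\alpha_0$; - LDG: $\theta=1$, $|\boldsymbol\beta|\le B$ and $\alpha\ge1$. For every $v\in V_{hp}$ we have $\mathsf Q_hv\in V^C_{hp}$, $v-\mathsf Q_hv\in V^B_{hp}$ and $$\mathcal A(v-\mathsf Q_hv,v-\mathsf Q_hv)+\mathcal A(\mathsf Q_hv,\mathsf Q_hv)\le C\,\mathcal A(v,v).$$ Consequently $V_{hp}=V^B_{hp}+V^C_{hp}$, and this decomposition is stable: for every $v\in V_{hp}$ the infimum below is finite and $$\inf_{\substack{v^B\in V^B_{hp},\ v^C\in V^C_{hp}\\ v^B+v^C=v}}\big[\mathcal A(v^B,v^B)+\mathcal A(v^C,v^C)\big]\le C\,\mathcal A(v,v).$$ -/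

import Mathlib

open MeasureTheory
open scoped RealInnerProductSpace

noncomputable section

namespace HpDG

/-- The Euclidean space `ℝ^d`. -/
abbrev E (d : ℕ) : Type := EuclideanSpace ℝ (Fin d)

/-- A convex polygonal (`d = 2`) or polyhedral (`d = 3`) domain: the nonempty interior of the convex
hull of finitely many points. -/
def IsConvexPolytopeDomain {d : ℕ} (Ω : Set (E d)) : Prop :=
  Ω.Nonempty ∧ ∃ S : Finset (E d), Ω = interior (convexHull ℝ (S : Set (E d)))

/-! ### The reference element -/

/-- The open reference hypercube `(-1,1)^d`. -/
def refCube (d : ℕ) : Set (E d) := {x | ∀ i, x i ∈ Set.Ioo (-1 : ℝ) 1}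

/-- The closed face (of any dimension `0, …, d`) of the closed reference cube `[-1,1]^d` on which the
coordinates `i` with `s i = 1` or `s i = -1` are frozen to that value, the others being free. -/
def refSubface {d : ℕ} (s : Fin d → SignType) : Set (E d) :=
  {x | (∀ i, x i ∈ Set.Icc (-1 : ℝ) 1) ∧ ∀ i, s i ≠ 0 → x i = ((s i : SignType) : ℝ)}

/-- The sign `1` or `-1` attached to a Boolean. -/
def sgn (b : Bool) : ℝ := if b then 1 else -1

/-- The closed `(d-1)`-dimensional face `{x ∈ [-1,1]^d : x_i = ±1}` of the reference cube. -/
def refFace {d : ℕ} (i : Fin d) (b : Bool) : Set (E d) :=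
  {x | (∀ j, x j ∈ Set.Icc (-1 : ℝ) 1) ∧ x i = sgn b}

/-- `ℚ^p`: (functions on `ℝ^d` given by) polynomials of degree at most `p` in each variable. -/
def Qp (d p : ℕ) : Submodule ℝ (E d → ℝ) where
  carrier := {f | ∃ q ∈ MvPolynomial.restrictDegree (Fin d) ℝ p,
    ∀ x : E d, f x = MvPolynomial.eval (fun i => x i) q}
  add_mem' := by
    rintro f g ⟨q, hq, hf⟩ ⟨r, hr, hg⟩
    exact ⟨q + r, Submodule.add_mem _ hq hr, fun x => by simp [hf, hg]⟩
  zero_mem' := ⟨0, Submodule.zero_mem _, fun x => by simp⟩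
  smul_mem' := by
    rintro c f ⟨q, hq, hf⟩
    exact ⟨c • q, Submodule.smul_mem _ c hq, fun x => by simp [hf, MvPolynomial.smul_eval]⟩

/-! ### Gauss-Legendre-Lobatto nodes -/

/-- The Legendre polynomial of degree `p`, by the formula of Rodrigues. -/
def legendre (p : ℕ) : Polynomial ℝ :=
  Polynomial.C (1 / (2 ^ p * (p.factorial : ℝ))) *
    Polynomial.derivative^[p] ((Polynomial.X ^ 2 - 1) ^ p)

/-- The one-dimensional Gauss-Legendre-Lobatto nodes of degree `p` on `[-1,1]`: the endpoints `±1`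
and the zeros of the derivative of the Legendre polynomial of degree `p`. -/
def gllNodes (p : ℕ) : Finset ℝ :=
  ((1 - Polynomial.X ^ 2) * Polynomial.derivative (legendre p)).roots.toFinset

/-- The tensor-product Gauss-Legendre-Lobatto nodes of the reference cube. -/
def refNodes (d p : ℕ) : Finset (Fin d → ℝ) := Fintype.piFinset fun _ => gllNodes p

/-- The tensor-product Lagrange basis function of the reference cube attached to the node `ξ`. -/
def refLagrange {d : ℕ} (p : ℕ) (ξ : Fin d → ℝ) (x : E d) : ℝ :=
  ∏ i, (Lagrange.basis (gllNodes p) id (ξ i)).eval (x i)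

/-! ### Meshes -/

/-- A conforming partition of `Ω` into finitely many open elements, each of them the image of the
reference cube under an invertible affine map. -/
structure Mesh {d : ℕ} (Ω : Set (E d)) where
  /-- The number of elements. -/
  n : ℕ
  /-- The affine maps from the reference element to the elements. -/
  F : Fin n → E d ≃ᵃ[ℝ] E d
  /-- Distinct elements are disjoint. -/
  disj : ∀ k l, k ≠ l → Disjoint (F k '' refCube d) (F l '' refCube d)
  /-- The closed elements cover the closed domain exactly. -/
  cover : ⋃ k, closure (F k '' refCube d) = closure Ω
  /-- Two closed elements are disjoint, or they meet in a common vertex, edge or face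
  (a full face of some dimension of both). -/
  conforming : ∀ k l, k ≠ l →
    closure (F k '' refCube d) ∩ closure (F l '' refCube d) = ∅ ∨
    ∃ s t : Fin d → SignType,
      closure (F k '' refCube d) ∩ closure (F l '' refCube d) = F k '' refSubface s ∧
      closure (F k '' refCube d) ∩ closure (F l '' refCube d) = F l '' refSubface t

namespace Mesh

variable {d : ℕ} {Ω : Set (E d)} (M : Mesh Ω)

/-- The (open) element `κ`. -/
def elem (k : Fin M.n) : Set (E d) := M.F k '' refCube d

/-- The diameter `h_κ`. -/
def h (k : Fin M.n) : ℝ := Metric.diam (M.elem k)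

/-- Shape regularity with constant `γ`: each element contains a ball of radius `r` with
`h_κ ≤ γ r`. -/
def ShapeRegular (γ : ℝ) : Prop :=
  ∀ k, ∃ x : E d, ∃ r : ℝ, 0 < r ∧ Metric.ball x r ⊆ M.elem k ∧ M.h k ≤ γ * r

/-- Quasi-uniformity with constant `q`: the diameters of any two elements are comparable. -/
def QuasiUniform (q : ℝ) : Prop := ∀ k l, M.h k ≤ q * M.h l

/-- A face of an element, as a side of that element: the element, the frozen reference coordinate,
and the sign of the latter. -/
abbrev Side : Type := Fin M.n × Fin d × Bool

/-- The closed subset of `ℝ^d` occupied by a side. -/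
def sideSet (s : M.Side) : Set (E d) := M.F s.1 '' refFace s.2.1 s.2.2

/-- The outward unit normal vector `n_{F,κ}` of `κ` on a side: for `F_κ(x) = A x + b`, the inverse
transpose of `A` takes the reference normal `± e_i` to a positive multiple of the normal. -/
def normal (s : M.Side) : E d :=
  let w : E d := LinearMap.adjoint ((M.F s.1).linear.symm : E d →ₗ[ℝ] E d)
    (sgn s.2.2 • EuclideanSpace.single s.2.1 (1 : ℝ))
  ‖w‖⁻¹ • w

open Classical in
/-- The set `ℱ_h` of all faces of the mesh; a face shared by two elements occurs once. -/
def faces : Finset (Set (E d)) := Finset.univ.image M.sideSet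

open Classical in
/-- The sides that occupy the face `f`: two (one in `κ⁺`, one in `κ⁻`) for an internal face, one for a
boundary face. -/
def sides (f : Set (E d)) : Finset M.Side := Finset.univ.filter fun s => M.sideSet s = f

/-- The set `ℱ_h^I` of internal faces: those shared by two elements. -/
def intFaces : Finset (Set (E d)) := M.faces.filter fun f => (M.sides f).card = 2

/-! ### Broken functions, traces, jumps and averages

A function (up to null sets) on `Ω` that is smooth on each element is represented by the family of its
elementwise restrictions, each one continued beyond the element by the same polynomial expression, so
that its trace from inside `κ` at a point of the boundary of `κ` is the value of the `κ`-th member. -/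

/-- Broken scalar functions. -/
abbrev Broken : Type := Fin M.n → E d → ℝ

/-- Broken vector fields. -/
abbrev BrokenVec : Type := Fin M.n → E d → E d

/-- The discontinuous finite element space `V_hp`: on each element `v ∘ F_κ` is in `ℚ^p`. -/
def Vhp (p : ℕ) : Submodule ℝ M.Broken where
  carrier := {v | ∀ k, (v k ∘ M.F k) ∈ Qp d p}
  add_mem' := fun hv hw k => (Qp d p).add_mem (hv k) (hw k)
  zero_mem' := fun _ => (Qp d p).zero_mem
  smul_mem' := fun c _ hv k => (Qp d p).smul_mem c (hv k)

/-- The space `[V_hp]^d`. -/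
def VhpVec (p : ℕ) : Set M.BrokenVec := {η | ∀ i : Fin d, (fun k x => η k x i) ∈ M.Vhp p}

/-- The jump `v⁺ n⁺ + v⁻ n⁻` (on a boundary face: `v n`) of a scalar function on the face `f`. -/
def jump (v : M.Broken) (f : Set (E d)) (x : E d) : E d :=
  ∑ s ∈ M.sides f, v s.1 x • M.normal s

/-- The jump `τ⁺ ⬝ n⁺ + τ⁻ ⬝ n⁻` of a vector field on an internal face `f`. -/
def jumpVec (τ : M.BrokenVec) (f : Set (E d)) (x : E d) : ℝ :=
  ∑ s ∈ M.sides f, ⟪τ s.1 x, M.normal s⟫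

/-- The average `(τ⁺ + τ⁻) / 2` (on a boundary face: `τ`) of a vector field on the face `f`. -/
def avgVec (τ : M.BrokenVec) (f : Set (E d)) (x : E d) : E d :=
  ((M.sides f).card : ℝ)⁻¹ • ∑ s ∈ M.sides f, τ s.1 x

/-- The integral over a face against the `(d-1)`-dimensional surface measure. -/
def faceIntegral (f : Set (E d)) (g : E d → ℝ) : ℝ := ∫ x in f, g x ∂μHE[d - 1]

/-- `∫_Ω τ ⬝ η dx`, as the sum of the integrals over the elements. -/
def vecIntegral (τ η : M.BrokenVec) : ℝ := ∑ k, ∫ x in M.elem k, ⟪τ k x, η k x⟫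

/-- The elementwise gradient. -/
def brokenGrad (v : M.Broken) : M.BrokenVec := fun k x => gradient (v k) x

/-! ### Liftings and the bilinear form -/

open Classical in
/-- The lifting `r_F(τ) ∈ [V_hp]^d`, defined by `∫_Ω r_F(τ) ⬝ η = -∫_F τ ⬝ {η}` for all
`η ∈ [V_hp]^d`. -/
def liftFaceR (p : ℕ) (f : Set (E d)) (τ : E d → E d) : M.BrokenVec :=
  if hr : ∃ r ∈ M.VhpVec p, ∀ η ∈ M.VhpVec p,
      M.vecIntegral r η = -faceIntegral f (fun x => ⟪τ x, M.avgVec η f x⟫)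
  then hr.choose else 0

open Classical in
/-- The lifting `l_F(v) ∈ [V_hp]^d`, defined by `∫_Ω l_F(v) ⬝ η = -∫_F v [η]` for all
`η ∈ [V_hp]^d`. -/
def liftFaceL (p : ℕ) (f : Set (E d)) (v : E d → ℝ) : M.BrokenVec :=
  if hr : ∃ r ∈ M.VhpVec p, ∀ η ∈ M.VhpVec p,
      M.vecIntegral r η = -faceIntegral f (fun x => v x * M.jumpVec η f x)
  then hr.choose else 0

/-- `R([v]) + L(β ⬝ [v])`, with `R` the sum of the `r_F` over all faces and `L` the sum of the `l_F`
over the internal faces. The vector `β` may vary from face to face. -/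
def lift (p : ℕ) (β : Set (E d) → E d) (v : M.Broken) : M.BrokenVec :=
  ∑ f ∈ M.faces, M.liftFaceR p f (M.jump v f) +
    ∑ f ∈ M.intFaces, M.liftFaceL p f (fun x => ⟪β f, M.jump v f x⟫)

/-- The penalty `σ` on the face `f`: `α p²` divided by the smallest diameter of an element that
has `f` as a face. -/
def sigma (p : ℕ) (α : ℝ) (f : Set (E d)) : ℝ :=
  α * (p : ℝ) ^ 2 / sInf ((fun s : M.Side => M.h s.1) '' (M.sides f : Set M.Side))

/-- The bilinear form `𝒜` of the discontinuous Galerkin method. -/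
def A (p : ℕ) (α θ : ℝ) (β : Set (E d) → E d) (u v : M.Broken) : ℝ :=
  M.vecIntegral (M.brokenGrad u) (M.brokenGrad v)
    + M.vecIntegral (M.brokenGrad u) (M.lift p β v)
    + M.vecIntegral (M.lift p β u) (M.brokenGrad v)
    + ∑ f ∈ M.faces, faceIntegral f (fun x => M.sigma p α f * ⟪M.jump u f x, M.jump v f x⟫)
    + θ * M.vecIntegral (M.lift p β u) (M.lift p β v)

/-! ### The two subspaces and the Oswald operator -/

/-- The image in the closed element `κ` of the point `ξ` of the closed reference cube. -/
def node (k : Fin M.n) (ξ : Fin d → ℝ) : E d := M.F k (WithLp.toLp 2 ξ)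

/-- `V_hp^B`: the functions in `V_hp` that vanish at all Gauss-Legendre-Lobatto nodes in the interior of
the elements. -/
def VB (p : ℕ) : Submodule ℝ M.Broken where
  carrier := {v | v ∈ M.Vhp p ∧ ∀ k, ∀ ξ ∈ refNodes d p,
    (∀ i, ξ i ∈ Set.Ioo (-1 : ℝ) 1) → v k (M.node k ξ) = 0}
  add_mem' := fun hv hw => ⟨(M.Vhp p).add_mem hv.1 hw.1, fun k ξ h1 h2 => by
    simp [hv.2 k ξ h1 h2, hw.2 k ξ h1 h2]⟩
  zero_mem' := ⟨(M.Vhp p).zero_mem, fun _ _ _ _ => rfl⟩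
  smul_mem' := fun c _ hv => ⟨(M.Vhp p).smul_mem c hv.1, fun k ξ h1 h2 => by
    simp [hv.2 k ξ h1 h2]⟩

/-- `V_hp^C`: the functions in `V_hp` that are continuous on the closure of `Ω` and vanish on the
boundary of `Ω`. -/
def VC (p : ℕ) : Submodule ℝ M.Broken where
  carrier := {v | v ∈ M.Vhp p ∧ ∃ g : E d → ℝ, ContinuousOn g (closure Ω) ∧
    (∀ x ∈ frontier Ω, g x = 0) ∧ ∀ k, ∀ x ∈ M.elem k, v k x = g x}
  add_mem' := by
    rintro v w ⟨hv, g, h1, h2, h3⟩ ⟨hw, g', h1', h2', h3'⟩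
    exact ⟨(M.Vhp p).add_mem hv hw, g + g', h1.add h1',
      fun x hx => by simp [h2 x hx, h2' x hx], fun k x hx => by simp [h3 k x hx, h3' k x hx]⟩
  zero_mem' := ⟨(M.Vhp p).zero_mem, 0, continuousOn_const, fun _ _ => rfl, fun _ _ _ => rfl⟩
  smul_mem' := by
    rintro c v ⟨hv, g, h1, h2, h3⟩
    exact ⟨(M.Vhp p).smul_mem c hv, c • g, h1.const_smul c,
      fun x hx => by simp [h2 x hx], fun k x hx => by simp [h3 k x hx]⟩

open Classical in
/-- The value that the Oswald operator prescribes at a node `y`: zero on the boundary of `Ω`, and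
otherwise the mean of the values of `v` from all closed elements that contain `y`. -/
def nodalMean (v : M.Broken) (y : E d) : ℝ :=
  if y ∈ frontier Ω then 0
  else (((Finset.univ.filter fun k => y ∈ closure (M.elem k)).card : ℝ))⁻¹ *
    ∑ k ∈ Finset.univ.filter (fun k => y ∈ closure (M.elem k)), v k y

/-- The Oswald operator `Q_h`: on each element, the Lagrange interpolant at the Gauss-Legendre-Lobatto
nodes of the nodal means. -/
def Qh (p : ℕ) (v : M.Broken) : M.Broken := fun k x =>
  ∑ ξ ∈ refNodes d p, M.nodalMean v (M.node k ξ) * refLagrange p ξ ((M.F k).symm x)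

end Mesh

/-- `𝒜` is the symmetric interior penalty form: `θ = 0`, `β = 0`, and a penalty coefficient `α ≥ 1` that
is at least the threshold `α₀`. -/
def IsSIPG {d : ℕ} (α₀ α θ : ℝ) (β : Set (E d) → E d) : Prop :=
  θ = 0 ∧ (∀ f, β f = 0) ∧ 1 ≤ α ∧ α₀ ≤ α

/-- `𝒜` is the local discontinuous Galerkin form: `θ = 1`, `|β| ≤ B`, and any penalty coefficient
`α ≥ 1`. -/
def IsLDG {d : ℕ} (B α θ : ℝ) (β : Set (E d) → E d) : Prop :=
  θ = 1 ∧ (∀ f, ‖β f‖ ≤ B) ∧ 1 ≤ α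

end HpDG

end

/-!
On `V_hp` the energy `𝒜(v, v)` is equivalent to `G(v) + S(v)`, where `G` is the square of the `L²` norm
of the elementwise gradient and `S` the penalty on the jumps. Testing the liftings with `Λ(v)` itself,
the trace inequality `‖v‖²_{L²(∂κ)} ≤ C p² h⁻¹ ‖v‖²_{L²(κ)}` gives `‖Λ(v)‖² ≤ C α⁻¹ S(v)`
(`Mesh.Scaled.vecIntegral_lift_le`), so that the lifting terms are absorbed, for large `α` in the interior
penalty form and by completing the square in the local discontinuous Galerkin form
(`Mesh.Scaled.le_A_self`).

The function `Q_h v` is continuous and vanishes on the boundary, so it has no jumps, and `v - Q_h v` has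
the jumps of `v`. The theorem therefore reduces to the bound of `G(v - Q_h v)` by `S(v)`
(`Mesh.Scaled.sum_integral_gradient_sub_Qh_le`), with a constant independent of `p`. The inverse
inequality costs the factor `p⁴ h⁻²`, and the `L²` norm on the cube is equivalent to the discrete norm
`∑ W(ξ) w(ξ)²` with the Gauss-Legendre-Lobatto weights. The nodal values of `v - Q_h v` vanish at the
interior nodes, and at a node on the boundary of an element the value is bounded by the jumps of `v` at
that node, since the elements around a point are connected through faces containing the point
(`Mesh.exists_single_side_or_mem_nhds`, `Mesh.abs_sub_nodalMean_le`). The weight of a node on a face is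
the weight `2 / (p (p + 1))` of an endpoint times the weight of the node in the face, so that the sum over
the nodes on a face is `p⁻²` times the squared `L²` norm of the jump on the face (`Mesh.sum_nodes_le`,
`Mesh.Scaled.quadrature_jump_le`): of the factor `p⁴` there remains `p²`, as in the penalty.

Two geometric facts are used throughout. An affine bijection between faces of the cube is a signed
permutation of the coordinates (`exists_faceMatch`), so that the nodes, the weights and the polynomial
degrees on a common face do not depend on the element from which it is seen. A face that belongs to a
single element lies in the boundary of the convex domain (`Mesh.sideSet_subset_frontier`).
-/

noncomputable section

namespace HpDG

/-! ### Legendre polynomials and Gauss-Legendre-Lobatto quadrature on an interval -/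

section Legendre

open Polynomial

/-- Integration over `[-1,1]` as a linear form on polynomials. -/
def polyIntegral : ℝ[X] →ₗ[ℝ] ℝ where
  toFun P := ∫ x in (-1 : ℝ)..1, P.eval x
  map_add' P Q := by
    simp only [eval_add]
    exact intervalIntegral.integral_add (P.continuous.intervalIntegrable _ _)
      (Q.continuous.intervalIntegrable _ _)
  map_smul' c P := by
    simp only [eval_smul, smul_eq_mul, RingHom.id_apply]
    exact intervalIntegral.integral_const_mul _ _

lemma polyIntegral_def (P : ℝ[X]) : polyIntegral P = ∫ x in (-1 : ℝ)..1, P.eval x := rfl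

lemma polyIntegral_C_mul (c : ℝ) (P : ℝ[X]) : polyIntegral (C c * P) = c * polyIntegral P := by
  rw [← smul_eq_C_mul, map_smul, smul_eq_mul]

lemma polyIntegral_derivative (P : ℝ[X]) :
    polyIntegral (derivative P) = P.eval 1 - P.eval (-1) :=
  intervalIntegral.integral_eq_sub_of_hasDerivAt (fun x _ => P.hasDerivAt x)
    ((derivative P).continuous.intervalIntegrable _ _)

lemma polyIntegral_derivative_mul (P Q : ℝ[X]) :
    polyIntegral (derivative P * Q) =
      P.eval 1 * Q.eval 1 - P.eval (-1) * Q.eval (-1) - polyIntegral (P * derivative Q) := by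
  have h := polyIntegral_derivative (P * Q)
  rw [derivative_mul, map_add, eval_mul, eval_mul] at h
  linarith

lemma polyIntegral_comp_neg (P : ℝ[X]) : polyIntegral (P.comp (-X)) = polyIntegral P := by
  simp only [polyIntegral_def, eval_comp, eval_neg, eval_X]
  rw [intervalIntegral.integral_comp_neg (fun x => P.eval x)]
  simp

lemma polyIntegral_nonneg {P : ℝ[X]} (h : ∀ x ∈ Set.Icc (-1 : ℝ) 1, 0 ≤ P.eval x) :
    0 ≤ polyIntegral P :=
  intervalIntegral.integral_nonneg (by norm_num) h

lemma eq_zero_of_polyIntegral_eq_zero {P : ℝ[X]} (h : ∀ x ∈ Set.Icc (-1 : ℝ) 1, 0 ≤ P.eval x)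
    (h0 : polyIntegral P = 0) : P = 0 := by
  by_contra hP
  have hpos : 0 < polyIntegral P := by
    obtain ⟨c, hc, hc0⟩ : ∃ c ∈ Set.Icc (-1 : ℝ) 1, P.eval c ≠ 0 := by
      by_contra! hall
      refine hP (Polynomial.eq_zero_of_infinite_isRoot P ?_)
      exact (Set.Icc_infinite (show (-1 : ℝ) < 1 by norm_num)).mono fun x hx => hall x hx
    exact intervalIntegral.integral_pos (by norm_num) P.continuous.continuousOn
      (fun x hx => h x (Set.Ioc_subset_Icc_self hx)) ⟨c, hc, (h c hc).lt_of_ne' hc0⟩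
  exact hpos.ne' h0

lemma polyIntegral_sq_nonneg (P : ℝ[X]) : 0 ≤ polyIntegral (P ^ 2) :=
  polyIntegral_nonneg fun x _ => by rw [eval_pow]; positivity

lemma eq_zero_of_polyIntegral_sq {P : ℝ[X]} (h : polyIntegral (P ^ 2) = 0) : P = 0 :=
  pow_eq_zero_iff (two_ne_zero) |>.1
    (eq_zero_of_polyIntegral_eq_zero (fun x _ => by rw [eval_pow]; positivity) h)

/-- `(X² - 1) ^ p`, whose `p`-th derivative is the Legendre polynomial up to a factor. -/
abbrev rodriguesBase (p : ℕ) : ℝ[X] := (X ^ 2 - 1) ^ p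

lemma eval_iterate_derivative_rodriguesBase {p k : ℕ} (hk : k < p) {x : ℝ} (hx : x ^ 2 = 1) :
    (derivative^[k] (rodriguesBase p)).eval x = 0 := by
  obtain ⟨Q, hQ⟩ := pow_sub_dvd_iterate_derivative_pow (X ^ 2 - 1 : ℝ[X]) p k
  rw [hQ, eval_mul, eval_pow]
  have : p - k ≠ 0 := by omega
  simp [hx, this]

lemma polyIntegral_iterate_derivative_mul {p : ℕ} (j : ℕ) (hj : j ≤ p) (Q : ℝ[X])
    (hQ : derivative^[j] Q = 0) :
    polyIntegral (derivative^[j] (rodriguesBase p) * Q) = 0 := by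
  induction j generalizing Q with
  | zero =>
    have : Q = 0 := hQ
    simp [this]
  | succ j ih =>
    rw [Function.iterate_succ_apply', polyIntegral_derivative_mul,
      eval_iterate_derivative_rodriguesBase (by omega) (by norm_num),
      eval_iterate_derivative_rodriguesBase (by omega) (by norm_num),
      ih (by omega) _ (by rwa [← Function.iterate_succ_apply])]
    simp

/-- The Legendre polynomial of degree `p` is orthogonal to all polynomials of smaller degree. -/
lemma polyIntegral_legendre_mul {p : ℕ} {Q : ℝ[X]} (hQ : Q.natDegree < p) :
    polyIntegral (legendre p * Q) = 0 := by
  rw [legendre, mul_assoc, polyIntegral_C_mul, polyIntegral_iterate_derivative_mul p le_rfl Q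
    (iterate_derivative_eq_zero hQ), mul_zero]

lemma natDegree_rodriguesBase (p : ℕ) : (rodriguesBase p).natDegree = 2 * p := by
  have : (X ^ 2 - 1 : ℝ[X]) = X ^ 2 - C 1 := by simp
  rw [rodriguesBase, natDegree_pow, this, natDegree_X_pow_sub_C, mul_comm]

lemma natDegree_legendre_le (p : ℕ) : (legendre p).natDegree ≤ p := by
  refine (natDegree_C_mul_le _ _).trans ((natDegree_iterate_derivative _ _).trans ?_)
  have := natDegree_rodriguesBase p
  simp only [rodriguesBase] at this
  omega

lemma coeff_legendre_ne_zero (p : ℕ) : (legendre p).coeff p ≠ 0 := by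
  have hm : (rodriguesBase p).Monic := by
    have : (X ^ 2 - 1 : ℝ[X]) = X ^ 2 - C 1 := by simp
    rw [rodriguesBase, this]
    exact (monic_X_pow_sub_C 1 two_ne_zero).pow p
  have hc : (rodriguesBase p).coeff (p + p) = 1 := by
    rw [← two_mul, ← natDegree_rodriguesBase]; exact hm
  rw [legendre, coeff_C_mul, coeff_iterate_derivative]
  simp only [rodriguesBase] at hc
  rw [hc]
  have : ((p + p).descFactorial p : ℝ) ≠ 0 := by
    exact_mod_cast (Nat.descFactorial_pos.2 (by omega)).ne'
  simp only [nsmul_eq_mul, mul_one]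
  positivity

lemma natDegree_legendre (p : ℕ) : (legendre p).natDegree = p :=
  le_antisymm (natDegree_legendre_le p) (le_natDegree_of_ne_zero (coeff_legendre_ne_zero p))

lemma legendre_ne_zero (p : ℕ) : legendre p ≠ 0 := fun h => coeff_legendre_ne_zero p (by simp [h])

lemma natDegree_one_sub_X_sq : (1 - X ^ 2 : ℝ[X]).natDegree = 2 := by
  compute_degree!

lemma natDegree_derivative_one_sub_X_sq_mul {g : ℝ[X]} {m : ℕ} (hg : g.natDegree ≤ m) :
    (derivative ((1 - X ^ 2) * g)).natDegree ≤ m + 1 := by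
  refine (natDegree_derivative_le _).trans ?_
  have := natDegree_mul_le (p := (1 - X ^ 2 : ℝ[X])) (q := g)
  rw [natDegree_one_sub_X_sq] at this
  omega

/-- Integration by parts against the weight `1 - x²`: no boundary terms. -/
lemma polyIntegral_weight_mul_derivative (f g : ℝ[X]) :
    polyIntegral ((1 - X ^ 2) * derivative f * g) =
      -polyIntegral (f * derivative ((1 - X ^ 2) * g)) := by
  have h := polyIntegral_derivative_mul f ((1 - X ^ 2) * g)
  rw [show (1 - X ^ 2) * derivative f * g = derivative f * ((1 - X ^ 2) * g) by ring, h]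
  simp

lemma polyIntegral_derivative_weight_mul (f g : ℝ[X]) :
    polyIntegral (derivative ((1 - X ^ 2) * derivative f) * g) =
      -polyIntegral ((1 - X ^ 2) * derivative f * derivative g) := by
  rw [polyIntegral_derivative_mul]
  simp

lemma polyIntegral_weight_derivative_legendre_mul {p : ℕ} {g : ℝ[X]} (hg : g.natDegree + 1 < p) :
    polyIntegral ((1 - X ^ 2) * derivative (legendre p) * g) = 0 := by
  rw [polyIntegral_weight_mul_derivative, polyIntegral_legendre_mul, neg_zero]
  exact (natDegree_derivative_one_sub_X_sq_mul le_rfl).trans_lt hg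

lemma natDegree_lt_of_coeff_eq_zero {P : ℝ[X]} {p : ℕ} (hp : 0 < p) (h : P.natDegree ≤ p)
    (h0 : P.coeff p = 0) : P.natDegree < p := by
  refine lt_of_le_of_ne h fun he => ?_
  have : P = 0 := by rw [← leadingCoeff_eq_zero, leadingCoeff, he, h0]
  simp [this] at he
  omega

lemma coeff_derivative_weight_derivative {P : ℝ[X]} {p : ℕ} (hp : 0 < p) (h : P.natDegree ≤ p) :
    (derivative ((1 - X ^ 2) * derivative P)).coeff p = -(p * (p + 1) * P.coeff p) := by
  obtain ⟨m, rfl⟩ : ∃ m, p = m + 1 := ⟨p - 1, by omega⟩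
  have h2 : P.coeff (m + 1 + 1 + 1) = 0 := coeff_eq_zero_of_natDegree_lt (by omega)
  rw [coeff_derivative, sub_mul, one_mul, coeff_sub, coeff_derivative, h2,
    show m + 1 + 1 = m + 2 by ring, coeff_X_pow_mul, coeff_derivative]
  push_cast
  ring

/-- The differential equation of Legendre. -/
lemma legendre_ode {p : ℕ} (hp : 0 < p) :
    derivative ((1 - X ^ 2) * derivative (legendre p)) = -(C ((p : ℝ) * (p + 1)) * legendre p) := by
  set D := derivative ((1 - X ^ 2) * derivative (legendre p)) +
    C ((p : ℝ) * (p + 1)) * legendre p with hD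
  have hd1 : (derivative ((1 - X ^ 2) * derivative (legendre p))).natDegree ≤ p := by
    have := natDegree_derivative_one_sub_X_sq_mul
      (g := derivative (legendre p)) (m := p - 1)
      ((natDegree_derivative_le _).trans (by rw [natDegree_legendre]))
    omega
  have hdeg : D.natDegree < p := by
    refine natDegree_lt_of_coeff_eq_zero hp (natDegree_add_le_of_degree_le hd1
      ((natDegree_C_mul_le _ _).trans (natDegree_legendre_le p))) ?_
    rw [hD, coeff_add, coeff_derivative_weight_derivative hp (natDegree_legendre_le p), coeff_C_mul]
    ring
  have h0 : polyIntegral (D ^ 2) = 0 := by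
    have e : D ^ 2 = derivative ((1 - X ^ 2) * derivative (legendre p)) * D +
        C ((p : ℝ) * (p + 1)) * (legendre p * D) := by rw [pow_two]; nth_rw 1 [hD]; ring
    rw [e, map_add, polyIntegral_C_mul, polyIntegral_legendre_mul hdeg,
      polyIntegral_derivative_weight_mul, polyIntegral_weight_mul_derivative,
      polyIntegral_legendre_mul]
    · simp
    · rcases Nat.eq_zero_or_pos D.natDegree with h | h
      · rw [natDegree_eq_zero.1 h |>.choose_spec.symm]; simpa using hp
      · have := natDegree_derivative_one_sub_X_sq_mul (g := derivative D) (m := D.natDegree - 1)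
          (natDegree_derivative_le _)
        omega
  exact eq_neg_of_add_eq_zero_left (eq_zero_of_polyIntegral_sq h0)

lemma eval_derivative_legendre_one {p : ℕ} (hp : 0 < p) :
    2 * (derivative (legendre p)).eval 1 = p * (p + 1) * (legendre p).eval 1 := by
  have h := congrArg (eval 1) (legendre_ode hp)
  simp [derivative_mul] at h
  linarith

lemma eval_derivative_legendre_neg_one {p : ℕ} (hp : 0 < p) :
    2 * (derivative (legendre p)).eval (-1) = -(p * (p + 1) * (legendre p).eval (-1)) := by
  have h := congrArg (eval (-1)) (legendre_ode hp)
  simp [derivative_mul] at h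
  linarith

lemma derivative_legendre_ne_zero {p : ℕ} (hp : 0 < p) : derivative (legendre p) ≠ 0 := by
  intro h
  have := derivative_eq_zero.1 h
  rw [natDegree_legendre] at this
  omega

/-- A zero `a` of `L_p'` outside `(-1,1)` would make `(1 - x²) L_p' g`, with `g = L_p' / (x - a)`, of
one sign, against orthogonality. -/
lemma mem_Ioo_of_isRoot_derivative_legendre {p : ℕ} (hp : 0 < p) {a : ℝ}
    (ha : (derivative (legendre p)).IsRoot a) : a ∈ Set.Ioo (-1 : ℝ) 1 := by
  obtain ⟨g, hg⟩ := dvd_iff_isRoot.2 ha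
  have hL := derivative_legendre_ne_zero hp
  have hg0 : g ≠ 0 := by rintro rfl; simp [hg] at hL
  have hdeg : g.natDegree + 1 < p := by
    have h1 := natDegree_derivative_lt (p := legendre p) (by rw [natDegree_legendre]; omega)
    rw [hg, natDegree_mul (X_sub_C_ne_zero a) hg0, natDegree_X_sub_C, natDegree_legendre] at h1
    omega
  have horth := polyIntegral_weight_derivative_legendre_mul hdeg
  rw [hg] at horth
  have hw : ∀ x ∈ Set.Icc (-1 : ℝ) 1, 0 ≤ 1 - x ^ 2 := fun x hx => by nlinarith [hx.1, hx.2]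
  by_contra hout
  rw [Set.mem_Ioo, not_and_or, not_lt, not_lt] at hout
  have hz : ((1 - X ^ 2) * ((X - C a) * g) * g : ℝ[X]) = 0 := by
    rcases hout with h | h
    · refine eq_zero_of_polyIntegral_eq_zero (fun x hx => ?_) horth
      simp only [eval_mul, eval_sub, eval_one, eval_pow, eval_X, eval_C]
      have := mul_nonneg (mul_nonneg (hw x hx) (show 0 ≤ x - a by linarith [hx.1]))
        (sq_nonneg (g.eval x))
      nlinarith [this]
    · have h' : polyIntegral (-((1 - X ^ 2) * ((X - C a) * g) * g)) = 0 := by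
        rw [map_neg, horth, neg_zero]
      refine neg_eq_zero.1 (eq_zero_of_polyIntegral_eq_zero (fun x hx => ?_) h')
      simp only [eval_mul, eval_sub, eval_one, eval_pow, eval_X, eval_C, eval_neg]
      have := mul_nonneg (mul_nonneg (hw x hx) (show 0 ≤ a - x by linarith [hx.2]))
        (sq_nonneg (g.eval x))
      nlinarith [this]
  have h3 : (1 - X ^ 2 : ℝ[X]) ≠ 0 := by
    intro h0
    have := natDegree_one_sub_X_sq
    simp [h0] at this
  simp [h3, hg0, X_sub_C_ne_zero] at hz

/-- Rolle's theorem, with the zeros of the derivatives of `(X² - 1) ^ p` at the endpoints. -/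
lemma card_roots_iterate_derivative {p : ℕ} (k : ℕ) (hk : k < p) :
    k + 2 ≤ (derivative^[k] (rodriguesBase p)).roots.toFinset.card := by
  have hne : ∀ k < p, derivative^[k] (rodriguesBase p) ≠ 0 := fun k hk h0 => by
    have := congrArg (derivative^[p - k]) h0
    rw [← Function.iterate_add_apply, show p - k + k = p by omega, iterate_derivative_zero] at this
    exact legendre_ne_zero p (by rw [legendre]; simp only [rodriguesBase] at this; simp [this])
  have hmem : ∀ k < p, ∀ x : ℝ, x ^ 2 = 1 → x ∈ (derivative^[k] (rodriguesBase p)).roots.toFinset :=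
    fun k hk x hx => by
      rw [Multiset.mem_toFinset, mem_roots (hne k hk)]
      exact eval_iterate_derivative_rodriguesBase hk hx
  induction k with
  | zero =>
    have : ({1, -1} : Finset ℝ) ⊆ (derivative^[0] (rodriguesBase p)).roots.toFinset := by
      intro x hx
      simp only [Finset.mem_insert, Finset.mem_singleton] at hx
      exact hmem 0 hk x (by rcases hx with rfl | rfl <;> norm_num)
    refine le_trans ?_ (Finset.card_le_card this)
    rw [Finset.card_pair (by norm_num)]
  | succ k ih =>
    have h1 := ih (by omega)
    have h2 := card_roots_toFinset_le_card_roots_derivative_sdiff_roots_succ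
      (derivative^[k] (rodriguesBase p))
    rw [← Function.iterate_succ_apply' derivative] at h2
    set R := (derivative^[k + 1] (rodriguesBase p)).roots.toFinset with hR
    set R' := (derivative^[k] (rodriguesBase p)).roots.toFinset with hR'
    have h3 : (R \ R') ∪ {1, -1} ⊆ R := by
      refine Finset.union_subset Finset.sdiff_subset fun x hx => ?_
      simp only [Finset.mem_insert, Finset.mem_singleton] at hx
      exact hmem (k + 1) hk x (by rcases hx with rfl | rfl <;> norm_num)
    have h4 : Disjoint (R \ R') ({1, -1} : Finset ℝ) := by
      rw [Finset.disjoint_right]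
      intro x hx hx2
      simp only [Finset.mem_insert, Finset.mem_singleton] at hx
      exact (Finset.mem_sdiff.1 hx2).2
        (hmem k (by omega) x (by rcases hx with rfl | rfl <;> norm_num))
    have h5 := Finset.card_le_card h3
    rw [Finset.card_union_of_disjoint h4, Finset.card_pair (by norm_num)] at h5
    omega

lemma card_roots_derivative_legendre {p : ℕ} (hp : 0 < p) :
    p ≤ (derivative (legendre p)).roots.toFinset.card + 1 := by
  have h1 := card_roots_iterate_derivative (p := p) (p - 1) (by omega)
  have h2 := card_roots_toFinset_le_derivative (derivative^[p - 1] (rodriguesBase p))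
  rw [← Function.iterate_succ_apply' derivative, show (p - 1).succ = p by omega] at h2
  have h3 := card_roots_toFinset_le_derivative (legendre p)
  have h4 : (legendre p).roots = (derivative^[p] (rodriguesBase p)).roots := by
    rw [legendre, roots_C_mul _ (by positivity)]
  rw [h4] at h3
  omega

lemma gll_poly_ne_zero {p : ℕ} (hp : 0 < p) :
    ((1 - X ^ 2) * derivative (legendre p) : ℝ[X]) ≠ 0 := by
  have h3 : (1 - X ^ 2 : ℝ[X]) ≠ 0 := by
    intro h0
    have := natDegree_one_sub_X_sq
    simp [h0] at this
  exact mul_ne_zero h3 (derivative_legendre_ne_zero hp)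

lemma mem_gllNodes {p : ℕ} (hp : 0 < p) {x : ℝ} :
    x ∈ gllNodes p ↔ x = 1 ∨ x = -1 ∨ (derivative (legendre p)).eval x = 0 := by
  rw [gllNodes, Multiset.mem_toFinset, mem_roots (gll_poly_ne_zero hp), IsRoot, eval_mul,
    mul_eq_zero, ← or_assoc]
  refine or_congr ?_ Iff.rfl
  simp only [eval_sub, eval_one, eval_pow, eval_X]
  rw [sub_eq_zero, eq_comm, sq_eq_one_iff]

lemma one_mem_gllNodes {p : ℕ} (hp : 0 < p) : (1 : ℝ) ∈ gllNodes p := (mem_gllNodes hp).2 (.inl rfl)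

lemma neg_one_mem_gllNodes {p : ℕ} (hp : 0 < p) : (-1 : ℝ) ∈ gllNodes p :=
  (mem_gllNodes hp).2 (.inr (.inl rfl))

lemma mem_Icc_of_mem_gllNodes {p : ℕ} (hp : 0 < p) {x : ℝ} (hx : x ∈ gllNodes p) :
    x ∈ Set.Icc (-1 : ℝ) 1 := by
  rcases (mem_gllNodes hp).1 hx with rfl | rfl | h
  · simp
  · simp
  · exact Set.Ioo_subset_Icc_self (mem_Ioo_of_isRoot_derivative_legendre hp h)

lemma natDegree_gll_poly {p : ℕ} (hp : 0 < p) :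
    ((1 - X ^ 2) * derivative (legendre p) : ℝ[X]).natDegree = p + 1 := by
  have h0 := gll_poly_ne_zero hp
  rw [natDegree_mul (left_ne_zero_of_mul h0) (right_ne_zero_of_mul h0), natDegree_one_sub_X_sq]
  have h1 : (derivative (legendre p)).coeff (p - 1) ≠ 0 := by
    rw [coeff_derivative, show p - 1 + 1 = p by omega]
    exact mul_ne_zero (coeff_legendre_ne_zero p) (by positivity)
  have h2 := le_natDegree_of_ne_zero h1
  have h3 := natDegree_derivative_le (legendre p)
  rw [natDegree_legendre] at h3
  omega

lemma card_gllNodes {p : ℕ} (hp : 0 < p) : (gllNodes p).card = p + 1 := by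
  apply le_antisymm
  · exact (Multiset.toFinset_card_le _).trans ((card_roots' _).trans (natDegree_gll_poly hp).le)
  · have h3 : (derivative (legendre p)).roots.toFinset ∪ {1, -1} ⊆ gllNodes p := by
      intro x hx
      rw [mem_gllNodes hp]
      simp only [Finset.mem_union, Multiset.mem_toFinset, mem_roots (derivative_legendre_ne_zero hp),
        IsRoot, Finset.mem_insert, Finset.mem_singleton] at hx
      tauto
    have h4 : Disjoint (derivative (legendre p)).roots.toFinset ({1, -1} : Finset ℝ) := by
      rw [Finset.disjoint_right]
      intro x hx hx2
      rw [Multiset.mem_toFinset, mem_roots (derivative_legendre_ne_zero hp)] at hx2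
      have := mem_Ioo_of_isRoot_derivative_legendre hp hx2
      simp only [Finset.mem_insert, Finset.mem_singleton] at hx
      rcases hx with rfl | rfl <;> simp at this
    have h5 := Finset.card_le_card h3
    rw [Finset.card_union_of_disjoint h4, Finset.card_pair (by norm_num)] at h5
    have := card_roots_derivative_legendre hp
    omega

lemma gll_poly_eq {p : ℕ} (hp : 0 < p) : ∃ c : ℝ, c ≠ 0 ∧
    Lagrange.nodal (gllNodes p) id = C c * ((1 - X ^ 2) * derivative (legendre p)) := by
  set N : ℝ[X] := (1 - X ^ 2) * derivative (legendre p) with hN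
  have h0 : N ≠ 0 := gll_poly_ne_zero hp
  have hc : N.roots.toFinset.card = p + 1 := card_gllNodes hp
  have hcard : Multiset.card N.roots = N.natDegree :=
    le_antisymm (card_roots' _) (by
      rw [natDegree_gll_poly hp, ← hc]; exact Multiset.toFinset_card_le _)
  have hnd : N.roots.Nodup := by
    rw [← Multiset.toFinset_card_eq_card_iff_nodup, hc, hcard, natDegree_gll_poly hp]
  have h1 := C_leadingCoeff_mul_prod_multiset_X_sub_C hcard
  refine ⟨N.leadingCoeff⁻¹, inv_ne_zero (leadingCoeff_ne_zero.2 h0), ?_⟩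
  have h2 : Lagrange.nodal (gllNodes p) id = (N.roots.map fun a => X - C a).prod := by
    rw [Lagrange.nodal_eq, gllNodes, Finset.prod, Multiset.toFinset_val, hnd.dedup]
    rfl
  calc _ = C N.leadingCoeff⁻¹ * (C N.leadingCoeff * (N.roots.map fun a => X - C a).prod) := by
        rw [h2, ← mul_assoc, ← C_mul, inv_mul_cancel₀ (leadingCoeff_ne_zero.2 h0), C_1, one_mul]
    _ = _ := by rw [h1]

/-- The Lagrange basis polynomial at the Gauss-Legendre-Lobatto node `t`. -/
abbrev gllBasis (p : ℕ) (t : ℝ) : ℝ[X] := Lagrange.basis (gllNodes p) id t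

/-- The Gauss-Legendre-Lobatto quadrature weight of the node `t`. -/
def gllWeight (p : ℕ) (t : ℝ) : ℝ := polyIntegral (gllBasis p t)

lemma gllBasis_self {p : ℕ} {t : ℝ} (ht : t ∈ gllNodes p) : (gllBasis p t).eval t = 1 :=
  Lagrange.eval_basis_self (v := id) (Set.injOn_id _) ht

lemma gllBasis_of_ne {p : ℕ} {s t : ℝ} (ht : t ∈ gllNodes p) (h : s ≠ t) :
    (gllBasis p s).eval t = 0 :=
  Lagrange.eval_basis_of_ne (v := id) h ht

lemma natDegree_gllBasis {p : ℕ} (hp : 0 < p) {t : ℝ} (ht : t ∈ gllNodes p) :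
    (gllBasis p t).natDegree = p := by
  rw [gllBasis, Lagrange.natDegree_basis (Set.injOn_id _) ht, card_gllNodes hp, Nat.add_sub_cancel]

lemma eq_sum_gllBasis {p : ℕ} (hp : 0 < p) {P : ℝ[X]} (h : P.natDegree ≤ p) :
    P = ∑ t ∈ gllNodes p, C (P.eval t) * gllBasis p t := by
  have := Lagrange.eq_interpolate (f := P) (s := gllNodes p) (v := id) (Set.injOn_id _)
    (by
      rw [card_gllNodes hp]
      exact (degree_le_of_natDegree_le h).trans_lt (by exact_mod_cast Nat.lt_succ_self p))
  rw [Lagrange.interpolate_apply] at this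
  exact this

/-- A polynomial of degree at most `p` that vanishes at the `p + 1` nodes is zero. -/
lemma eq_zero_of_eval_gllNodes {p : ℕ} (hp : 0 < p) {P : ℝ[X]} (h : P.natDegree ≤ p)
    (h0 : ∀ t ∈ gllNodes p, P.eval t = 0) : P = 0 := by
  rw [eq_sum_gllBasis hp h]
  exact Finset.sum_eq_zero fun t ht => by rw [h0 t ht]; simp

/-- The quadrature formula is exact up to degree `2p - 1`: the nodal polynomial is a multiple of
`(1 - x²) L_p'`, hence orthogonal to polynomials of degree at most `p - 2`. -/
lemma gll_quadrature {p : ℕ} (hp : 1 < p) {f : ℝ[X]} (hf : f.natDegree < 2 * p) :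
    ∑ t ∈ gllNodes p, gllWeight p t * f.eval t = polyIntegral f := by
  have hp0 : 0 < p := by omega
  obtain ⟨c, -, hc⟩ := gll_poly_eq hp0
  set N : ℝ[X] := Lagrange.nodal (gllNodes p) id with hN
  have hm : N.Monic := Lagrange.nodal_monic
  have hNd : N.natDegree = p + 1 := by rw [hN, Lagrange.natDegree_nodal, card_gllNodes hp0]
  have hdiv := modByMonic_add_div f N
  set r := f %ₘ N with hr
  set Q := f /ₘ N with hQ
  have hQd : Q.natDegree + 1 < p := by
    have := natDegree_divByMonic f hm
    rw [← hQ, hNd] at this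
    omega
  have hrd : r.natDegree ≤ p := by
    have := natDegree_modByMonic_lt f hm (by intro h; rw [h] at hNd; simp at hNd)
    rw [← hr, hNd] at this
    omega
  have hint : polyIntegral (N * Q) = 0 := by
    rw [hc, mul_assoc, polyIntegral_C_mul, polyIntegral_weight_derivative_legendre_mul hQd, mul_zero]
  have hev : ∀ t ∈ gllNodes p, f.eval t = r.eval t := fun t ht => by
    have : N.eval t = 0 := Lagrange.eval_nodal_at_node (v := id) ht
    rw [← hdiv, eval_add, eval_mul, this, zero_mul, add_zero]
  rw [← hdiv, map_add, hint, add_zero, hdiv]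
  conv_rhs => rw [eq_sum_gllBasis hp0 hrd, map_sum]
  refine Finset.sum_congr rfl fun t ht => ?_
  rw [hev t ht, polyIntegral_C_mul, gllWeight, mul_comm]

lemma polyIntegral_weight_derivative_legendre_sq {p : ℕ} (hp : 0 < p) :
    polyIntegral ((1 - X ^ 2) * derivative (legendre p) * derivative (legendre p)) =
      p * (p + 1) * polyIntegral (legendre p ^ 2) := by
  rw [polyIntegral_weight_mul_derivative, legendre_ode hp, mul_neg, map_neg, neg_neg,
    show legendre p * (C ((p : ℝ) * (p + 1)) * legendre p) =
      C ((p : ℝ) * (p + 1)) * legendre p ^ 2 by ring, polyIntegral_C_mul]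

/-- The splitting `P = g + c L_p` with `deg g < p`. -/
lemma exists_eq_add_legendre {p : ℕ} (hp : 0 < p) {P : ℝ[X]} (hP : P.natDegree ≤ p) :
    ∃ (g : ℝ[X]) (c : ℝ), g.natDegree < p ∧ P = g + C c * legendre p := by
  refine ⟨P - C (P.coeff p / (legendre p).coeff p) * legendre p,
    P.coeff p / (legendre p).coeff p, natDegree_lt_of_coeff_eq_zero hp ?_ ?_, by ring⟩
  · exact (natDegree_sub_le _ _).trans (max_le hP ((natDegree_C_mul_le _ _).trans
      (natDegree_legendre_le p)))
  · rw [coeff_sub, coeff_C_mul, div_mul_cancel₀ _ (coeff_legendre_ne_zero p), sub_self]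

lemma polyIntegral_add_legendre_sq {p : ℕ} {g : ℝ[X]} (hg : g.natDegree < p) (c : ℝ) :
    polyIntegral ((g + C c * legendre p) ^ 2) =
      polyIntegral (g ^ 2) + c ^ 2 * polyIntegral (legendre p ^ 2) := by
  rw [show (g + C c * legendre p) ^ 2 = g ^ 2 + C (2 * c) * (legendre p * g) +
    C (c ^ 2) * legendre p ^ 2 by simp only [C_mul, C_pow, C_ofNat]; ring, map_add, map_add,
    polyIntegral_C_mul, polyIntegral_C_mul, polyIntegral_legendre_mul hg]
  ring

/-- On `L_p²`, which has degree `2p`, the quadrature overestimates the integral by the factor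
`2 + 1 / p`: subtracting `(x² - 1) L_p'² / p²`, which vanishes at all nodes, cancels the leading term. -/
lemma gll_quadrature_legendre_sq {p : ℕ} (hp : 1 < p) :
    ∑ t ∈ gllNodes p, gllWeight p t * (legendre p).eval t ^ 2 =
      (2 + 1 / (p : ℝ)) * polyIntegral (legendre p ^ 2) := by
  have hp0 : 0 < p := by omega
  have hpR : (p : ℝ) ≠ 0 := by positivity
  set f : ℝ[X] := legendre p ^ 2 +
    C (1 / (p : ℝ) ^ 2) * ((1 - X ^ 2) * derivative (legendre p) * derivative (legendre p)) with hf
  have hd' : (derivative (legendre p)).natDegree ≤ p - 1 :=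
    (natDegree_derivative_le _).trans (by rw [natDegree_legendre])
  have h1d : ((1 - X ^ 2) * derivative (legendre p)).natDegree ≤ p + 1 := by
    rw [natDegree_gll_poly hp0]
  have hle : f.natDegree ≤ 2 * p := by
    refine natDegree_add_le_of_degree_le ?_ ((natDegree_C_mul_le _ _).trans ?_)
    · exact natDegree_pow_le.trans (by rw [natDegree_legendre])
    · exact natDegree_mul_le.trans (by omega)
  have hcoef : f.coeff (2 * p) = 0 := by
    have e1 : (legendre p ^ 2).coeff (2 * p) = (legendre p).coeff p ^ 2 := by
      rw [mul_comm, ← coeff_pow_of_natDegree_le (natDegree_legendre_le p)]; ring_nf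
    have e2 : ((1 - X ^ 2) * derivative (legendre p)).coeff (p + 1) =
        -(p * (legendre p).coeff p) := by
      have := coeff_derivative_weight_derivative hp0 (natDegree_legendre_le p)
      rw [coeff_derivative] at this
      have h2 : (p : ℝ) + 1 ≠ 0 := by positivity
      field_simp at this
      linarith
    have e3 : ((1 - X ^ 2) * derivative (legendre p) * derivative (legendre p)).coeff
        ((p + 1) + (p - 1)) = -(p * (legendre p).coeff p) * (p * (legendre p).coeff p) := by
      rw [coeff_mul_add_eq_of_natDegree_le h1d hd', e2, coeff_derivative,
        show p - 1 + 1 = p by omega]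
      push_cast [Nat.cast_sub (show 1 ≤ p by omega)]
      ring
    rw [show p + 1 + (p - 1) = 2 * p by omega] at e3
    rw [hf, coeff_add, coeff_C_mul, e1, e3]
    field_simp
    ring
  have hlt : f.natDegree < 2 * p := natDegree_lt_of_coeff_eq_zero (by omega) hle hcoef
  have hq := gll_quadrature hp hlt
  have hev : ∀ t ∈ gllNodes p, f.eval t = (legendre p).eval t ^ 2 := fun t ht => by
    have h0 : ((1 - X ^ 2) * derivative (legendre p) : ℝ[X]).eval t = 0 :=
      (mem_roots (gll_poly_ne_zero hp0)).1 (Multiset.mem_toFinset.1 ht)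
    rw [hf, eval_add, eval_pow, eval_mul, eval_mul, h0]
    ring
  rw [Finset.sum_congr rfl fun t ht => by rw [hev t ht]] at hq
  rw [hq, hf, map_add, polyIntegral_C_mul, polyIntegral_weight_derivative_legendre_sq hp0]
  field_simp
  ring

lemma gll_quadrature_sq {p : ℕ} (hp : 1 < p) {g : ℝ[X]} (hg : g.natDegree < p) (c : ℝ) :
    ∑ t ∈ gllNodes p, gllWeight p t * (g + C c * legendre p).eval t ^ 2 =
      polyIntegral (g ^ 2) + c ^ 2 * ((2 + 1 / (p : ℝ)) * polyIntegral (legendre p ^ 2)) := by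
  rw [← gll_quadrature_legendre_sq hp]
  have hd : (g ^ 2 + C (2 * c) * (legendre p * g)).natDegree < 2 * p := by
    refine (natDegree_add_le_of_degree_le (n := 2 * p - 1) ?_
      ((natDegree_C_mul_le _ _).trans ?_)).trans_lt (by omega)
    · exact natDegree_pow_le.trans (by omega)
    · exact natDegree_mul_le.trans (by rw [natDegree_legendre]; omega)
  have hq := gll_quadrature hp hd
  rw [map_add, polyIntegral_C_mul, polyIntegral_legendre_mul hg, mul_zero, add_zero] at hq
  rw [← hq, Finset.mul_sum, ← Finset.sum_add_distrib]
  refine Finset.sum_congr rfl fun t _ => ?_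
  simp only [eval_add, eval_mul, eval_pow, eval_C]
  ring

lemma polyIntegral_sq_le_gll {p : ℕ} (hp : 1 < p) {P : ℝ[X]} (hP : P.natDegree ≤ p) :
    polyIntegral (P ^ 2) ≤ ∑ t ∈ gllNodes p, gllWeight p t * P.eval t ^ 2 := by
  obtain ⟨g, c, hg, rfl⟩ := exists_eq_add_legendre (by omega) hP
  rw [gll_quadrature_sq hp hg, polyIntegral_add_legendre_sq hg]
  have h1 := mul_nonneg (sq_nonneg c) (polyIntegral_sq_nonneg (legendre p))
  have h2 : 0 ≤ 1 / (p : ℝ) := by positivity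
  nlinarith [mul_nonneg h2 h1]

lemma gll_le_polyIntegral_sq {p : ℕ} (hp : 1 < p) {P : ℝ[X]} (hP : P.natDegree ≤ p) :
    ∑ t ∈ gllNodes p, gllWeight p t * P.eval t ^ 2 ≤ 3 * polyIntegral (P ^ 2) := by
  obtain ⟨g, c, hg, rfl⟩ := exists_eq_add_legendre (by omega) hP
  rw [gll_quadrature_sq hp hg, polyIntegral_add_legendre_sq hg]
  have h1 := mul_nonneg (sq_nonneg c) (polyIntegral_sq_nonneg (legendre p))
  have h2 : 1 / (p : ℝ) ≤ 1 := by
    rw [div_le_one (by positivity)]; exact_mod_cast hp.le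
  nlinarith [mul_le_mul_of_nonneg_right h2 h1, polyIntegral_sq_nonneg g]

lemma sum_gllNodes_eq_single {p : ℕ} {t : ℝ} (ht : t ∈ gllNodes p) (f : ℝ → ℝ)
    (h : ∀ s ∈ gllNodes p, s ≠ t → f s = 0) : ∑ s ∈ gllNodes p, f s = f t :=
  Finset.sum_eq_single t h fun h' => absurd ht h'

lemma gllWeight_pos {p : ℕ} (hp : 1 < p) {t : ℝ} (ht : t ∈ gllNodes p) : 0 < gllWeight p t := by
  have h := polyIntegral_sq_le_gll hp (natDegree_gllBasis (by omega) ht).le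
  rw [sum_gllNodes_eq_single ht _ fun s hs hst => by rw [gllBasis_of_ne hs hst.symm]; ring,
    gllBasis_self ht] at h
  have h0 : polyIntegral (gllBasis p t ^ 2) ≠ 0 := fun h0 => by
    have h1 := gllBasis_self ht
    rw [eq_zero_of_polyIntegral_sq h0] at h1
    simp at h1
  have := (polyIntegral_sq_nonneg (gllBasis p t)).lt_of_ne' h0
  linarith

/-- At an endpoint, Legendre's differential equation makes `L_p` a multiple of `L_p'`, whose zeros are
interior. -/
lemma eval_legendre_ne_zero {p : ℕ} (hp : 0 < p) {a : ℝ} (ha : a = 1 ∨ a = -1) :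
    (legendre p).eval a ≠ 0 := by
  intro h
  have hd : (derivative (legendre p)).IsRoot a := by
    rcases ha with rfl | rfl
    · have := eval_derivative_legendre_one hp
      rw [h] at this
      simp only [IsRoot]; linarith
    · have := eval_derivative_legendre_neg_one hp
      rw [h] at this
      simp only [IsRoot]; linarith
  have := mem_Ioo_of_isRoot_derivative_legendre hp hd
  rcases ha with rfl | rfl <;> simp at this

/-- The endpoint weights: apply the quadrature to `(1 ± x) L_p'`, which vanishes at the other nodes. -/
lemma gllWeight_one {p : ℕ} (hp : 1 < p) : gllWeight p 1 = 2 / (p * (p + 1)) := by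
  have hp0 : 0 < p := by omega
  have hd' := natDegree_derivative_le (legendre p)
  rw [natDegree_legendre] at hd'
  have h := gll_quadrature hp (f := derivative (legendre p) * (X - C (-1)))
    (natDegree_mul_le.trans_lt (by rw [natDegree_X_sub_C]; omega))
  have hL : polyIntegral (legendre p) = 0 := by
    simpa using polyIntegral_legendre_mul (p := p) (Q := 1) (by simpa using hp0)
  rw [sum_gllNodes_eq_single (one_mem_gllNodes hp0) _ fun s hs hst => by
      rcases (mem_gllNodes hp0).1 hs with rfl | rfl | h
      · exact absurd rfl hst
      · simp
      · simp [h], polyIntegral_derivative_mul] at h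
  simp [hL] at h
  have h1 := eval_derivative_legendre_one hp0
  have h2 := eval_legendre_ne_zero hp0 (.inl rfl)
  have hpR : (0 : ℝ) < p := by positivity
  rw [eq_div_iff (by positivity)]
  apply mul_right_cancel₀ h2
  linear_combination h - gllWeight p 1 * h1

lemma gllWeight_neg_one {p : ℕ} (hp : 1 < p) : gllWeight p (-1) = 2 / (p * (p + 1)) := by
  have hp0 : 0 < p := by omega
  have hd' := natDegree_derivative_le (legendre p)
  rw [natDegree_legendre] at hd'
  have h := gll_quadrature hp (f := derivative (legendre p) * (X - C 1))
    (natDegree_mul_le.trans_lt (by rw [natDegree_X_sub_C]; omega))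
  have hL : polyIntegral (legendre p) = 0 := by
    simpa using polyIntegral_legendre_mul (p := p) (Q := 1) (by simpa using hp0)
  rw [sum_gllNodes_eq_single (neg_one_mem_gllNodes hp0) _ fun s hs hst => by
      rcases (mem_gllNodes hp0).1 hs with rfl | rfl | h
      · simp
      · exact absurd rfl hst
      · simp [h], polyIntegral_derivative_mul] at h
  simp [hL] at h
  have h1 := eval_derivative_legendre_neg_one hp0
  have h2 := eval_legendre_ne_zero hp0 (.inr rfl)
  have hpR : (0 : ℝ) < p := by positivity
  rw [eq_div_iff (by positivity)]
  apply mul_right_cancel₀ h2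
  linear_combination h + gllWeight p (-1) * h1

lemma iterate_derivative_comp_neg_X (P : ℝ[X]) (k : ℕ) :
    derivative^[k] (P.comp (-X)) = C ((-1) ^ k) * (derivative^[k] P).comp (-X) := by
  induction k with
  | zero => simp
  | succ k ih =>
    rw [Function.iterate_succ_apply', Function.iterate_succ_apply', ih, derivative_C_mul,
      derivative_comp]
    simp only [derivative_neg, derivative_X, pow_succ, C_mul]
    simp

lemma legendre_comp_neg (p : ℕ) : (legendre p).comp (-X) = C ((-1) ^ p) * legendre p := by
  have h := iterate_derivative_comp_neg_X (rodriguesBase p) p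
  have e : (rodriguesBase p).comp (-X) = rodriguesBase p := by simp [rodriguesBase]
  rw [e] at h
  have h2 : (derivative^[p] (rodriguesBase p)).comp (-X) =
      C ((-1) ^ p) * derivative^[p] (rodriguesBase p) := by
    nth_rw 2 [h]
    rw [← mul_assoc, ← C_mul, ← mul_pow]
    simp
  rw [legendre, mul_comp, C_comp, h2]
  ring

lemma neg_mem_gllNodes {p : ℕ} (hp : 0 < p) {t : ℝ} (ht : t ∈ gllNodes p) : -t ∈ gllNodes p := by
  rw [mem_gllNodes hp] at ht ⊢
  rcases ht with rfl | rfl | h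
  · simp
  · simp
  · refine .inr (.inr ?_)
    have := congrArg (eval t) (congrArg derivative (legendre_comp_neg p))
    rw [derivative_comp, derivative_C_mul] at this
    simpa [h] using this

lemma gllWeight_neg {p : ℕ} (hp : 1 < p) {t : ℝ} (ht : t ∈ gllNodes p) :
    gllWeight p (-t) = gllWeight p t := by
  have hp0 : 0 < p := by omega
  have hd : ((gllBasis p t).comp (-X)).natDegree < 2 * p := by
    rw [natDegree_comp, natDegree_neg, natDegree_X, natDegree_gllBasis hp0 ht]
    omega
  have h := gll_quadrature hp hd
  rw [sum_gllNodes_eq_single (neg_mem_gllNodes hp0 ht) _ fun s hs hst => by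
    rw [eval_comp, eval_neg, eval_X, gllBasis_of_ne (neg_mem_gllNodes hp0 hs)
      (fun h => hst (by rw [h, neg_neg])), mul_zero], polyIntegral_comp_neg] at h
  simpa [gllBasis_self ht, gllWeight] using h

/-- The `p`-version trace inequality on an interval, read off from the endpoint weights. -/
lemma eval_sq_le_of_endpoint {p : ℕ} (hp : 1 < p) {P : ℝ[X]} (hP : P.natDegree ≤ p) {a : ℝ}
    (ha : a = 1 ∨ a = -1) : P.eval a ^ 2 ≤ 3 * p ^ 2 * polyIntegral (P ^ 2) := by
  have hp0 : 0 < p := by omega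
  have hmem : a ∈ gllNodes p := by
    rcases ha with rfl | rfl
    exacts [one_mem_gllNodes hp0, neg_one_mem_gllNodes hp0]
  have hw : gllWeight p a = 2 / (p * (p + 1)) := by
    rcases ha with rfl | rfl
    exacts [gllWeight_one hp, gllWeight_neg_one hp]
  have h1 := Finset.single_le_sum (f := fun t => gllWeight p t * P.eval t ^ 2)
    (fun t ht => mul_nonneg (gllWeight_pos hp ht).le (sq_nonneg _)) hmem
  have h2 := h1.trans (gll_le_polyIntegral_sq hp hP)
  simp only [hw] at h2
  have hpR : (1 : ℝ) ≤ p := by exact_mod_cast hp.le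
  have h0 := polyIntegral_sq_nonneg P
  rw [div_mul_eq_mul_div, div_le_iff₀ (by positivity)] at h2
  nlinarith [mul_nonneg h0 (show (0 : ℝ) ≤ p * (p - 1) by nlinarith)]

lemma integral_sq_comp_affine_le (P : ℝ[X]) {x : ℝ} (hx : x ∈ Set.Icc (0 : ℝ) 1) :
    polyIntegral ((P.comp (C ((x + 1) / 2) * X + C ((x - 1) / 2))) ^ 2) ≤
      2 * polyIntegral (P ^ 2) := by
  simp only [polyIntegral_def, eval_pow, eval_comp, eval_add, eval_mul, eval_C, eval_X]
  have hc : (x + 1) / 2 ≠ 0 := by linarith [hx.1]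
  rw [intervalIntegral.integral_comp_mul_add (fun y => P.eval y ^ 2) hc,
    show (x + 1) / 2 * -1 + (x - 1) / 2 = -1 by ring, show (x + 1) / 2 * 1 + (x - 1) / 2 = x by ring]
  have hii : ∀ a b : ℝ, IntervalIntegrable (fun y => P.eval y ^ 2) volume a b := fun a b =>
    (P.continuous.pow 2).intervalIntegrable a b
  have hle : ∫ y in (-1 : ℝ)..x, P.eval y ^ 2 ≤ ∫ y in (-1 : ℝ)..1, P.eval y ^ 2 :=
    intervalIntegral.integral_mono_interval le_rfl (by linarith [hx.1]) hx.2
      (Filter.Eventually.of_forall fun y => sq_nonneg _) (hii _ _)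
  have h0 : 0 ≤ ∫ y in (-1 : ℝ)..x, P.eval y ^ 2 :=
    intervalIntegral.integral_nonneg (by linarith [hx.1]) fun y _ => sq_nonneg _
  rw [smul_eq_mul]
  have : ((x + 1) / 2)⁻¹ ≤ 2 := by
    rw [inv_le_comm₀ (by linarith [hx.1]) (by norm_num)]; linarith [hx.1]
  calc _ ≤ 2 * ∫ y in (-1 : ℝ)..x, P.eval y ^ 2 := mul_le_mul_of_nonneg_right this h0
    _ ≤ _ := by linarith

/-- The `L^∞`-`L²` inverse inequality: the endpoint estimate on the longer of `[-1,x]` and `[x,1]`. -/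
lemma eval_sq_le {p : ℕ} (hp : 1 < p) {P : ℝ[X]} (hP : P.natDegree ≤ p) {x : ℝ}
    (hx : x ∈ Set.Icc (-1 : ℝ) 1) : P.eval x ^ 2 ≤ 6 * p ^ 2 * polyIntegral (P ^ 2) := by
  wlog h0 : 0 ≤ x generalizing P x
  · have h := this (P := P.comp (-X)) (x := -x)
      (by rwa [natDegree_comp, natDegree_neg, natDegree_X, mul_one])
      ⟨by linarith [hx.2], by linarith [hx.1]⟩ (by linarith)
    rwa [← pow_comp, polyIntegral_comp_neg, eval_comp, eval_neg, eval_X, neg_neg] at h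
  · set R : ℝ[X] := P.comp (C ((x + 1) / 2) * X + C ((x - 1) / 2)) with hR
    have hd : R.natDegree ≤ p := by
      refine natDegree_comp_le.trans ?_
      have : (C ((x + 1) / 2) * X + C ((x - 1) / 2) : ℝ[X]).natDegree ≤ 1 := natDegree_linear_le
      nlinarith
    have h1 := eval_sq_le_of_endpoint hp hd (.inl rfl)
    have h2 := integral_sq_comp_affine_le P ⟨h0, hx.2⟩
    rw [← hR] at h2
    have h3 : R.eval 1 = P.eval x := by
      rw [hR, eval_comp]; simp; ring_nf
    rw [h3] at h1
    have : (0 : ℝ) ≤ 3 * p ^ 2 := by positivity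
    nlinarith [mul_le_mul_of_nonneg_left h2 this]

/-- `∫ (1 - x²) P'² ≤ p (p + 1) ∫ P²`, by expansion in Legendre polynomials. -/
lemma polyIntegral_weight_derivative_sq_le (p : ℕ) {P : ℝ[X]} (hP : P.natDegree ≤ p) :
    polyIntegral ((1 - X ^ 2) * derivative P * derivative P) ≤
      p * (p + 1) * polyIntegral (P ^ 2) := by
  induction p generalizing P with
  | zero =>
    rw [derivative_of_natDegree_zero (by omega)]
    simp
  | succ p ih =>
    obtain ⟨g, c, hg, rfl⟩ := exists_eq_add_legendre (Nat.succ_pos p) hP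
    have h1 := ih (P := g) (by omega)
    have h2 := polyIntegral_weight_derivative_legendre_sq (Nat.succ_pos p)
    have h3 : polyIntegral ((1 - X ^ 2) * derivative (legendre (p + 1)) * derivative g) = 0 := by
      rw [polyIntegral_weight_mul_derivative, polyIntegral_legendre_mul, neg_zero]
      rcases Nat.eq_zero_or_pos g.natDegree with h | h
      · rw [derivative_of_natDegree_zero h]; simp
      · have := natDegree_derivative_one_sub_X_sq_mul (g := derivative g) (m := g.natDegree - 1)
          (natDegree_derivative_le _)
        omega
    rw [polyIntegral_add_legendre_sq hg, derivative_add, derivative_C_mul,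
      show (1 - X ^ 2) * (derivative g + C c * derivative (legendre (p + 1))) *
        (derivative g + C c * derivative (legendre (p + 1))) =
        (1 - X ^ 2) * derivative g * derivative g +
        C (2 * c) * ((1 - X ^ 2) * derivative (legendre (p + 1)) * derivative g) +
        C (c ^ 2) * ((1 - X ^ 2) * derivative (legendre (p + 1)) * derivative (legendre (p + 1))) by
        simp only [C_mul, C_pow, C_ofNat]; ring, map_add, map_add, polyIntegral_C_mul,
      polyIntegral_C_mul, h3, h2]
    have h4 := polyIntegral_sq_nonneg g
    push_cast at *
    nlinarith [mul_nonneg h4 (show (0 : ℝ) ≤ 2 * (p + 1) by positivity)]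

/-- The weight `1 - x²` costs a factor `p²` on polynomials of degree at most `p`: by the
`L^∞`-`L²` inequality, at least half of the mass lies at distance at least `δ = 1 / (24 p²)` from the endpoints. -/
lemma polyIntegral_sq_le_weight {p : ℕ} (hp : 1 < p) {P : ℝ[X]} (hP : P.natDegree ≤ p) :
    polyIntegral (P ^ 2) ≤ 48 * p ^ 2 * polyIntegral ((1 - X ^ 2) * P * P) := by
  have hpR : (1 : ℝ) < p := by exact_mod_cast hp
  set δ : ℝ := 1 / (24 * p ^ 2) with hδ
  have hδ0 : 0 < δ := by positivity
  have hδ1 : δ ≤ 1 / 24 := by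
    rw [hδ]; apply one_div_le_one_div_of_le <;> nlinarith
  set I := polyIntegral (P ^ 2) with hI
  have hI0 : 0 ≤ I := polyIntegral_sq_nonneg P
  have hii : ∀ a b : ℝ, IntervalIntegrable (fun y => P.eval y ^ 2) volume a b := fun a b =>
    (P.continuous.pow 2).intervalIntegrable a b
  have hIe : I = ∫ y in (-1 : ℝ)..1, P.eval y ^ 2 := by
    rw [hI, polyIntegral_def]; simp only [eval_pow]
  have hend : ∀ a b : ℝ, -1 ≤ a → a ≤ b → b ≤ 1 →
      ∫ y in a..b, P.eval y ^ 2 ≤ (b - a) * (6 * p ^ 2 * I) := fun a b ha hab hb => by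
    calc ∫ y in a..b, P.eval y ^ 2 ≤ ∫ y in a..b, (6 * p ^ 2 * I) :=
          intervalIntegral.integral_mono_on hab (hii _ _) (by simp) fun y hy =>
            eval_sq_le hp hP ⟨ha.trans hy.1, hy.2.trans hb⟩
      _ = _ := by simp; ring
  have hsplit : ∫ y in (-1 : ℝ)..1, P.eval y ^ 2 = (∫ y in (-1 : ℝ)..(-1 + δ), P.eval y ^ 2) +
      (∫ y in (-1 + δ)..(1 - δ), P.eval y ^ 2) + ∫ y in (1 - δ)..1, P.eval y ^ 2 := by
    rw [intervalIntegral.integral_add_adjacent_intervals (hii _ _) (hii _ _),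
      intervalIntegral.integral_add_adjacent_intervals (hii _ _) (hii _ _)]
  have h1 := hend (-1) (-1 + δ) le_rfl (by linarith) (by linarith)
  have h2 := hend (1 - δ) 1 (by linarith) (by linarith) le_rfl
  have hδp : δ * (6 * p ^ 2 * I) = I / 4 := by rw [hδ]; field_simp; ring
  have hmid : I / 2 ≤ ∫ y in (-1 + δ)..(1 - δ), P.eval y ^ 2 := by
    have e1 : (-1 + δ - -1) * (6 * p ^ 2 * I) = I / 4 := by rw [← hδp]; ring
    have e2 : (1 - (1 - δ)) * (6 * p ^ 2 * I) = I / 4 := by rw [← hδp]; ring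
    linarith
  have hw : ∀ y : ℝ, ((1 - X ^ 2) * P * P).eval y = (1 - y ^ 2) * P.eval y ^ 2 := fun y => by
    simp; ring
  have hwi : ∀ a b : ℝ, IntervalIntegrable (fun y => (1 - y ^ 2) * P.eval y ^ 2) volume a b :=
    fun a b => (Continuous.mul (by fun_prop) (P.continuous.pow 2)).intervalIntegrable a b
  have h3 : ∫ y in (-1 + δ)..(1 - δ), δ * P.eval y ^ 2 ≤
      ∫ y in (-1 + δ)..(1 - δ), (1 - y ^ 2) * P.eval y ^ 2 :=
    intervalIntegral.integral_mono_on (by linarith) ((hii _ _).const_mul δ) (hwi _ _) fun y hy => by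
      refine mul_le_mul_of_nonneg_right ?_ (sq_nonneg _)
      nlinarith [hy.1, hy.2, mul_nonneg (show 0 ≤ 1 - δ - y by linarith [hy.2])
        (show 0 ≤ y - (-1 + δ) by linarith [hy.1])]
  have h4 : ∫ y in (-1 + δ)..(1 - δ), (1 - y ^ 2) * P.eval y ^ 2 ≤
      ∫ y in (-1 : ℝ)..1, (1 - y ^ 2) * P.eval y ^ 2 := by
    refine intervalIntegral.integral_mono_interval (by linarith) (by linarith) (by linarith) ?_
      (hwi _ _)
    refine (ae_restrict_iff' measurableSet_Ioc).2 (Filter.Eventually.of_forall fun y hy => ?_)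
    have : 0 ≤ 1 - y ^ 2 := by nlinarith [hy.1, hy.2]
    exact mul_nonneg this (sq_nonneg _)
  rw [intervalIntegral.integral_const_mul] at h3
  have h5 : δ * (I / 2) ≤ polyIntegral ((1 - X ^ 2) * P * P) := by
    rw [polyIntegral_def]
    simp only [hw]
    exact (mul_le_mul_of_nonneg_left hmid hδ0.le).trans (h3.trans h4)
  calc I = 48 * p ^ 2 * (δ * (I / 2)) := by rw [hδ]; field_simp; ring
    _ ≤ _ := mul_le_mul_of_nonneg_left h5 (by positivity)

/-- The inverse inequality of Schmidt, with the exponent `4` of `p`. -/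
lemma polyIntegral_derivative_sq_le {p : ℕ} (hp : 1 < p) {P : ℝ[X]} (hP : P.natDegree ≤ p) :
    polyIntegral (derivative P ^ 2) ≤ 96 * p ^ 4 * polyIntegral (P ^ 2) := by
  have h1 := polyIntegral_sq_le_weight hp
    (((natDegree_derivative_le P).trans (Nat.sub_le _ _)).trans hP)
  have h2 := polyIntegral_weight_derivative_sq_le p hP
  have h0 := polyIntegral_sq_nonneg P
  have hpR : (1 : ℝ) < p := by exact_mod_cast hp
  calc _ ≤ 48 * p ^ 2 * (p * (p + 1) * polyIntegral (P ^ 2)) :=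
        h1.trans (mul_le_mul_of_nonneg_left h2 (by positivity))
    _ ≤ 48 * p ^ 2 * (2 * p ^ 2 * polyIntegral (P ^ 2)) := by
        refine mul_le_mul_of_nonneg_left (mul_le_mul_of_nonneg_right ?_ h0) (by positivity)
        nlinarith
    _ = _ := by ring

end Legendre

/-! ### Polynomials in each variable on the reference cube -/

section Tensor

open Polynomial Function

/-- Lebesgue measure on the cube `[-1,1]^d`, as a product measure. -/
def cubeMeasure (d : ℕ) : Measure (Fin d → ℝ) :=
  Measure.pi fun _ => volume.restrict (Set.Icc (-1 : ℝ) 1)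

instance (d : ℕ) : IsFiniteMeasure (cubeMeasure d) := by
  unfold cubeMeasure; infer_instance

lemma cubeMeasure_eq (d : ℕ) :
    cubeMeasure d = (volume : Measure (Fin d → ℝ)).restrict
      (Set.univ.pi fun _ => Set.Icc (-1 : ℝ) 1) := by
  rw [cubeMeasure, volume_pi, Measure.restrict_pi_pi]

lemma integrable_cubeMeasure {d : ℕ} {f : (Fin d → ℝ) → ℝ} (hf : Continuous f) :
    Integrable f (cubeMeasure d) := by
  rw [cubeMeasure_eq]
  exact hf.continuousOn.integrableOn_compact (isCompact_univ_pi fun _ => isCompact_Icc)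

lemma continuous_insertNth {n : ℕ} (i : Fin (n + 1)) :
    Continuous fun q : ℝ × (Fin n → ℝ) => (i.insertNth q.1 q.2 : Fin (n + 1) → ℝ) :=
  Continuous.finInsertNth i continuous_fst continuous_snd

/-- Fubini's theorem on the cube, with one coordinate singled out. -/
lemma integral_cubeMeasure_insertNth {n : ℕ} (i : Fin (n + 1)) {f : (Fin (n + 1) → ℝ) → ℝ}
    (hf : Continuous f) :
    ∫ x, f x ∂cubeMeasure (n + 1) =
      ∫ y, (∫ t in (-1 : ℝ)..1, f (i.insertNth t y)) ∂cubeMeasure n := by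
  have hmp := (measurePreserving_piFinSuccAbove
    (fun _ : Fin (n + 1) => (volume : Measure ℝ).restrict (Set.Icc (-1 : ℝ) 1)) i).symm
  have h1 := hmp.integral_comp' f
  have hint : Integrable (fun q : ℝ × (Fin n → ℝ) => f (i.insertNth q.1 q.2))
      (((volume : Measure ℝ).restrict (Set.Icc (-1 : ℝ) 1)).prod (cubeMeasure n)) :=
    (hmp.integrable_comp_emb (MeasurableEquiv.measurableEmbedding _)).2 (integrable_cubeMeasure hf)
  calc ∫ x, f x ∂cubeMeasure (n + 1) = ∫ q : ℝ × (Fin n → ℝ), f (i.insertNth q.1 q.2)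
        ∂((volume : Measure ℝ).restrict (Set.Icc (-1 : ℝ) 1)).prod (cubeMeasure n) := h1.symm
    _ = _ := by
      rw [integral_prod_symm _ hint]
      refine integral_congr_ae (Filter.Eventually.of_forall fun y => ?_)
      dsimp only
      rw [intervalIntegral.integral_of_le (by norm_num), integral_Icc_eq_integral_Ioc]

/-- A continuous function that is a polynomial of degree at most `p` in each variable separately. The
tensor-product arguments need no more, and the property is evidently preserved by restriction to faces
and by signed permutations of the coordinates. -/
structure IsSepPoly {d : ℕ} (p : ℕ) (f : (Fin d → ℝ) → ℝ) : Prop where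
  continuous : Continuous f
  exists_poly : ∀ i x, ∃ P : ℝ[X], P.natDegree ≤ p ∧ ∀ t, f (update x i t) = P.eval t

lemma IsSepPoly.continuous_sq {d p : ℕ} {f : (Fin d → ℝ) → ℝ} (hf : IsSepPoly p f) :
    Continuous fun x => f x ^ 2 := hf.continuous.pow 2

lemma IsSepPoly.exists_insertNth {n p : ℕ} {f : (Fin (n + 1) → ℝ) → ℝ} (hf : IsSepPoly p f)
    (i : Fin (n + 1)) (y : Fin n → ℝ) :
    ∃ P : ℝ[X], P.natDegree ≤ p ∧ ∀ t, f (i.insertNth t y) = P.eval t := by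
  obtain ⟨P, hP, h⟩ := hf.exists_poly i (i.insertNth 0 y)
  exact ⟨P, hP, fun t => by rw [← h t, Fin.update_insertNth]⟩

lemma IsSepPoly.insertNth {n p : ℕ} {f : (Fin (n + 1) → ℝ) → ℝ} (hf : IsSepPoly p f)
    (i : Fin (n + 1)) (t : ℝ) : IsSepPoly p fun y => f (i.insertNth t y) where
  continuous := hf.continuous.comp ((continuous_insertNth i).comp
    (continuous_const.prodMk continuous_id : Continuous fun y : Fin n → ℝ => (t, y)))
  exists_poly j y := by
    obtain ⟨P, hP, h⟩ := hf.exists_poly (i.succAbove j) (i.insertNth t y)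
    exact ⟨P, hP, fun s => by rw [← h s, Fin.insertNth_update]⟩

lemma IsSepPoly.sub {d p : ℕ} {f g : (Fin d → ℝ) → ℝ} (hf : IsSepPoly p f) (hg : IsSepPoly p g) :
    IsSepPoly p fun x => f x - g x where
  continuous := hf.continuous.sub hg.continuous
  exists_poly i x := by
    obtain ⟨P, hP, h⟩ := hf.exists_poly i x
    obtain ⟨Q, hQ, h'⟩ := hg.exists_poly i x
    exact ⟨P - Q, (natDegree_sub_le _ _).trans (max_le hP hQ), fun t => by simp [h, h']⟩

lemma polyIntegral_sq_def (P : ℝ[X]) : polyIntegral (P ^ 2) = ∫ t in (-1 : ℝ)..1, P.eval t ^ 2 := by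
  simp [polyIntegral_def]

lemma continuous_integral_insertNth {n : ℕ} {f : (Fin (n + 1) → ℝ) → ℝ} (hf : Continuous f)
    (i : Fin (n + 1)) :
    Continuous fun y : Fin n → ℝ => ∫ t in (-1 : ℝ)..1, f (i.insertNth t y) :=
  intervalIntegral.continuous_parametric_intervalIntegral_of_continuous'
    (f := fun (y : Fin n → ℝ) t => f (i.insertNth t y))
    (hf.comp ((continuous_insertNth i).comp (continuous_snd.prodMk continuous_fst))) _ _

/-- The tensor-product Gauss-Legendre-Lobatto weight of the node `ξ`. -/
def tensorWeight {d : ℕ} (p : ℕ) (ξ : Fin d → ℝ) : ℝ := ∏ i, gllWeight p (ξ i)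

lemma mem_refNodes {d p : ℕ} {ξ : Fin d → ℝ} : ξ ∈ refNodes d p ↔ ∀ i, ξ i ∈ gllNodes p :=
  Fintype.mem_piFinset

lemma tensorWeight_pos {d p : ℕ} (hp : 1 < p) {ξ : Fin d → ℝ} (h : ξ ∈ refNodes d p) :
    0 < tensorWeight p ξ :=
  Finset.prod_pos fun i _ => gllWeight_pos hp (mem_refNodes.1 h i)

lemma tensorWeight_insertNth {n p : ℕ} (i : Fin (n + 1)) (t : ℝ) (η : Fin n → ℝ) :
    tensorWeight p (i.insertNth t η : Fin (n + 1) → ℝ) = gllWeight p t * tensorWeight p η := by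
  rw [tensorWeight, Fin.prod_univ_succAbove _ i]
  simp [tensorWeight]

lemma insertNth_mem_refNodes {n p : ℕ} {i : Fin (n + 1)} {t : ℝ} {η : Fin n → ℝ} :
    (i.insertNth t η : Fin (n + 1) → ℝ) ∈ refNodes (n + 1) p ↔
      t ∈ gllNodes p ∧ η ∈ refNodes n p := by
  simp only [mem_refNodes, Fin.forall_iff_succAbove i, Fin.insertNth_apply_same,
    Fin.insertNth_apply_succAbove]

lemma sum_refNodes_succ {n p : ℕ} (i : Fin (n + 1)) (g : (Fin (n + 1) → ℝ) → ℝ) :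
    ∑ ξ ∈ refNodes (n + 1) p, g ξ =
      ∑ t ∈ gllNodes p, ∑ η ∈ refNodes n p, g (i.insertNth t η) := by
  rw [← Finset.sum_product']
  symm
  refine Finset.sum_equiv (Fin.insertNthEquiv (fun _ => ℝ) i) (fun q => ?_) (fun q _ => rfl)
  rw [Finset.mem_product]
  exact insertNth_mem_refNodes.symm

lemma cube_quadrature_zero {p : ℕ} (f : (Fin 0 → ℝ) → ℝ) :
    ∑ ξ ∈ refNodes 0 p, tensorWeight p ξ * f ξ ^ 2 = ∫ x, f x ^ 2 ∂cubeMeasure 0 := by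
  rw [cubeMeasure, Measure.pi_of_empty _ 0, integral_dirac]
  rw [refNodes, Fintype.piFinset_of_isEmpty, Finset.univ_unique, Finset.sum_singleton]
  simp only [tensorWeight, Finset.univ_eq_empty, Finset.prod_empty, one_mul]
  congr 2
  exact Subsingleton.elim _ _

/-- The tensor-product quadrature does not underestimate the square of the `L²` norm. -/
lemma integral_sq_le_quadrature {n p : ℕ} (hp : 1 < p) {f : (Fin n → ℝ) → ℝ}
    (hf : IsSepPoly p f) :
    ∫ x, f x ^ 2 ∂cubeMeasure n ≤ ∑ ξ ∈ refNodes n p, tensorWeight p ξ * f ξ ^ 2 := by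
  induction n with
  | zero => exact (cube_quadrature_zero f).ge
  | succ n ih =>
    have hc := hf.continuous_sq
    rw [integral_cubeMeasure_insertNth 0 hc, sum_refNodes_succ 0]
    calc _ ≤ ∫ y, ∑ t ∈ gllNodes p, gllWeight p t * f ((0 : Fin (n + 1)).insertNth t y) ^ 2
          ∂cubeMeasure n := by
          refine integral_mono (integrable_cubeMeasure (continuous_integral_insertNth hc 0))
            (integrable_cubeMeasure (continuous_finsetSum _ fun t _ =>
              ((hf.insertNth 0 t).continuous_sq).const_mul _)) fun y => ?_
          obtain ⟨P, hP, h⟩ := hf.exists_insertNth 0 y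
          simp only [h]
          rw [← polyIntegral_sq_def]
          exact polyIntegral_sq_le_gll hp hP
      _ = ∑ t ∈ gllNodes p, gllWeight p t *
            ∫ y, f ((0 : Fin (n + 1)).insertNth t y) ^ 2 ∂cubeMeasure n := by
          rw [integral_finsetSum _ fun t _ => integrable_cubeMeasure
            (((hf.insertNth 0 t).continuous_sq).const_mul _)]
          simp_rw [integral_const_mul]
      _ ≤ _ := by
          refine Finset.sum_le_sum fun t ht => ?_
          refine (mul_le_mul_of_nonneg_left (ih (hf.insertNth 0 t)) (gllWeight_pos hp ht).le).trans
            (le_of_eq ?_)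
          simp only [tensorWeight_insertNth, Finset.mul_sum, mul_assoc]

/-- The tensor-product quadrature overestimates the square of the `L²` norm by at most `3 ^ d`. -/
lemma quadrature_le_integral_sq {n p : ℕ} (hp : 1 < p) {f : (Fin n → ℝ) → ℝ}
    (hf : IsSepPoly p f) :
    ∑ ξ ∈ refNodes n p, tensorWeight p ξ * f ξ ^ 2 ≤ 3 ^ n * ∫ x, f x ^ 2 ∂cubeMeasure n := by
  induction n with
  | zero => rw [cube_quadrature_zero, pow_zero, one_mul]
  | succ n ih =>
    have hc := hf.continuous_sq
    rw [integral_cubeMeasure_insertNth 0 hc, sum_refNodes_succ 0]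
    calc _ ≤ ∑ t ∈ gllNodes p, gllWeight p t *
            (3 ^ n * ∫ y, f ((0 : Fin (n + 1)).insertNth t y) ^ 2 ∂cubeMeasure n) := by
          refine Finset.sum_le_sum fun t ht => ?_
          refine le_trans (le_of_eq ?_)
            (mul_le_mul_of_nonneg_left (ih (hf.insertNth 0 t)) (gllWeight_pos hp ht).le)
          simp only [tensorWeight_insertNth, Finset.mul_sum, mul_assoc]
      _ = 3 ^ n * ∫ y, ∑ t ∈ gllNodes p, gllWeight p t * f ((0 : Fin (n + 1)).insertNth t y) ^ 2
          ∂cubeMeasure n := by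
          rw [integral_finsetSum _ fun t _ => integrable_cubeMeasure
            (((hf.insertNth 0 t).continuous_sq).const_mul _), Finset.mul_sum]
          simp_rw [integral_const_mul]
          exact Finset.sum_congr rfl fun t _ => by ring
      _ ≤ 3 ^ n * ∫ y, 3 * (∫ t in (-1 : ℝ)..1, f ((0 : Fin (n + 1)).insertNth t y) ^ 2)
          ∂cubeMeasure n := by
          refine mul_le_mul_of_nonneg_left (integral_mono (integrable_cubeMeasure
            (continuous_finsetSum _ fun t _ => ((hf.insertNth 0 t).continuous_sq).const_mul _))
            (integrable_cubeMeasure ((continuous_integral_insertNth hc 0).const_mul _))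
            fun y => ?_) (by positivity)
          obtain ⟨P, hP, h⟩ := hf.exists_insertNth 0 y
          simp only [h]
          rw [← polyIntegral_sq_def]
          exact gll_le_polyIntegral_sq hp hP
      _ = _ := by rw [integral_const_mul]; ring

/-- The `p`-version trace inequality on the reference cube. -/
lemma integral_face_sq_le {n p : ℕ} (hp : 1 < p) {f : (Fin (n + 1) → ℝ) → ℝ} (hf : IsSepPoly p f)
    (i : Fin (n + 1)) {a : ℝ} (ha : a = 1 ∨ a = -1) :
    ∫ y, f (i.insertNth a y) ^ 2 ∂cubeMeasure n ≤
      3 * p ^ 2 * ∫ x, f x ^ 2 ∂cubeMeasure (n + 1) := by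
  have hc := hf.continuous_sq
  rw [integral_cubeMeasure_insertNth i hc, ← integral_const_mul]
  refine integral_mono (integrable_cubeMeasure ((hf.insertNth i a).continuous_sq))
    (integrable_cubeMeasure ((continuous_integral_insertNth hc i).const_mul _)) fun y => ?_
  obtain ⟨P, hP, h⟩ := hf.exists_insertNth i y
  simp only [h]
  rw [← polyIntegral_sq_def]
  exact eval_sq_le_of_endpoint hp hP ha

/-- The `p`-version inverse inequality for a partial derivative on the reference cube. -/
lemma integral_partialDeriv_sq_le {n p : ℕ} (hp : 1 < p) {f g : (Fin (n + 1) → ℝ) → ℝ}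
    (hf : IsSepPoly p f) (hg : Continuous g) (i : Fin (n + 1))
    (hfg : ∀ x, HasDerivAt (fun t => f (update x i t)) (g x) (x i)) :
    ∫ x, g x ^ 2 ∂cubeMeasure (n + 1) ≤ 96 * p ^ 4 * ∫ x, f x ^ 2 ∂cubeMeasure (n + 1) := by
  have hc := hf.continuous_sq
  have hc' : Continuous fun x => g x ^ 2 := hg.pow 2
  rw [integral_cubeMeasure_insertNth i hc, integral_cubeMeasure_insertNth i hc',
    ← integral_const_mul]
  refine integral_mono (integrable_cubeMeasure (continuous_integral_insertNth hc' i))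
    (integrable_cubeMeasure ((continuous_integral_insertNth hc i).const_mul _)) fun y => ?_
  obtain ⟨P, hP, h⟩ := hf.exists_insertNth i y
  have hg' : ∀ t, g (i.insertNth t y) = (derivative P).eval t := fun t => by
    have h1 := hfg (i.insertNth t y)
    simp only [Fin.update_insertNth, h, Fin.insertNth_apply_same] at h1
    exact h1.unique (P.hasDerivAt t)
  simp only [h, hg']
  rw [← polyIntegral_sq_def, ← polyIntegral_sq_def]
  exact polyIntegral_derivative_sq_le hp hP

/-- The affine hull of the face `refSubface s`, in coordinates. -/
def faceHull {d : ℕ} (s : Fin d → SignType) : Set (Fin d → ℝ) :=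
  {x | ∀ i, s i ≠ 0 → x i = ((s i : SignType) : ℝ)}

lemma update_mem_faceHull {d : ℕ} {s : Fin d → SignType} {x : Fin d → ℝ} (hx : x ∈ faceHull s)
    {i : Fin d} (hi : s i = 0) (t : ℝ) : update x i t ∈ faceHull s := fun j hj => by
  have : j ≠ i := by rintro rfl; exact hj hi
  rw [update_of_ne this]; exact hx j hj

lemma sign_eq_one_or {σ : SignType} (h : σ ≠ 0) : ((σ : SignType) : ℝ) = 1 ∨ (σ : ℝ) = -1 := by
  cases σ with
  | zero => exact absurd rfl h
  | neg => right; rfl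
  | pos => left; rfl

lemma sign_mem_gllNodes {p : ℕ} (hp : 0 < p) {σ : SignType} (h : σ ≠ 0) :
    (σ : ℝ) ∈ gllNodes p := by
  rcases sign_eq_one_or h with e | e <;> rw [e]
  exacts [one_mem_gllNodes hp, neg_one_mem_gllNodes hp]

/-- Unisolvence of the tensor-product nodes on a face of the cube of any dimension. -/
lemma eq_zero_on_faceHull {d p : ℕ} (hp : 0 < p) {f : (Fin d → ℝ) → ℝ} {s : Fin d → SignType}
    (hf : ∀ i, s i = 0 → ∀ x ∈ faceHull s,
      ∃ P : ℝ[X], P.natDegree ≤ p ∧ ∀ t, f (update x i t) = P.eval t)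
    (h0 : ∀ ξ ∈ refNodes d p, ξ ∈ faceHull s → f ξ = 0) {x : Fin d → ℝ} (hx : x ∈ faceHull s) :
    f x = 0 := by
  have key : ∀ T : Finset (Fin d), ∀ x ∈ faceHull s,
      (∀ i, s i = 0 → i ∉ T → x i ∈ gllNodes p) → f x = 0 := by
    intro T
    induction T using Finset.induction with
    | empty =>
      intro x hx h
      refine h0 x (mem_refNodes.2 fun i => ?_) hx
      by_cases hi : s i = 0
      · exact h i hi (Finset.notMem_empty i)
      · rw [hx i hi]; exact sign_mem_gllNodes hp hi
    | insert i T _ ih =>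
      intro x hx h
      by_cases hi : s i = 0
      · obtain ⟨P, hP, hPe⟩ := hf i hi x hx
        have hP0 : P = 0 := eq_zero_of_eval_gllNodes hp hP fun t ht => by
          rw [← hPe]
          refine ih _ (update_mem_faceHull hx hi t) fun j hj hjT => ?_
          by_cases hji : j = i
          · subst hji; rwa [update_self]
          · rw [update_of_ne hji]
            exact h j hj (by simp [hji, hjT])
        have := hPe (x i)
        rw [update_eq_self, hP0, eval_zero] at this
        exact this
      · refine ih x hx fun j hj hjT => h j hj ?_
        have : j ≠ i := by rintro rfl; exact hi hj
        simp [this, hjT]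
  exact key Finset.univ x hx fun i _ hi => absurd (Finset.mem_univ i) hi

end Tensor

/-! ### Affine bijections between faces of the cube -/

section CubeFaces

open Function

variable {d : ℕ}

/-- The closed face `refSubface s` of the reference cube, in coordinates. -/
def cubeFace (s : Fin d → SignType) : Set (Fin d → ℝ) :=
  {x | (∀ i, x i ∈ Set.Icc (-1 : ℝ) 1) ∧ x ∈ faceHull s}

/-- The centre of the face `refSubface s`. -/
def faceCenter (s : Fin d → SignType) : Fin d → ℝ := fun i => ((s i : SignType) : ℝ)

lemma abs_sign_le (σ : SignType) : |((σ : SignType) : ℝ)| ≤ 1 := by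
  cases σ <;> simp

lemma faceCenter_mem (s : Fin d → SignType) : faceCenter s ∈ cubeFace s :=
  ⟨fun i => abs_le.1 (abs_sign_le (s i)), fun _ _ => rfl⟩

/-- The unit cube of the directions of the face `refSubface s`. -/
def dirCube (s : Fin d → SignType) : Set (Fin d → ℝ) :=
  {u | (∀ i, |u i| ≤ 1) ∧ ∀ i, s i ≠ 0 → u i = 0}

lemma add_faceCenter_mem {s : Fin d → SignType} {u : Fin d → ℝ} :
    u + faceCenter s ∈ cubeFace s ↔ u ∈ dirCube s := by
  constructor
  · rintro ⟨h1, h2⟩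
    have h3 : ∀ i, s i ≠ 0 → u i = 0 := fun i hi => by
      have := h2 i hi
      simpa [faceCenter] using this
    refine ⟨fun i => ?_, h3⟩
    by_cases hi : s i = 0
    · have := h1 i
      simpa [faceCenter, hi, abs_le] using this
    · simp [h3 i hi]
  · rintro ⟨h1, h2⟩
    refine ⟨fun i => ?_, fun i hi => by simp [faceCenter, h2 i hi]⟩
    by_cases hi : s i = 0
    · have := abs_le.1 (h1 i)
      simpa [faceCenter, hi] using this
    · have := abs_le.1 (abs_sign_le (s i))
      simpa [faceCenter, h2 i hi] using this

/-- An affine bijection between faces maps the centre to the centre, since these are the centres of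
symmetry of bounded sets. -/
lemma map_faceCenter (G : (Fin d → ℝ) ≃ᵃ[ℝ] (Fin d → ℝ)) {s t : Fin d → SignType}
    (hG : G '' cubeFace s = cubeFace t) : G (faceCenter s) = faceCenter t := by
  have hmem : ∀ x ∈ cubeFace s, G x ∈ cubeFace t := fun x hx => hG ▸ Set.mem_image_of_mem G hx
  have hlin : ∀ u, G (u + faceCenter s) = G.linear u + G (faceCenter s) := fun u => by
    have := G.map_vadd (faceCenter s) u
    simpa [vadd_eq_add] using this
  funext j
  by_cases hj : t j = 0
  · have hstep : ∀ c : ℝ, |c| ≤ 1 → |2 * G (faceCenter s) j - c| ≤ 1 := fun c hc => by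
      have hz : Pi.single j c + faceCenter t ∈ cubeFace t := add_faceCenter_mem.2
        ⟨fun i => by by_cases h : i = j <;> [(subst h; simpa using hc); simp [h]],
          fun i hi => by
            have : i ≠ j := by rintro rfl; exact hi hj
            simp [this]⟩
      rw [← hG] at hz
      obtain ⟨x, hx, hxe⟩ := hz
      have hu : x - faceCenter s ∈ dirCube s := add_faceCenter_mem.1 (by simpa using hx)
      have hu' : -(x - faceCenter s) ∈ dirCube s :=
        ⟨fun i => by simpa only [Pi.neg_apply, abs_neg] using hu.1 i, fun i hi => by
          simpa only [Pi.neg_apply, neg_eq_zero] using hu.2 i hi⟩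
      have h1 := (hmem _ (add_faceCenter_mem.2 hu')).1 j
      have h2 := hlin (x - faceCenter s)
      rw [sub_add_cancel, hxe] at h2
      have h3 := congrFun h2 j
      rw [hlin, map_neg] at h1
      simp only [Pi.add_apply, Pi.neg_apply, Pi.single_eq_same, faceCenter, hj,
        SignType.coe_zero, add_zero] at h1 h3
      rw [abs_le]
      constructor <;> linarith [h1.1, h1.2]
    have h1 := (abs_le.1 (hstep 1 (by simp))).1
    have h2 := (abs_le.1 (hstep (-1) (by simp))).2
    simp only [faceCenter, hj, SignType.coe_zero] at h1 h2 ⊢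
    linarith
  · exact (hmem _ (faceCenter_mem s)).2 j hj

lemma pi_apply_eq_sum (L : (Fin d → ℝ) →ₗ[ℝ] (Fin d → ℝ)) (u : Fin d → ℝ) (j : Fin d) :
    L u j = ∑ i, u i * L (Pi.single i 1) j := by
  conv_lhs => rw [← Finset.univ_sum_single u, map_sum, Finset.sum_apply]
  refine Finset.sum_congr rfl fun i _ => ?_
  have : Pi.single i (u i) = u i • (Pi.single i 1 : Fin d → ℝ) := by
    rw [← Pi.single_smul, smul_eq_mul, mul_one]
  rw [this, map_smul, Pi.smul_apply, smul_eq_mul]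

lemma single_mem_dirCube {s : Fin d → SignType} {i : Fin d} (hi : s i = 0) :
    (Pi.single i 1 : Fin d → ℝ) ∈ dirCube s :=
  ⟨fun k => by by_cases h : k = i <;> [(subst h; simp); simp [h]], fun k hk => by
    have : k ≠ i := by rintro rfl; exact hk hi
    simp [this]⟩

/-- A linear map between the cubes has rows of `ℓ¹` norm at most one. -/
lemma sum_abs_row_le {L : (Fin d → ℝ) →ₗ[ℝ] (Fin d → ℝ)} {s t : Fin d → SignType}
    (hL : ∀ u ∈ dirCube s, L u ∈ dirCube t) (j : Fin d) :
    ∑ i, (if s i = 0 then |L (Pi.single i 1) j| else 0) ≤ 1 := by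
  have hu : (fun i => if s i = 0 then ((SignType.sign (L (Pi.single i 1) j) : SignType) : ℝ)
      else 0) ∈ dirCube s :=
    ⟨fun i => by dsimp only; split_ifs <;> simp [abs_sign_le], fun i hi => by simp [hi]⟩
  have h := (abs_le.1 ((hL _ hu).1 j)).2
  rw [pi_apply_eq_sum] at h
  refine le_trans (le_of_eq (Finset.sum_congr rfl fun i _ => ?_)) h
  split_ifs
  · rw [sign_mul_self]
  · simp

lemma map_eq_zero_of_dir {L : (Fin d → ℝ) →ₗ[ℝ] (Fin d → ℝ)} {s t : Fin d → SignType}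
    (hL : ∀ u ∈ dirCube s, L u ∈ dirCube t) {u : Fin d → ℝ} (hu : ∀ i, s i ≠ 0 → u i = 0)
    {j : Fin d} (hj : t j ≠ 0) : L u j = 0 := by
  rw [pi_apply_eq_sum]
  refine Finset.sum_eq_zero fun i _ => ?_
  by_cases hi : s i = 0
  · rw [(hL _ (single_mem_dirCube hi)).2 j hj, mul_zero]
  · rw [hu i hi, zero_mul]

/-- A linear bijection between the cubes is an isometry for the sup norm; each coordinate of the
source occurs, up to sign, as a coordinate of the image. -/
lemma exists_row {L : (Fin d → ℝ) ≃ₗ[ℝ] (Fin d → ℝ)} {s t : Fin d → SignType}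
    (hL : ∀ u ∈ dirCube s, L u ∈ dirCube t) (hL' : ∀ u ∈ dirCube t, L.symm u ∈ dirCube s)
    {i : Fin d} (hi : s i = 0) :
    ∃ j, t j = 0 ∧ ∃ ε : ℝ, (ε = 1 ∨ ε = -1) ∧
      ∀ u : Fin d → ℝ, (∀ k, s k ≠ 0 → u k = 0) → L u j = ε * u i := by
  set a : Fin d → ℝ := L (Pi.single i 1) with ha
  have ha' := hL _ (single_mem_dirCube hi)
  rw [← ha] at ha'
  set b : Fin d → ℝ := fun j => L.symm (Pi.single j 1) i with hb
  have hb' : ∑ j, (if t j = 0 then |b j| else 0) ≤ 1 :=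
    sum_abs_row_le (L := (L.symm : (Fin d → ℝ) →ₗ[ℝ] (Fin d → ℝ))) hL' i
  have hab : ∑ j, a j * b j = 1 := by
    have := pi_apply_eq_sum (L.symm : (Fin d → ℝ) →ₗ[ℝ] (Fin d → ℝ)) a i
    simp only [LinearEquiv.coe_coe] at this
    rw [← this, ha, L.symm_apply_apply, Pi.single_eq_same]
  obtain ⟨j, hj, hj1⟩ : ∃ j, t j = 0 ∧ |a j| = 1 := by
    by_contra! hno
    have hle : ∀ j, a j * b j ≤ if t j = 0 then |b j| else 0 := fun j => by
      split_ifs with h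
      · calc a j * b j ≤ |a j * b j| := le_abs_self _
          _ = |a j| * |b j| := abs_mul _ _
          _ ≤ 1 * |b j| := mul_le_mul_of_nonneg_right (ha'.1 j) (abs_nonneg _)
          _ = |b j| := one_mul _
      · rw [ha'.2 j h, zero_mul]
    have hex : ∃ j, a j * b j ≠ 0 := by
      by_contra! h0
      simp [h0] at hab
    obtain ⟨j, hj⟩ := hex
    have hj0 : t j = 0 := by
      by_contra h
      exact hj (by rw [ha'.2 j h, zero_mul])
    have hbj : 0 < |b j| := abs_pos.2 (right_ne_zero_of_mul hj)
    have hlt : a j * b j < if t j = 0 then |b j| else 0 := by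
      rw [if_pos hj0]
      calc a j * b j ≤ |a j * b j| := le_abs_self _
        _ = |a j| * |b j| := abs_mul _ _
        _ < 1 * |b j| := mul_lt_mul_of_pos_right (lt_of_le_of_ne (ha'.1 j) (hno j hj0)) hbj
        _ = |b j| := one_mul _
    have := Finset.sum_lt_sum (fun j _ => hle j) ⟨j, Finset.mem_univ j, hlt⟩
    linarith
  refine ⟨j, hj, a j, by rwa [abs_eq (by norm_num)] at hj1, fun u hu => ?_⟩
  have hrow := sum_abs_row_le (L := (L : (Fin d → ℝ) →ₗ[ℝ] (Fin d → ℝ))) hL j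
  have hpe := pi_apply_eq_sum (L : (Fin d → ℝ) →ₗ[ℝ] (Fin d → ℝ)) u j
  simp only [LinearEquiv.coe_coe] at hrow hpe
  rw [hpe, Finset.sum_eq_single i, mul_comm]
  · intro k _ hki
    by_cases hk : s k = 0
    · rw [← Finset.add_sum_erase _ _ (Finset.mem_univ i), if_pos hi, ← ha, hj1,
        ← Finset.add_sum_erase _ _ (Finset.mem_erase.2 ⟨hki, Finset.mem_univ k⟩), if_pos hk] at hrow
      have h0 : 0 ≤ ∑ x ∈ (Finset.univ.erase i).erase k,
          (if s x = 0 then |L (Pi.single x 1) j| else 0) :=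
        Finset.sum_nonneg fun x _ => by split_ifs <;> positivity
      have : |L (Pi.single k 1) j| = 0 := le_antisymm (by linarith) (abs_nonneg _)
      rw [abs_eq_zero.1 this, mul_zero]
    · rw [hu k hk, zero_mul]
  · exact fun h => absurd (Finset.mem_univ i) h

/-- The combinatorial data of an affine bijection between two faces of the cube: a bijection of the
free coordinates and a sign for each of them. -/
structure FaceMatch (G : (Fin d → ℝ) → (Fin d → ℝ)) (s t : Fin d → SignType) where
  /-- The bijection of the free coordinates. -/
  equiv : {i // s i = 0} ≃ {j // t j = 0}
  /-- The signs. -/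
  sign : {i // s i = 0} → ℝ
  sign_eq : ∀ i, sign i = 1 ∨ sign i = -1
  mem_hull : ∀ x ∈ faceHull s, G x ∈ faceHull t
  apply_eq : ∀ x ∈ faceHull s, ∀ i, G x (equiv i) = sign i * x i

/-- Affine bijections between faces of the cube are signed permutations of the free coordinates. -/
lemma exists_faceMatch (G : (Fin d → ℝ) ≃ᵃ[ℝ] (Fin d → ℝ)) {s t : Fin d → SignType}
    (hG : G '' cubeFace s = cubeFace t) : Nonempty (FaceMatch G s t) := by
  have hc := map_faceCenter G hG
  have hlin : ∀ u, G (u + faceCenter s) = G.linear u + faceCenter t := fun u => by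
    have := G.map_vadd (faceCenter s) u
    rw [hc] at this
    simpa [vadd_eq_add] using this
  have hL : ∀ u ∈ dirCube s, G.linear u ∈ dirCube t := fun u hu => by
    rw [← add_faceCenter_mem, ← hlin, ← hG]
    exact Set.mem_image_of_mem _ (add_faceCenter_mem.2 hu)
  have hL' : ∀ u ∈ dirCube t, G.linear.symm u ∈ dirCube s := fun u hu => by
    have h1 := add_faceCenter_mem.2 hu
    rw [← hG] at h1
    obtain ⟨x, hx, hxe⟩ := h1
    have h2 := hlin (x - faceCenter s)
    rw [sub_add_cancel, hxe] at h2
    have h3 : u = G.linear (x - faceCenter s) := add_right_cancel h2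
    rw [h3, LinearEquiv.symm_apply_apply]
    exact add_faceCenter_mem.1 (by simpa using hx)
  choose j hj ε hε hrow using fun i : {i // s i = 0} => exists_row hL hL' i.2
  choose j' hj' ε' hε' hrow' using fun i : {i // t i = 0} =>
    exists_row (L := G.linear.symm) hL' (by simpa using hL) i.2
  have hinj : Injective fun i => (⟨j i, hj i⟩ : {j // t j = 0}) := fun i k hik => by
    by_contra hne
    have hik' : j i = j k := congrArg Subtype.val hik
    have hne' : (k : Fin d) ≠ i := fun h => hne (Subtype.ext h.symm)
    have h1 := hrow i _ (single_mem_dirCube i.2).2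
    have h2 := hrow k _ (single_mem_dirCube i.2).2
    rw [hik', h2] at h1
    rcases hε i with h | h <;> simp [h, hne'] at h1
  have hinj' : Injective fun i => (⟨j' i, hj' i⟩ : {j // s j = 0}) := fun i k hik => by
    by_contra hne
    have hik' : j' i = j' k := congrArg Subtype.val hik
    have hne' : (k : Fin d) ≠ i := fun h => hne (Subtype.ext h.symm)
    have h1 := hrow' i _ (single_mem_dirCube i.2).2
    have h2 := hrow' k _ (single_mem_dirCube i.2).2
    rw [hik', h2] at h1
    rcases hε' i with h | h <;> simp [h, hne'] at h1
  have hbij := (Fintype.bijective_iff_injective_and_card _).2 ⟨hinj,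
    le_antisymm (Fintype.card_le_of_injective _ hinj) (Fintype.card_le_of_injective _ hinj')⟩
  have hx : ∀ x ∈ faceHull s, (∀ k, s k ≠ 0 → (x - faceCenter s) k = 0) ∧
      G x = G.linear (x - faceCenter s) + faceCenter t := fun x hx => by
    refine ⟨fun k hk => by simp [hx k hk, faceCenter], ?_⟩
    rw [← hlin, sub_add_cancel]
  refine ⟨⟨Equiv.ofBijective _ hbij, ε, hε, fun x h k hk => ?_, fun x h i => ?_⟩⟩
  · have h0 : G.linear (x - faceCenter s) k = 0 :=
      map_eq_zero_of_dir (L := (G.linear : (Fin d → ℝ) →ₗ[ℝ] (Fin d → ℝ))) hL (hx x h).1 hk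
    rw [(hx x h).2, Pi.add_apply, h0]
    simp [faceCenter]
  · rw [(hx x h).2, Pi.add_apply, Equiv.ofBijective_apply, hrow i _ (hx x h).1]
    simp [faceCenter, hj i, i.2]

namespace FaceMatch

variable {G : (Fin d → ℝ) → (Fin d → ℝ)} {s t : Fin d → SignType}

lemma apply_update (m : FaceMatch G s t) {x : Fin d → ℝ} (hx : x ∈ faceHull s) {i : Fin d} (hi : s i = 0) (c : ℝ) :
    G (update x i c) = update (G x) (m.equiv ⟨i, hi⟩) (m.sign ⟨i, hi⟩ * c) := by
  have hu := update_mem_faceHull hx hi c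
  funext k
  by_cases hk : t k = 0
  · obtain ⟨i', hi'⟩ := m.equiv.surjective ⟨k, hk⟩
    have hk' : k = m.equiv i' := by rw [hi']
    rw [hk', m.apply_eq _ hu]
    by_cases h : i' = ⟨i, hi⟩
    · subst h; simp
    · have h1 : (i' : Fin d) ≠ i := fun e => h (Subtype.ext e)
      have h2 : (m.equiv i' : Fin d) ≠ m.equiv ⟨i, hi⟩ := fun e =>
        h (m.equiv.injective (Subtype.ext e))
      rw [update_of_ne h1, update_of_ne h2, m.apply_eq _ hx]
  · have h2 : k ≠ m.equiv ⟨i, hi⟩ := fun e => hk (e ▸ (m.equiv ⟨i, hi⟩).2)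
    rw [update_of_ne h2, m.mem_hull _ hu k hk, m.mem_hull _ hx k hk]

lemma card_eq (m : FaceMatch G s t) : Fintype.card {i // s i = 0} = Fintype.card {j // t j = 0} :=
  Fintype.card_congr m.equiv

lemma mem_refNodes (m : FaceMatch G s t) {p : ℕ} (hp : 0 < p) {x : Fin d → ℝ} (hx : x ∈ faceHull s)
    (hn : x ∈ refNodes d p) : G x ∈ refNodes d p := by
  rw [HpDG.mem_refNodes] at hn ⊢
  intro k
  by_cases hk : t k = 0
  · obtain ⟨i, hi⟩ := m.equiv.surjective ⟨k, hk⟩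
    have hk' : k = m.equiv i := by rw [hi]
    rw [hk', m.apply_eq _ hx]
    rcases m.sign_eq i with h | h <;> rw [h]
    · rw [one_mul]; exact hn i
    · rw [neg_one_mul]; exact neg_mem_gllNodes hp (hn i)
  · rw [m.mem_hull _ hx k hk]; exact sign_mem_gllNodes hp hk

end FaceMatch

lemma gllWeight_sign {p : ℕ} (hp : 1 < p) {σ : SignType} (h : σ ≠ 0) :
    gllWeight p (σ : ℝ) = 2 / (p * (p + 1)) := by
  rcases sign_eq_one_or h with e | e <;> rw [e]
  exacts [gllWeight_one hp, gllWeight_neg_one hp]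

lemma tensorWeight_eq_of_mem_faceHull {p : ℕ} (hp : 1 < p) {s : Fin d → SignType} {x : Fin d → ℝ}
    (hx : x ∈ faceHull s) :
    tensorWeight p x = (∏ i : {i // s i = 0}, gllWeight p (x i)) *
      (2 / (p * (p + 1))) ^ (d - Fintype.card {i // s i = 0}) := by
  rw [tensorWeight, ← Fintype.prod_subtype_mul_prod_subtype (fun i => s i = 0)]
  congr 1
  rw [Finset.prod_congr rfl fun (i : {i // ¬ s i = 0}) _ => by
    rw [hx i i.2, gllWeight_sign hp i.2], Finset.prod_const, Finset.card_univ,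
    Fintype.card_subtype_compl, Fintype.card_fin]

/-- The tensor-product weight of a node does not depend on the element from which it is seen. -/
lemma FaceMatch.tensorWeight_eq {G : (Fin d → ℝ) → (Fin d → ℝ)} {s t : Fin d → SignType}
    (m : FaceMatch G s t) {p : ℕ} (hp : 1 < p) {x : Fin d → ℝ} (hx : x ∈ faceHull s)
    (hn : x ∈ refNodes d p) : tensorWeight p (G x) = tensorWeight p x := by
  rw [tensorWeight_eq_of_mem_faceHull hp hx, tensorWeight_eq_of_mem_faceHull hp (m.mem_hull x hx),
    m.card_eq, ← m.equiv.prod_comp]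
  congr 1
  refine Finset.prod_congr rfl fun i _ => ?_
  rw [m.apply_eq x hx i]
  rcases m.sign_eq i with h | h <;> rw [h]
  · rw [one_mul]
  · rw [neg_one_mul, gllWeight_neg hp (HpDG.mem_refNodes.1 hn i)]

end CubeFaces

namespace Mesh

/-! ### Elements, faces and coordinates -/

section Charts

open Function Filter Topology

variable {d : ℕ} {Ω : Set (E d)} (M : Mesh Ω)

/-- The parametrization of the element `k` by the reference cube, in coordinates. -/
def chart (k : Fin M.n) : (Fin d → ℝ) ≃ᵃ[ℝ] E d :=
  (WithLp.linearEquiv 2 ℝ (Fin d → ℝ)).symm.toAffineEquiv.trans (M.F k)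

/-- The reference coordinates of a point with respect to the element `k`. -/
abbrev coord (k : Fin M.n) : E d ≃ᵃ[ℝ] (Fin d → ℝ) := (M.chart k).symm

lemma chart_eq_node (k : Fin M.n) (ξ : Fin d → ℝ) : M.chart k ξ = M.node k ξ := rfl

lemma coord_apply (k : Fin M.n) (y : E d) (i : Fin d) : M.coord k y i = (M.F k).symm y i := rfl

lemma coord_F (k : Fin M.n) (x : E d) : M.coord k (M.F k x) = fun i => x i := by
  funext i; rw [coord_apply, AffineEquiv.symm_apply_apply]

lemma F_eq_chart (k : Fin M.n) (x : E d) : M.F k x = M.chart k fun i => x i := by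
  rw [← coord_F, AffineEquiv.apply_symm_apply]

lemma continuous_chart (k : Fin M.n) : Continuous (M.chart k) :=
  (M.chart k).toAffineMap.continuous_of_finiteDimensional

lemma continuous_coord (k : Fin M.n) : Continuous (M.coord k) :=
  (M.coord k).toAffineMap.continuous_of_finiteDimensional

lemma continuous_coord_apply (k : Fin M.n) (i : Fin d) : Continuous fun y => M.coord k y i :=
  (continuous_apply i).comp (M.continuous_coord k)

/-- `chart` as a homeomorphism. -/
def chartHomeo (k : Fin M.n) : (Fin d → ℝ) ≃ₜ E d where
  toEquiv := (M.chart k).toEquiv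
  continuous_toFun := M.continuous_chart k
  continuous_invFun := M.continuous_coord k

lemma image_F_eq (k : Fin M.n) (A : Set (E d)) (B : Set (Fin d → ℝ))
    (h : ∀ x : E d, x ∈ A ↔ (fun i => x i) ∈ B) : M.F k '' A = M.chart k '' B := by
  ext y
  constructor
  · rintro ⟨x, hx, rfl⟩
    exact ⟨_, (h x).1 hx, (M.F_eq_chart k x).symm⟩
  · rintro ⟨ξ, hξ, rfl⟩
    exact ⟨WithLp.toLp 2 ξ, (h _).2 hξ, rfl⟩

lemma mem_chart_image {k : Fin M.n} {B : Set (Fin d → ℝ)} {y : E d} :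
    y ∈ M.chart k '' B ↔ M.coord k y ∈ B := by
  constructor
  · rintro ⟨ξ, hξ, rfl⟩
    rwa [AffineEquiv.symm_apply_apply]
  · exact fun h => ⟨_, h, AffineEquiv.apply_symm_apply _ _⟩

lemma elem_eq (k : Fin M.n) :
    M.elem k = M.chart k '' (Set.univ.pi fun _ => Set.Ioo (-1 : ℝ) 1) :=
  M.image_F_eq k _ _ fun x => by simp [refCube]

lemma closure_elem_eq (k : Fin M.n) :
    closure (M.elem k) = M.chart k '' (Set.univ.pi fun _ => Set.Icc (-1 : ℝ) 1) := by
  rw [elem_eq]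
  have h := (M.chartHomeo k).image_closure (Set.univ.pi fun _ => Set.Ioo (-1 : ℝ) 1)
  rw [closure_pi_set] at h
  simp only [closure_Ioo (show (-1 : ℝ) ≠ 1 by norm_num)] at h
  exact h.symm

lemma mem_elem {k : Fin M.n} {y : E d} :
    y ∈ M.elem k ↔ ∀ i, M.coord k y i ∈ Set.Ioo (-1 : ℝ) 1 := by
  rw [elem_eq, mem_chart_image]; simp only [Set.mem_univ_pi]

lemma mem_closure_elem {k : Fin M.n} {y : E d} :
    y ∈ closure (M.elem k) ↔ ∀ i, M.coord k y i ∈ Set.Icc (-1 : ℝ) 1 := by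
  rw [closure_elem_eq, mem_chart_image]; simp only [Set.mem_univ_pi]

lemma chart_mem_elem {k : Fin M.n} {ξ : Fin d → ℝ} :
    M.chart k ξ ∈ M.elem k ↔ ∀ i, ξ i ∈ Set.Ioo (-1 : ℝ) 1 := by
  rw [mem_elem, AffineEquiv.symm_apply_apply]

lemma chart_mem_closure_elem {k : Fin M.n} {ξ : Fin d → ℝ} :
    M.chart k ξ ∈ closure (M.elem k) ↔ ∀ i, ξ i ∈ Set.Icc (-1 : ℝ) 1 := by
  rw [mem_closure_elem, AffineEquiv.symm_apply_apply]

lemma isOpen_elem (k : Fin M.n) : IsOpen (M.elem k) := by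
  rw [elem_eq]
  exact (M.chartHomeo k).isOpenMap _ (isOpen_set_pi Set.finite_univ fun _ _ => isOpen_Ioo)

lemma isCompact_closure_elem (k : Fin M.n) : IsCompact (closure (M.elem k)) := by
  rw [closure_elem_eq]
  exact (isCompact_univ_pi fun _ => isCompact_Icc).image (M.continuous_chart k)

lemma chart_zero_mem (k : Fin M.n) : M.chart k 0 ∈ M.elem k :=
  M.chart_mem_elem.2 fun i => by simp

lemma image_refSubface (k : Fin M.n) (s : Fin d → SignType) :
    M.F k '' refSubface s = M.chart k '' cubeFace s :=
  M.image_F_eq k _ _ fun _ => Iff.rfl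

lemma eq_of_mem_elem_of_mem_closure {k l : Fin M.n} {y : E d} (hk : y ∈ M.elem k)
    (hl : y ∈ closure (M.elem l)) : k = l := by
  by_contra h
  obtain ⟨z, hz, hz'⟩ := mem_closure_iff.1 hl _ (M.isOpen_elem k) hk
  exact Set.disjoint_left.1 (M.disj k l h) hz hz'

/-- Change of reference coordinates from the element `k` to the element `l`. -/
def transition (k l : Fin M.n) : (Fin d → ℝ) ≃ᵃ[ℝ] (Fin d → ℝ) := (M.chart k).trans (M.coord l)

lemma transition_apply (k l : Fin M.n) (ξ : Fin d → ℝ) :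
    M.transition k l ξ = M.coord l (M.chart k ξ) := rfl

lemma transition_coord (k l : Fin M.n) (y : E d) : M.transition k l (M.coord k y) = M.coord l y := by
  rw [transition_apply, AffineEquiv.apply_symm_apply]

lemma transition_faceMatch {k l : Fin M.n} {s t : Fin d → SignType}
    (h : M.chart k '' cubeFace s = M.chart l '' cubeFace t) :
    Nonempty (FaceMatch (M.transition k l) s t) := by
  refine exists_faceMatch _ ?_
  have h1 : (M.transition k l : (Fin d → ℝ) → (Fin d → ℝ)) = M.coord l ∘ M.chart k := rfl
  rw [h1, Set.image_comp, h, ← Set.image_comp]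
  have h2 : (M.coord l ∘ M.chart l : (Fin d → ℝ) → (Fin d → ℝ)) = id := by
    funext x; exact AffineEquiv.symm_apply_apply _ _
  rw [h2, Set.image_id]

/-- Two distinct closed elements with a common point meet in a common proper face. -/
lemma exists_common_face {k l : Fin M.n} (hkl : k ≠ l) {y : E d} (hk : y ∈ closure (M.elem k))
    (hl : y ∈ closure (M.elem l)) : ∃ s t : Fin d → SignType, s ≠ 0 ∧
      closure (M.elem k) ∩ closure (M.elem l) = M.chart k '' cubeFace s ∧
      closure (M.elem k) ∩ closure (M.elem l) = M.chart l '' cubeFace t := by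
  rcases M.conforming k l hkl with h | ⟨s, t, hs, ht⟩
  · have hmem : y ∈ closure (M.elem k) ∩ closure (M.elem l) := ⟨hk, hl⟩
    exact absurd (Eq.subset h hmem) (Set.notMem_empty y)
  · rw [image_refSubface] at hs ht
    refine ⟨s, t, ?_, hs, ht⟩
    rintro rfl
    have h1 : M.chart k 0 ∈ M.chart k '' cubeFace (0 : Fin d → SignType) :=
      Set.mem_image_of_mem _ ⟨fun i => by simp, fun i hi => absurd rfl hi⟩
    rw [← hs] at h1
    exact hkl (M.eq_of_mem_elem_of_mem_closure (M.chart_zero_mem k) h1.2)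

lemma exists_common_faceMatch {k l : Fin M.n} (hkl : k ≠ l) {y : E d}
    (hk : y ∈ closure (M.elem k)) (hl : y ∈ closure (M.elem l)) :
    ∃ s t : Fin d → SignType, M.coord k y ∈ cubeFace s ∧
      Nonempty (FaceMatch (M.transition k l) s t) := by
  obtain ⟨s, t, -, hs, ht⟩ := M.exists_common_face hkl hk hl
  exact ⟨s, t, M.mem_chart_image.1 (hs ▸ ⟨hk, hl⟩), M.transition_faceMatch (hs.symm.trans ht)⟩

/-! ### Position of the elements in the domain -/

lemma closure_elem_subset (k : Fin M.n) : closure (M.elem k) ⊆ closure Ω := by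
  rw [← M.cover]
  exact Set.subset_iUnion (fun k => closure (M.F k '' refCube d)) k

lemma exists_mem_closure_elem {y : E d} (hy : y ∈ closure Ω) : ∃ k, y ∈ closure (M.elem k) := by
  rw [← M.cover] at hy
  exact Set.mem_iUnion.1 hy

lemma elem_subset (hΩ : IsOpen Ω) (hc : Convex ℝ Ω) (k : Fin M.n) : M.elem k ⊆ Ω := by
  have h1 : M.elem k ⊆ interior (closure Ω) :=
    interior_maximal (subset_closure.trans (M.closure_elem_subset k)) (M.isOpen_elem k)
  have hne : (interior Ω).Nonempty := by
    rw [hΩ.interior_eq]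
    exact closure_nonempty_iff.1 ⟨_, M.closure_elem_subset k (subset_closure (M.chart_zero_mem k))⟩
  rwa [hc.interior_closure_eq_interior_of_nonempty_interior hne, hΩ.interior_eq] at h1

/-- A face of an element lies in the boundary of a convex domain as soon as one of its relatively
interior points does: it lies in a supporting hyperplane. -/
lemma chart_image_subset_frontier (hΩ : IsOpen Ω) (hc : Convex ℝ Ω) {k : Fin M.n} {y : E d}
    (hy : y ∈ frontier Ω) {s : Fin d → SignType} (hs : M.coord k y ∈ faceHull s)
    (hfree : ∀ i, s i = 0 → M.coord k y i ∈ Set.Ioo (-1 : ℝ) 1) :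
    M.chart k '' cubeFace s ⊆ frontier Ω := by
  have hsub : M.chart k '' cubeFace s ⊆ closure Ω := by
    rintro _ ⟨ξ, hξ, rfl⟩
    exact M.closure_elem_subset k (M.chart_mem_closure_elem.2 hξ.1)
  intro z hz
  rw [hΩ.frontier_eq] at hy ⊢
  refine ⟨hsub hz, fun hzΩ => hy.2 ?_⟩
  obtain ⟨ζ, hζ, rfl⟩ := hz
  set ξ := M.coord k y with hξ
  -- the point of the face beyond `y`, as seen from `z`
  have hev : ∀ᶠ ε : ℝ in 𝓝[>] 0, ∀ i, s i = 0 → ξ i + ε * (ξ i - ζ i) ∈ Set.Ioo (-1 : ℝ) 1 := by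
    rw [eventually_all]
    intro i
    by_cases hi : s i = 0
    · have hcont : Continuous fun ε : ℝ => ξ i + ε * (ξ i - ζ i) := by fun_prop
      have := (hcont.tendsto 0).eventually (isOpen_Ioo.mem_nhds
        (show ξ i + 0 * (ξ i - ζ i) ∈ Set.Ioo (-1 : ℝ) 1 by simpa using hfree i hi))
      exact (this.filter_mono nhdsWithin_le_nhds).mono fun ε h _ => h
    · exact Eventually.of_forall fun ε h => absurd h hi
  obtain ⟨ε, hε, hε0⟩ := (hev.and self_mem_nhdsWithin).exists
  have hε0 : 0 < ε := hε0
  set η : Fin d → ℝ := ξ + ε • (ξ - ζ) with hη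
  have hηmem : M.chart k η ∈ closure Ω := by
    refine hsub (Set.mem_image_of_mem _ ⟨fun i => ?_, fun i hi => ?_⟩)
    · by_cases hi : s i = 0
      · exact Set.Ioo_subset_Icc_self (hε i hi)
      · simp only [hη, Pi.add_apply, Pi.smul_apply, Pi.sub_apply, hs i hi, hζ.2 i hi, sub_self,
          smul_zero, add_zero]
        exact abs_le.1 (abs_sign_le _)
    · simp [hη, hs i hi, hζ.2 i hi]
  have hseg := hc.openSegment_interior_closure_subset_interior
    (by rwa [hΩ.interior_eq]) hηmem
  rw [hΩ.interior_eq] at hseg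
  apply hseg
  have h1 : y = M.chart k (AffineMap.lineMap ζ η (1 / (1 + ε))) := by
    rw [← AffineEquiv.apply_symm_apply (M.chart k) y]
    congr 1
    funext i
    simp only [AffineMap.lineMap_apply, vsub_eq_sub, vadd_eq_add, Pi.add_apply, Pi.smul_apply,
      Pi.sub_apply, smul_eq_mul, hη]
    change ξ i = _
    field_simp
    ring
  rw [openSegment_eq_image_lineMap]
  refine ⟨1 / (1 + ε), ⟨by positivity, by rw [div_lt_one (by positivity)]; linarith⟩, ?_⟩
  rw [h1]
  exact ((M.chart k).toAffineMap.apply_lineMap ζ η _).symm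

/-- The face of the cube that contains a given point of the cube in its relative interior. -/
def facePattern (ξ : Fin d → ℝ) : Fin d → SignType :=
  fun i => if ξ i = 1 then 1 else if ξ i = -1 then -1 else 0

lemma mem_faceHull_facePattern (ξ : Fin d → ℝ) : ξ ∈ faceHull (facePattern ξ) := fun i hi => by
  unfold facePattern at hi ⊢
  split_ifs at hi ⊢ with h1 h2
  · simpa using h1
  · simpa using h2
  · exact absurd rfl hi

lemma mem_Ioo_of_facePattern {ξ : Fin d → ℝ} (h : ∀ i, ξ i ∈ Set.Icc (-1 : ℝ) 1) {i : Fin d}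
    (hi : facePattern ξ i = 0) : ξ i ∈ Set.Ioo (-1 : ℝ) 1 := by
  unfold facePattern at hi
  split_ifs at hi with h1 h2
  exact ⟨lt_of_le_of_ne (h i).1 (Ne.symm h2), lt_of_le_of_ne (h i).2 h1⟩

end Charts

end Mesh

namespace Mesh

/-! ### Sides, normals, and the two sides of a face -/

section Sides

open Function Filter Topology

variable {d : ℕ} {Ω : Set (E d)} (M : Mesh Ω)

lemma sgn_mul_self (b : Bool) : sgn b * sgn b = 1 := by cases b <;> simp [sgn]

lemma sgn_eq_one_or (b : Bool) : sgn b = 1 ∨ sgn b = -1 := by cases b <;> simp [sgn]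

lemma sgn_ne_zero (b : Bool) : sgn b ≠ 0 := by cases b <;> simp [sgn]

/-- The face `refFace i b` as a sign pattern. -/
def sideSign (i : Fin d) (b : Bool) : Fin d → SignType := Pi.single i (if b then 1 else -1)

lemma sideSign_self (i : Fin d) (b : Bool) : ((sideSign i b i : SignType) : ℝ) = sgn b := by
  cases b <;> simp [sideSign, sgn]

lemma sideSign_ne_zero_iff {i j : Fin d} {b : Bool} : sideSign i b j ≠ 0 ↔ j = i := by
  unfold sideSign
  by_cases h : j = i
  · subst h; cases b <;> simp
  · simp [h]

lemma sideSign_of_ne {i j : Fin d} {b : Bool} (h : j ≠ i) : sideSign i b j = 0 := by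
  by_contra h'; exact h (sideSign_ne_zero_iff.1 h')

lemma mem_faceHull_sideSign {i : Fin d} {b : Bool} {x : Fin d → ℝ} :
    x ∈ faceHull (sideSign i b) ↔ x i = sgn b := by
  constructor
  · intro h; rw [← sideSign_self i b]; exact h i (sideSign_ne_zero_iff.2 rfl)
  · intro h j hj
    obtain rfl := sideSign_ne_zero_iff.1 hj
    rw [h, sideSign_self]

lemma sideSet_eq (s : M.Side) :
    M.sideSet s = M.chart s.1 '' cubeFace (sideSign s.2.1 s.2.2) :=
  M.image_F_eq _ _ _ fun _ => and_congr Iff.rfl mem_faceHull_sideSign.symm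

lemma mem_sideSet {s : M.Side} {y : E d} : y ∈ M.sideSet s ↔
    (∀ j, M.coord s.1 y j ∈ Set.Icc (-1 : ℝ) 1) ∧ M.coord s.1 y s.2.1 = sgn s.2.2 := by
  rw [sideSet_eq, mem_chart_image]
  exact and_congr Iff.rfl mem_faceHull_sideSign

lemma isCompact_sideSet (s : M.Side) : IsCompact (M.sideSet s) := by
  have : M.sideSet s = closure (M.elem s.1) ∩ {y | M.coord s.1 y s.2.1 = sgn s.2.2} := by
    ext y; rw [mem_sideSet, Set.mem_inter_iff, mem_closure_elem]; rfl
  rw [this]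
  exact (M.isCompact_closure_elem _).inter_right
    (isClosed_eq (M.continuous_coord_apply _ _) continuous_const)

lemma sideSet_subset (s : M.Side) : M.sideSet s ⊆ closure (M.elem s.1) := fun _ hy =>
  M.mem_closure_elem.2 (M.mem_sideSet.1 hy).1

/-- The affine function that is negative on the element and vanishes on the side. -/
def sideFun (s : M.Side) (y : E d) : ℝ := sgn s.2.2 * M.coord s.1 y s.2.1 - 1

/-- The outward normal vector of a side before normalization: the gradient of `sideFun`. -/
def normalDir (s : M.Side) : E d :=
  LinearMap.adjoint ((M.F s.1).linear.symm : E d →ₗ[ℝ] E d)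
    (sgn s.2.2 • EuclideanSpace.single s.2.1 (1 : ℝ))

lemma normal_eq (s : M.Side) : M.normal s = ‖M.normalDir s‖⁻¹ • M.normalDir s := rfl

lemma inner_normalDir (s : M.Side) (v : E d) :
    ⟪M.normalDir s, v⟫ = sgn s.2.2 * (M.F s.1).linear.symm v s.2.1 := by
  rw [normalDir, LinearMap.adjoint_inner_left, inner_smul_left, EuclideanSpace.inner_single_left]
  simp

lemma sideFun_add (s : M.Side) (y v : E d) :
    M.sideFun s (v + y) = M.sideFun s y + ⟪M.normalDir s, v⟫ := by
  have h : M.coord s.1 (v + y) s.2.1 = (M.F s.1).linear.symm v s.2.1 + M.coord s.1 y s.2.1 := by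
    rw [coord_apply, coord_apply]
    have := (M.F s.1).symm.map_vadd y v
    rw [vadd_eq_add, vadd_eq_add] at this
    rw [this, PiLp.add_apply]
    rfl
  rw [sideFun, h, inner_normalDir, sideFun]
  ring

lemma normalDir_ne_zero (s : M.Side) : M.normalDir s ≠ 0 := by
  intro h
  have := M.inner_normalDir s ((M.F s.1).linear (EuclideanSpace.single s.2.1 1))
  rw [h, inner_zero_left, LinearEquiv.symm_apply_apply] at this
  simp at this
  exact sgn_ne_zero _ this.symm

lemma norm_normal (s : M.Side) : ‖M.normal s‖ = 1 := by
  rw [normal_eq]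
  exact norm_smul_inv_norm (𝕜 := ℝ) (M.normalDir_ne_zero s)

lemma sideFun_chart_update (s : M.Side) (ξ : Fin d → ℝ) (ε : ℝ) :
    M.sideFun s (M.chart s.1 (update ξ s.2.1 (sgn s.2.2 * (1 + ε)))) = ε := by
  rw [sideFun, AffineEquiv.symm_apply_apply, update_self, ← mul_assoc, sgn_mul_self]
  ring

/-- The relative interior of a side. -/
def sideInterior (s : M.Side) : Set (E d) :=
  {x | M.coord s.1 x s.2.1 = sgn s.2.2 ∧ ∀ j ≠ s.2.1, M.coord s.1 x j ∈ Set.Ioo (-1 : ℝ) 1}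

lemma sideInterior_subset (s : M.Side) : M.sideInterior s ⊆ M.sideSet s := fun x hx => by
  refine M.mem_sideSet.2 ⟨fun j => ?_, hx.1⟩
  by_cases h : j = s.2.1
  · rw [h, hx.1]; rcases sgn_eq_one_or s.2.2 with e | e <;> rw [e] <;> norm_num
  · exact Set.Ioo_subset_Icc_self (hx.2 j h)

lemma tendsto_chart_update {s : M.Side} {x : E d} (hx : x ∈ M.sideInterior s) :
    Tendsto (fun ε : ℝ => M.chart s.1 (update (M.coord s.1 x) s.2.1 (sgn s.2.2 * (1 + ε))))
      (𝓝 0) (𝓝 x) := by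
  have hc : Continuous
      (fun ε : ℝ => M.chart s.1 (update (M.coord s.1 x) s.2.1 (sgn s.2.2 * (1 + ε)))) :=
    (M.continuous_chart _).comp (continuous_const.update _ (by fun_prop))
  have := hc.tendsto 0
  have e : update (M.coord s.1 x) s.2.1 (sgn s.2.2) = M.coord s.1 x := by
    rw [← hx.1, update_eq_self]
  rwa [add_zero, mul_one, e, AffineEquiv.apply_symm_apply] at this

/-- Near a relatively interior point of a side, the element is a half space. -/
lemma eventually_half_space {s : M.Side} {x : E d} (hx : x ∈ M.sideInterior s) :
    ∀ᶠ y in 𝓝 x, (M.sideFun s y ≤ 0 → y ∈ closure (M.elem s.1)) ∧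
      (M.sideFun s y < 0 → y ∈ M.elem s.1) := by
  have h1 : ∀ᶠ y in 𝓝 x, ∀ j, j ≠ s.2.1 → M.coord s.1 y j ∈ Set.Ioo (-1 : ℝ) 1 := by
    rw [eventually_all]
    intro j
    by_cases hj : j = s.2.1
    · exact Eventually.of_forall fun y h => absurd hj h
    · exact ((M.continuous_coord_apply s.1 j).tendsto x |>.eventually
        (isOpen_Ioo.mem_nhds (hx.2 j hj))).mono fun y h _ => h
  have h2 : ∀ᶠ y in 𝓝 x, -1 < sgn s.2.2 * M.coord s.1 y s.2.1 := by
    have hc : Continuous fun y => sgn s.2.2 * M.coord s.1 y s.2.1 :=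
      continuous_const.mul (M.continuous_coord_apply s.1 s.2.1)
    refine (hc.tendsto x).eventually (lt_mem_nhds ?_)
    rw [hx.1, sgn_mul_self]; norm_num
  filter_upwards [h1, h2] with y hy1 hy2
  constructor
  · intro hle
    refine M.mem_closure_elem.2 fun j => ?_
    by_cases hj : j = s.2.1
    · rw [sideFun] at hle
      rw [hj]
      rcases sgn_eq_one_or s.2.2 with e | e <;> rw [e] at hle hy2 <;> constructor <;> linarith
    · exact Set.Ioo_subset_Icc_self (hy1 j hj)
  · intro hlt
    refine M.mem_elem.2 fun j => ?_
    by_cases hj : j = s.2.1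
    · rw [sideFun] at hlt
      rw [hj]
      rcases sgn_eq_one_or s.2.2 with e | e <;> rw [e] at hlt hy2 <;> constructor <;> linarith
    · exact hy1 j hj

/-- The barycentre of a side. -/
def sideCenter (s : M.Side) : E d := M.chart s.1 (faceCenter (sideSign s.2.1 s.2.2))

lemma sideCenter_mem (s : M.Side) : M.sideCenter s ∈ M.sideInterior s := by
  rw [sideInterior, Set.mem_ofPred_eq, sideCenter, AffineEquiv.symm_apply_apply]
  refine ⟨sideSign_self _ _, fun j hj => ?_⟩
  simp [faceCenter, sideSign_of_ne hj]

lemma sideSet_faceMatch {s s' : M.Side} (h : M.sideSet s = M.sideSet s') :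
    Nonempty (FaceMatch (M.transition s.1 s'.1) (sideSign s.2.1 s.2.2) (sideSign s'.2.1 s'.2.2)) :=
  M.transition_faceMatch (by rw [← sideSet_eq, ← sideSet_eq, h])

lemma sideInterior_subset_of_sideSet_eq {s s' : M.Side} (h : M.sideSet s = M.sideSet s') :
    M.sideInterior s ⊆ M.sideInterior s' := fun x hx => by
  obtain ⟨m⟩ := M.sideSet_faceMatch h
  have hx' := mem_faceHull_sideSign.2 hx.1
  have h1 := m.mem_hull _ hx'
  rw [transition_coord, mem_faceHull_sideSign] at h1
  refine ⟨h1, fun j hj => ?_⟩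
  obtain ⟨i, hi⟩ := m.equiv.surjective ⟨j, sideSign_of_ne hj⟩
  have h2 := m.apply_eq _ hx' i
  rw [transition_coord, hi] at h2
  have hi' : (i : Fin d) ≠ s.2.1 := fun e => sideSign_ne_zero_iff.2 e i.2
  have h3 := hx.2 i hi'
  rw [h2]
  rcases m.sign_eq i with e | e <;> rw [e] <;> constructor <;> linarith [h3.1, h3.2]

lemma eq_of_sideSet_eq_of_fst_eq {s s' : M.Side} (h : M.sideSet s = M.sideSet s')
    (h1 : s.1 = s'.1) : s = s' := by
  obtain ⟨k, i, b⟩ := s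
  obtain ⟨k', i', b'⟩ := s'
  obtain rfl : k = k' := h1
  have h2 := (M.mem_sideSet.1 (h ▸ M.sideInterior_subset _ (M.sideCenter_mem (k, i, b)))).2
  rw [sideCenter, AffineEquiv.symm_apply_apply] at h2
  simp only [faceCenter] at h2
  have hi : i' = i := by
    by_contra hne
    rw [sideSign_of_ne hne] at h2
    exact sgn_ne_zero b' (by simpa using h2.symm)
  subst hi
  rw [sideSign_self] at h2
  have hb : b = b' := by cases b <;> cases b' <;> simp [sgn] at h2 ⊢ <;> norm_num at h2
  rw [hb]

/-- Two sides that occupy the same face belong to different elements, on opposite sides of it: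
otherwise the elements would overlap near the barycentre of the face. -/
lemma exists_sideFun_eq_mul {s s' : M.Side} (hne : s ≠ s') (h : M.sideSet s = M.sideSet s') :
    ∃ c < 0, ∀ y, M.sideFun s' y = c * M.sideFun s y := by
  have hk : s.1 ≠ s'.1 := fun e => hne (M.eq_of_sideSet_eq_of_fst_eq h e)
  obtain ⟨m⟩ := M.sideSet_faceMatch h
  set G := M.transition s.1 s'.1 with hG
  set c : ℝ := sgn s'.2.2 * (sgn s.2.2 * G.linear (Pi.single s.2.1 1) s'.2.1) with hc
  have hfun : ∀ y, M.sideFun s' y = c * M.sideFun s y := fun y => by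
    set x := M.coord s.1 y with hx
    set x' := update x s.2.1 (sgn s.2.2) with hx'
    have hh : x' ∈ faceHull (sideSign s.2.1 s.2.2) := mem_faceHull_sideSign.2 (by rw [hx', update_self])
    have h1 := mem_faceHull_sideSign.1 (m.mem_hull _ hh)
    have h2 : x = (x s.2.1 - sgn s.2.2) • Pi.single s.2.1 (1 : ℝ) + x' := by
      funext j
      by_cases hj : j = s.2.1
      · subst hj; simp [hx']
      · simp [hx', hj]
    have h3 : G x = G.linear ((x s.2.1 - sgn s.2.2) • Pi.single s.2.1 (1 : ℝ)) + G x' := by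
      have := G.map_vadd x' ((x s.2.1 - sgn s.2.2) • Pi.single s.2.1 (1 : ℝ))
      rwa [vadd_eq_add, vadd_eq_add, ← h2] at this
    have h4 := congrFun h3 s'.2.1
    rw [hx, transition_coord, map_smul, Pi.add_apply, Pi.smul_apply, smul_eq_mul, h1] at h4
    rw [sideFun, sideFun, h4, hc]
    have e1 := sgn_mul_self s.2.2
    have e2 := sgn_mul_self s'.2.2
    linear_combination e2 - sgn s'.2.2 * (G.linear (Pi.single s.2.1 1)) s'.2.1 *
      (M.coord s.1 y s.2.1) * e1
  refine ⟨c, ?_, hfun⟩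
  by_contra hcneg
  rcases (not_lt.1 hcneg).eq_or_lt with h0 | hpos
  · have h1 := hfun (M.chart s'.1 0)
    rw [← h0, zero_mul, sideFun, AffineEquiv.symm_apply_apply] at h1
    simp at h1
  · have hx := M.sideCenter_mem s
    have hx' := M.sideInterior_subset_of_sideSet_eq h hx
    have hev := (M.tendsto_chart_update hx).eventually
      ((M.eventually_half_space hx).and (M.eventually_half_space hx'))
    obtain ⟨ε, ⟨h1, h2⟩, hε⟩ :=
      ((hev.filter_mono nhdsWithin_le_nhds).and (self_mem_nhdsWithin (s := Set.Iio (0 : ℝ)))).exists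
    have hε : ε < 0 := hε
    have e1 := h1.2 (by rw [sideFun_chart_update]; exact hε)
    have e2 := h2.2 (by rw [hfun, sideFun_chart_update]; exact mul_neg_of_pos_of_neg hpos hε)
    exact Set.disjoint_left.1 (M.disj _ _ hk) e1 e2

lemma normal_eq_neg {s s' : M.Side} (hne : s ≠ s') (h : M.sideSet s = M.sideSet s') :
    M.normal s' = -M.normal s := by
  obtain ⟨c, hc, hfun⟩ := M.exists_sideFun_eq_mul hne h
  have h1 : M.normalDir s' = c • M.normalDir s := ext_inner_right ℝ fun v => by
    have h2 := M.sideFun_add s' 0 v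
    have h3 := M.sideFun_add s 0 v
    rw [hfun, hfun, h3] at h2
    rw [inner_smul_left]
    simp only [conj_trivial]
    linarith
  rw [normal_eq, normal_eq, h1, norm_smul, Real.norm_eq_abs, abs_of_neg hc, mul_inv, smul_smul,
    ← neg_smul]
  congr 1
  have hc0 := hc.ne
  have hn := norm_ne_zero_iff.2 (M.normalDir_ne_zero s)
  field_simp

lemma mem_sides {f : Set (E d)} {s : M.Side} : s ∈ M.sides f ↔ M.sideSet s = f := by
  classical
  simp [sides]

/-- A face is occupied by one side or by two. -/
lemma sides_eq (s : M.Side) : M.sides (M.sideSet s) = {s} ∨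
    ∃ s', s ≠ s' ∧ M.sideSet s = M.sideSet s' ∧ M.sides (M.sideSet s) = {s, s'} := by
  by_cases h : ∃ s', s ≠ s' ∧ M.sideSet s = M.sideSet s'
  · obtain ⟨s', hne, he⟩ := h
    refine .inr ⟨s', hne, he, ?_⟩
    ext t
    rw [mem_sides, Finset.mem_insert, Finset.mem_singleton]
    constructor
    · intro ht
      by_contra! hno
      have h1 := M.normal_eq_neg hne he
      have h2 := M.normal_eq_neg hno.1.symm ht.symm
      have h3 := M.normal_eq_neg hno.2.symm (he.symm.trans ht.symm)
      rw [h1, h2, neg_neg] at h3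
      have h4 := M.norm_normal s
      have h5 := congrArg (fun v => ⟪v, M.normal s⟫) h3
      simp only [inner_neg_left, real_inner_self_eq_norm_sq, h4] at h5
      norm_num at h5
    · rintro (rfl | rfl)
      exacts [rfl, he.symm]
  · push Not at h
    left
    ext t
    rw [mem_sides, Finset.mem_singleton]
    constructor
    · intro ht
      by_contra hne
      exact h t (Ne.symm hne) ht.symm
    · rintro rfl; rfl

/-- A face that is occupied by a single side lies in the boundary of the domain. -/
lemma sideSet_subset_frontier (hΩ : IsOpen Ω) (hc : Convex ℝ Ω) {s : M.Side}
    (hs : M.sides (M.sideSet s) = {s}) : M.sideSet s ⊆ frontier Ω := by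
  set x := M.sideCenter s with hxdef
  have hx := M.sideCenter_mem s
  rw [← hxdef] at hx
  by_cases hfr : x ∈ frontier Ω
  · rw [sideSet_eq]
    refine M.chart_image_subset_frontier hΩ hc hfr (mem_faceHull_sideSign.2 hx.1) fun i hi => ?_
    exact hx.2 i fun e => sideSign_ne_zero_iff.2 e hi
  · exfalso
    have hxΩ : x ∈ Ω := by
      by_contra h
      rw [hΩ.frontier_eq] at hfr
      exact hfr ⟨M.closure_elem_subset _ (M.sideSet_subset s (M.sideInterior_subset s hx)), h⟩
    -- the points just beyond the face belong to other elements
    have hclosed : IsClosed (⋃ l : {l // l ≠ s.1}, closure (M.elem l)) :=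
      isClosed_iUnion_of_finite fun _ => isClosed_closure
    have hev : ∀ᶠ ε : ℝ in 𝓝[>] 0,
        M.chart s.1 (update (M.coord s.1 x) s.2.1 (sgn s.2.2 * (1 + ε))) ∈
          ⋃ l : {l // l ≠ s.1}, closure (M.elem l) := by
      have h1 := ((M.tendsto_chart_update hx).eventually (hΩ.mem_nhds hxΩ)).filter_mono
        (nhdsWithin_le_nhds (s := Set.Ioi 0))
      filter_upwards [h1, self_mem_nhdsWithin] with ε hε hε0
      have hε0 : 0 < ε := hε0
      obtain ⟨l, hl⟩ := M.exists_mem_closure_elem (subset_closure hε)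
      refine Set.mem_iUnion.2 ⟨⟨l, ?_⟩, hl⟩
      rintro rfl
      have h2 := M.sideFun_chart_update s (M.coord s.1 x) ε
      have h3 := M.mem_closure_elem.1 hl s.2.1
      rw [sideFun] at h2
      rcases sgn_eq_one_or s.2.2 with e | e <;> simp only [e] at h2 h3 <;> linarith [h3.1, h3.2]
    have hmem := hclosed.mem_of_tendsto
      ((M.tendsto_chart_update hx).mono_left nhdsWithin_le_nhds) hev
    obtain ⟨⟨l, hl⟩, hxl⟩ := Set.mem_iUnion.1 hmem
    obtain ⟨s₁, t, hs0, h1, h2⟩ := M.exists_common_face (Ne.symm hl)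
      (M.sideSet_subset s (M.sideInterior_subset s hx)) hxl
    have hxs : M.coord s.1 x ∈ cubeFace s₁ := M.mem_chart_image.1
      (h1 ▸ ⟨M.sideSet_subset s (M.sideInterior_subset s hx), hxl⟩)
    have hs₁ : s₁ = sideSign s.2.1 s.2.2 := by
      have hzero : ∀ j, j ≠ s.2.1 → s₁ j = 0 := fun j hj => by
        by_contra hj0
        have h3 := hx.2 j hj
        rw [hxs.2 j hj0] at h3
        rcases sign_eq_one_or hj0 with e | e <;> rw [e] at h3 <;> simp at h3
      obtain ⟨j, hj⟩ : ∃ j, s₁ j ≠ 0 := by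
        by_contra! hall
        exact hs0 (funext hall)
      have hji : j = s.2.1 := by
        by_contra hne; exact hj (hzero j hne)
      subst hji
      funext j
      by_cases hj' : j = s.2.1
      · subst hj'
        have h3 := hxs.2 _ hj
        rw [hx.1, ← sideSign_self s.2.1 s.2.2] at h3
        revert h3
        generalize sideSign s.2.1 s.2.2 s.2.1 = a
        generalize s₁ s.2.1 = b
        cases a <;> cases b <;> simp <;> norm_num
      · rw [hzero j hj', sideSign_of_ne hj']
    subst hs₁
    obtain ⟨m⟩ := M.transition_faceMatch (h1.symm.trans h2)
    -- the pattern `t` has exactly one frozen coordinate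
    have hcard : Fintype.card {j // ¬ t j = 0} = 1 := by
      have e1 := m.card_eq
      have e2 := Fintype.card_subtype_compl (fun j => t j = 0)
      have e3 := Fintype.card_subtype_compl (fun j => sideSign s.2.1 s.2.2 j = 0)
      have e4 : Fintype.card {j // ¬ sideSign s.2.1 s.2.2 j = 0} = 1 :=
        Fintype.card_eq_one_iff.2 ⟨⟨s.2.1, sideSign_ne_zero_iff.2 rfl⟩, fun j =>
          Subtype.ext (sideSign_ne_zero_iff.1 j.2)⟩
      rw [e2, ← e1, ← e3, e4]
    obtain ⟨⟨i', hi'⟩, huniq⟩ := Fintype.card_eq_one_iff.1 hcard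
    obtain ⟨b', hb'⟩ : ∃ b', t = sideSign i' b' := by
      refine ⟨decide (t i' = 1), funext fun j => ?_⟩
      by_cases hj : j = i'
      · subst hj
        unfold sideSign
        rw [Pi.single_eq_same]
        have key : ∀ a : SignType, a ≠ 0 → a = if decide (a = 1) = true then 1 else -1 := by
          decide
        exact key _ hi'
      · rw [sideSign_of_ne hj]
        by_contra h0
        exact hj (congrArg Subtype.val (huniq ⟨j, h0⟩))
    have hmem' : ((l, i', b') : M.Side) ∈ M.sides (M.sideSet s) := by
      rw [mem_sides, sideSet_eq, sideSet_eq]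
      simp only
      rw [← hb', ← h1, ← h2]
    rw [hs, Finset.mem_singleton] at hmem'
    exact hl (congrArg Prod.fst hmem')

end Sides

end Mesh

namespace Mesh

/-! ### The elements around a point are connected through faces -/

section Connectivity

open Function Filter Topology

variable {d : ℕ} {Ω : Set (E d)} (M : Mesh Ω)

/-- For a given endpoint `c`, segments from a generic point `a` avoid a plane of codimension two (except
possibly at `c`): it is enough that `a` is off a hyperplane through the plane and `c`. -/
lemma exists_dense_avoiding (c : E d) (l : Fin M.n) {i j : Fin d} (hij : i ≠ j) (b b' : ℝ) :
    ∃ D : Set (E d), IsOpen D ∧ Dense D ∧ ∀ a ∈ D, ∀ τ : ℝ, AffineMap.lineMap a c τ ≠ c →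
      ¬ (M.coord l (AffineMap.lineMap a c τ) i = b ∧ M.coord l (AffineMap.lineMap a c τ) j = b') := by
  obtain ⟨α, β, hne, hc⟩ : ∃ α β : ℝ, 0 < α ^ 2 + β ^ 2 ∧
      α * (M.coord l c i - b) + β * (M.coord l c j - b') = 0 := by
    by_cases h : M.coord l c i - b = 0
    · exact ⟨1, 0, by norm_num, by rw [h]; ring⟩
    · exact ⟨-(M.coord l c j - b'), M.coord l c i - b, by positivity, by ring⟩
  set φ : E d → ℝ := fun z => α * (M.coord l z i - b) + β * (M.coord l z j - b') with hφ
  have hcont : Continuous φ := by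
    have h1 := M.continuous_coord_apply l i
    have h2 := M.continuous_coord_apply l j
    fun_prop
  have hline : ∀ a τ, φ (AffineMap.lineMap a c τ) = (1 - τ) * φ a := fun a τ => by
    have h1 : M.coord l (AffineMap.lineMap a c τ) =
        AffineMap.lineMap (M.coord l a) (M.coord l c) τ := (M.coord l).toAffineMap.apply_lineMap a c τ
    simp only [hφ, h1]
    simp only [AffineMap.lineMap_apply, vsub_eq_sub, vadd_eq_add, Pi.add_apply,
      Pi.smul_apply, Pi.sub_apply, smul_eq_mul]
    linear_combination τ * hc
  refine ⟨{a | φ a ≠ 0}, isOpen_ne_fun hcont continuous_const, fun a => ?_, ?_⟩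
  · by_cases ha : φ a = 0
    · set u : ℝ → E d := fun ε => M.chart l (M.coord l a + ε • (Pi.single i α + Pi.single j β)) with hu
      have hut : Tendsto u (𝓝 0) (𝓝 a) := by
        have : Continuous u := (M.continuous_chart l).comp (by fun_prop)
        have h := this.tendsto 0
        simpa [hu] using h
      refine mem_closure_of_tendsto (hut.mono_left (nhdsWithin_le_nhds (s := {0}ᶜ))) ?_
      filter_upwards [self_mem_nhdsWithin] with ε hε
      have hε : ε ≠ 0 := hε
      have h1 : φ (u ε) = φ a + ε * (α ^ 2 + β ^ 2) := by
        simp only [hφ, hu, AffineEquiv.symm_apply_apply, Pi.add_apply, Pi.smul_apply, smul_eq_mul,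
          Pi.single_eq_same, Pi.single_eq_of_ne hij, Pi.single_eq_of_ne hij.symm]
        ring
      rw [h1, ha, zero_add]
      exact mul_ne_zero hε hne.ne'
    · exact subset_closure ha
  · rintro a ha τ hτ ⟨h1, h2⟩
    have h3 := hline a τ
    have h4 : φ (AffineMap.lineMap a c τ) = 0 := by simp only [hφ, h1, h2]; ring
    rw [h4] at h3
    rcases mul_eq_zero.1 h3.symm with h | h
    · have : τ = 1 := by linarith
      rw [this, AffineMap.lineMap_apply_one] at hτ
      exact hτ rfl
    · exact ha h

/-- A face-connected family of elements around `y` either fills a neighbourhood of `y` or has a face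
through `y` that belongs to no other element. Otherwise a generic segment leaves the family through a
relatively interior point of a face, behind which there is another element of the family. -/
lemma exists_single_side_or_mem_nhds (y : E d) (S : Set (Fin M.n)) {k : Fin M.n} (hk : k ∈ S)
    (hy : y ∈ closure (M.elem k))
    (hclosed : ∀ s s' : M.Side, s.1 ∈ S → y ∈ M.sideSet s → s ≠ s' → M.sideSet s = M.sideSet s' →
      s'.1 ∈ S) :
    (∃ s : M.Side, s.1 ∈ S ∧ y ∈ M.sideSet s ∧ M.sides (M.sideSet s) = {s}) ∨
      (⋃ l ∈ S, closure (M.elem l)) ∈ 𝓝 y := by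
  by_contra! hcon
  obtain ⟨hno, hT⟩ := hcon
  set T := ⋃ l ∈ S, closure (M.elem l) with hTdef
  have hTc : IsClosed T := Set.Finite.isClosed_biUnion (Set.toFinite S) fun _ _ => isClosed_closure
  have hev : ∀ᶠ z in 𝓝 y, ∀ s : M.Side, z ∈ M.sideSet s → y ∈ M.sideSet s := by
    rw [eventually_all]
    intro s
    by_cases h : y ∈ M.sideSet s
    · exact Eventually.of_forall fun _ _ => h
    · filter_upwards [(M.isCompact_sideSet s).isClosed.isOpen_compl.mem_nhds h] with z hz hz'
      exact absurd hz' hz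
  obtain ⟨r, hr, hball⟩ := Metric.mem_nhds_iff.1 hev
  -- a point `c` near `y` outside the family, and a generic point `a` near `y` in the element `k`
  obtain ⟨c, hcU, hcT⟩ : ∃ c ∈ Metric.ball y r, c ∉ T := by
    by_contra! h
    exact hT (mem_of_superset (Metric.ball_mem_nhds y hr) h)
  choose D hDo hDd hD using fun q : Fin M.n × {ij : Fin d × Fin d // ij.1 ≠ ij.2} × Bool × Bool =>
    M.exists_dense_avoiding c q.1 q.2.1.2 (sgn q.2.2.1) (sgn q.2.2.2)
  have hDense : Dense (⋂ q, D q) := dense_iInter_of_isOpen hDo hDd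
  obtain ⟨a, ⟨haU, hak⟩, haD⟩ := hDense.inter_open_nonempty
    (Metric.ball y r ∩ M.elem k) (Metric.isOpen_ball.inter (M.isOpen_elem k))
    (by
      obtain ⟨z, hz1, hz2⟩ := mem_closure_iff.1 hy _ Metric.isOpen_ball (Metric.mem_ball_self hr)
      exact ⟨z, hz1, hz2⟩)
  have haT : a ∈ T := Set.mem_biUnion hk (subset_closure hak)
  -- the segment from `a` to `c` leaves the family at some point `x`
  obtain ⟨x, hxseg, hxfr⟩ : (segment ℝ a c ∩ frontier T).Nonempty := by
    by_contra hemp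
    have hint : ∀ z ∈ segment ℝ a c, z ∈ T → z ∈ interior T := fun z hz hzT => by
      by_contra h
      exact hemp ⟨z, hz, by rw [hTc.frontier_eq]; exact ⟨hzT, h⟩⟩
    obtain ⟨z, -, hz1, hz2⟩ := (convex_segment a c).isPreconnected (interior T) Tᶜ isOpen_interior
      hTc.isOpen_compl (fun z hz => (em (z ∈ T)).imp (hint z hz) id)
      ⟨a, left_mem_segment ℝ a c, hint a (left_mem_segment ℝ a c) haT⟩
      ⟨c, right_mem_segment ℝ a c, hcT⟩
    exact hz2 (interior_subset hz1)
  have hxT : x ∈ T := hTc.frontier_subset hxfr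
  have hxU : x ∈ Metric.ball y r := (convex_ball y r).segment_subset haU hcU hxseg
  have hxc : x ≠ c := by rintro rfl; exact hcT hxT
  have hxint : T ∉ 𝓝 x := fun h => hxfr.2 (mem_interior_iff_mem_nhds.2 h)
  obtain ⟨l, hlS, hxl⟩ := Set.mem_iUnion₂.1 hxT
  have hxIcc := M.mem_closure_elem.1 hxl
  have hend : ∀ i, M.coord l x i ∉ Set.Ioo (-1 : ℝ) 1 → ∃ b, M.coord l x i = sgn b := fun i hi => by
    rw [Set.mem_Ioo, not_and_or, not_lt, not_lt] at hi
    rcases hi with h | h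
    · exact ⟨false, by simp only [sgn]; exact le_antisymm h (hxIcc i).1⟩
    · exact ⟨true, by simp only [sgn]; exact le_antisymm (hxIcc i).2 h⟩
  obtain ⟨i, hi⟩ : ∃ i, M.coord l x i ∉ Set.Ioo (-1 : ℝ) 1 := by
    by_contra! h
    refine hxint (mem_of_superset ((M.isOpen_elem l).mem_nhds (M.mem_elem.2 h)) ?_)
    exact subset_closure.trans (Set.subset_biUnion_of_mem (u := fun l => closure (M.elem l)) hlS)
  obtain ⟨b, hb⟩ := hend i hi
  -- `x` has a single frozen coordinate since the segment avoids the planes of codimension two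
  have hxs : x ∈ M.sideInterior (l, i, b) := by
    refine ⟨hb, fun j hj => ?_⟩
    by_contra hj'
    obtain ⟨b', hb'⟩ := hend j hj'
    rw [segment_eq_image_lineMap] at hxseg
    obtain ⟨τ, -, rfl⟩ := hxseg
    exact hD (l, ⟨(i, j), Ne.symm hj⟩, b, b') a (Set.mem_iInter.1 haD _) τ hxc ⟨hb, hb'⟩
  have hys : y ∈ M.sideSet (l, i, b) := hball hxU _ (M.sideInterior_subset _ hxs)
  rcases M.sides_eq (l, i, b) with h1 | ⟨s', hne, he, -⟩
  · exact hno _ hlS hys h1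
  · have hs'S := hclosed _ s' hlS hys hne he
    obtain ⟨e, he0, hfun⟩ := M.exists_sideFun_eq_mul hne he
    have hxs' := M.sideInterior_subset_of_sideSet_eq he hxs
    refine hxint ?_
    filter_upwards [M.eventually_half_space hxs, M.eventually_half_space hxs'] with z hz hz'
    rcases le_or_gt (M.sideFun (l, i, b) z) 0 with h | h
    · exact Set.mem_biUnion hlS (hz.1 h)
    · refine Set.mem_biUnion hs'S (hz'.1 ?_)
      rw [hfun]
      exact (mul_neg_of_neg_of_pos he0 h).le

/-! ### Jumps control the deviation from the nodal mean -/

lemma jump_of_sides_eq_singleton (v : M.Broken) {s : M.Side} (h : M.sides (M.sideSet s) = {s})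
    (x : E d) : M.jump v (M.sideSet s) x = v s.1 x • M.normal s := by
  rw [jump, h, Finset.sum_singleton]

lemma jump_of_sides_eq_pair (v : M.Broken) {s s' : M.Side} (hne : s ≠ s')
    (he : M.sideSet s = M.sideSet s') (h : M.sides (M.sideSet s) = {s, s'}) (x : E d) :
    M.jump v (M.sideSet s) x = (v s.1 x - v s'.1 x) • M.normal s := by
  rw [jump, h, Finset.sum_pair hne, M.normal_eq_neg hne he, sub_smul, smul_neg, sub_eq_add_neg]

lemma sides_eq_pair {s s' : M.Side} (hne : s ≠ s') (he : M.sideSet s = M.sideSet s') :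
    M.sides (M.sideSet s) = {s, s'} := by
  have hs' : s' ∈ M.sides (M.sideSet s) := M.mem_sides.2 he.symm
  rcases M.sides_eq s with h | ⟨t, hnt, -, h⟩
  · rw [h, Finset.mem_singleton] at hs'
    exact absurd hs'.symm hne
  · rw [h, Finset.mem_insert, Finset.mem_singleton] at hs'
    rcases hs' with e | e
    · exact absurd e.symm hne
    · rw [h, e]

lemma norm_jump_of_pair (v : M.Broken) {s s' : M.Side} (hne : s ≠ s')
    (he : M.sideSet s = M.sideSet s') (x : E d) :
    ‖M.jump v (M.sideSet s) x‖ = |v s.1 x - v s'.1 x| := by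
  rw [M.jump_of_sides_eq_pair v hne he (M.sides_eq_pair hne he), norm_smul, norm_normal, mul_one,
    Real.norm_eq_abs]

lemma norm_jump_of_singleton (v : M.Broken) {s : M.Side} (h : M.sides (M.sideSet s) = {s})
    (x : E d) : ‖M.jump v (M.sideSet s) x‖ = |v s.1 x| := by
  rw [M.jump_of_sides_eq_singleton v h, norm_smul, norm_normal, mul_one, Real.norm_eq_abs]

lemma sideSet_mem_faces (s : M.Side) : M.sideSet s ∈ M.faces := by
  classical
  exact Finset.mem_image_of_mem _ (Finset.mem_univ s)

lemma mem_faces {f : Set (E d)} : f ∈ M.faces ↔ ∃ s, M.sideSet s = f := by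
  classical
  simp [faces]

open Classical in
/-- The sum of the squared jumps at a point over all faces through it. -/
def jumpSum (v : M.Broken) (y : E d) : ℝ := ∑ f ∈ M.faces.filter (y ∈ ·), ‖M.jump v f y‖ ^ 2

lemma jumpSum_nonneg (v : M.Broken) (y : E d) : 0 ≤ M.jumpSum v y :=
  Finset.sum_nonneg fun _ _ => sq_nonneg _

lemma norm_jump_le_sqrt_jumpSum (v : M.Broken) {s : M.Side} {y : E d} (hy : y ∈ M.sideSet s) :
    ‖M.jump v (M.sideSet s) y‖ ≤ √(M.jumpSum v y) := by
  classical
  refine Real.le_sqrt_of_sq_le ?_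
  exact Finset.single_le_sum (f := fun f => ‖M.jump v f y‖ ^ 2) (fun _ _ => sq_nonneg _)
    (Finset.mem_filter.2 ⟨M.sideSet_mem_faces s, hy⟩)

/-- The graph of the elements around `y`, adjacent when they share a face through `y`. -/
def starGraph (y : E d) : SimpleGraph {l // y ∈ closure (M.elem l)} :=
  SimpleGraph.fromRel fun l l' => ∃ s s' : M.Side, s.1 = l ∧ s'.1 = l' ∧ y ∈ M.sideSet s ∧
    s ≠ s' ∧ M.sideSet s = M.sideSet s'

lemma abs_sub_le_of_adj (v : M.Broken) {y : E d} {l l' : {l // y ∈ closure (M.elem l)}}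
    (h : (M.starGraph y).Adj l l') : |v l y - v l' y| ≤ √(M.jumpSum v y) := by
  rw [starGraph, SimpleGraph.fromRel_adj] at h
  rcases h.2 with ⟨s, s', h1, h2, hy, hne, he⟩ | ⟨s, s', h1, h2, hy, hne, he⟩
  · rw [← h1, ← h2, ← M.norm_jump_of_pair v hne he]
    exact M.norm_jump_le_sqrt_jumpSum v hy
  · rw [abs_sub_comm, ← h1, ← h2, ← M.norm_jump_of_pair v hne he]
    exact M.norm_jump_le_sqrt_jumpSum v hy

lemma abs_sub_le_of_walk (v : M.Broken) {y : E d} {l l' : {l // y ∈ closure (M.elem l)}}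
    (w : (M.starGraph y).Walk l l') : |v l y - v l' y| ≤ w.length * √(M.jumpSum v y) := by
  induction w with
  | nil => simp
  | @cons a b c h w ih =>
    have h1 := M.abs_sub_le_of_adj v h
    have h2 := abs_sub_le (v a y) (v b y) (v c y)
    rw [SimpleGraph.Walk.length_cons]
    push_cast
    linarith

open Classical in
/-- The number of closed elements that contain a point. -/
def starCard (y : E d) : ℕ := Fintype.card {l // y ∈ closure (M.elem l)}

lemma abs_sub_le_of_reachable (v : M.Broken) {y : E d} {l l' : {l // y ∈ closure (M.elem l)}}
    (h : (M.starGraph y).Reachable l l') :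
    |v l y - v l' y| ≤ (M.starCard y - 1) * √(M.jumpSum v y) := by
  classical
  obtain ⟨w, hw⟩ := h.exists_isPath
  refine (M.abs_sub_le_of_walk v w).trans (mul_le_mul_of_nonneg_right ?_ (Real.sqrt_nonneg _))
  have := hw.length_lt
  rw [le_sub_iff_add_le]
  exact_mod_cast this

lemma frontier_not_mem_nhds (hΩ : IsOpen Ω) (hc : Convex ℝ Ω) (k : Fin M.n) {y : E d}
    (hy : y ∈ frontier Ω) : closure Ω ∉ 𝓝 y := fun h => by
  have hne : (interior Ω).Nonempty := by
    rw [hΩ.interior_eq]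
    exact closure_nonempty_iff.1 ⟨_, M.closure_elem_subset k (subset_closure (M.chart_zero_mem k))⟩
  have h1 := mem_interior_iff_mem_nhds.2 h
  rw [hc.interior_closure_eq_interior_of_nonempty_interior hne] at h1
  exact hy.2 h1

/-- The value of a broken function at a point differs from the nodal mean by a multiple of the jumps
at that point. At a point of the domain all elements around it are reachable through faces from any of
them; at a boundary point a boundary face, across which the jump is the value itself, is reachable. -/
lemma abs_sub_nodalMean_le (hΩ : IsOpen Ω) (hc : Convex ℝ Ω) (v : M.Broken) {k : Fin M.n} {y : E d}
    (hy : y ∈ closure (M.elem k)) :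
    |v k y - M.nodalMean v y| ≤ M.starCard y * √(M.jumpSum v y) := by
  classical
  set S : Set (Fin M.n) := {l | ∃ h, (M.starGraph y).Reachable ⟨k, hy⟩ ⟨l, h⟩} with hS
  have hkS : k ∈ S := ⟨hy, SimpleGraph.Reachable.refl _⟩
  have hJ := Real.sqrt_nonneg (M.jumpSum v y)
  have hSle : ∀ l ∈ S, |v k y - v l y| ≤ (M.starCard y - 1) * √(M.jumpSum v y) := fun l hl => by
    obtain ⟨h, hr⟩ := hl
    exact M.abs_sub_le_of_reachable v hr
  have hclosed : ∀ s s' : M.Side, s.1 ∈ S → y ∈ M.sideSet s → s ≠ s' →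
      M.sideSet s = M.sideSet s' → s'.1 ∈ S := by
    rintro s s' ⟨h, hr⟩ hys hne he
    have hys' : y ∈ closure (M.elem s'.1) := M.sideSet_subset s' (he ▸ hys)
    refine ⟨hys', hr.trans (SimpleGraph.Adj.reachable ?_)⟩
    rw [starGraph, SimpleGraph.fromRel_adj]
    refine ⟨fun e => hne (M.eq_of_sideSet_eq_of_fst_eq he (congrArg Subtype.val e)), .inl ?_⟩
    exact ⟨s, s', rfl, rfl, hys, hne, he⟩
  have hmain := M.exists_single_side_or_mem_nhds y S hkS hy hclosed
  by_cases hfr : y ∈ frontier Ω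
  · rw [nodalMean, if_pos hfr, sub_zero]
    rcases hmain with ⟨s, hsS, hys, hs⟩ | hT
    · have h1 := hSle _ hsS
      have h2 := M.norm_jump_le_sqrt_jumpSum v hys
      rw [M.norm_jump_of_singleton v hs] at h2
      have h3 := abs_add_le (v k y - v s.1 y) (v s.1 y)
      rw [sub_add_cancel] at h3
      linarith
    · refine absurd (mem_of_superset hT ?_) (M.frontier_not_mem_nhds hΩ hc k hfr)
      exact Set.iUnion₂_subset fun l _ => M.closure_elem_subset l
  · have hT : (⋃ l ∈ S, closure (M.elem l)) ∈ 𝓝 y := by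
      rcases hmain with ⟨s, -, hys, hs⟩ | hT
      · exact absurd (M.sideSet_subset_frontier hΩ hc hs hys) hfr
      · exact hT
    have hall : ∀ l, y ∈ closure (M.elem l) → l ∈ S := fun l hl => by
      obtain ⟨z, hz, hzl⟩ := mem_closure_iff_nhds.1 hl _ hT
      obtain ⟨l', hl'S, hzl'⟩ := Set.mem_iUnion₂.1 hz
      rwa [M.eq_of_mem_elem_of_mem_closure hzl hzl']
    rw [nodalMean, if_neg hfr]
    set K := Finset.univ.filter fun l => y ∈ closure (M.elem l) with hK
    have hKpos : (0 : ℝ) < K.card := by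
      have : 0 < K.card := Finset.card_pos.2 ⟨k, Finset.mem_filter.2 ⟨Finset.mem_univ k, hy⟩⟩
      exact_mod_cast this
    have hdiff : v k y - (K.card : ℝ)⁻¹ * ∑ l ∈ K, v l y =
        (K.card : ℝ)⁻¹ * ∑ l ∈ K, (v k y - v l y) := by
      rw [Finset.sum_sub_distrib, Finset.sum_const, nsmul_eq_mul]
      field_simp
    rw [hdiff, abs_mul, abs_of_pos (inv_pos.2 hKpos), inv_mul_le_iff₀ hKpos]
    calc |∑ l ∈ K, (v k y - v l y)| ≤ ∑ l ∈ K, |v k y - v l y| := Finset.abs_sum_le_sum_abs _ _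
      _ ≤ ∑ l ∈ K, M.starCard y * √(M.jumpSum v y) := by
        refine Finset.sum_le_sum fun l hl => ?_
        have := hSle l (hall l (Finset.mem_filter.1 hl).2)
        linarith
      _ = _ := by rw [Finset.sum_const, nsmul_eq_mul]

lemma sq_sub_nodalMean_le (hΩ : IsOpen Ω) (hc : Convex ℝ Ω) (v : M.Broken) {k : Fin M.n} {y : E d}
    (hy : y ∈ closure (M.elem k)) :
    (v k y - M.nodalMean v y) ^ 2 ≤ (M.starCard y : ℝ) ^ 2 * M.jumpSum v y := by
  have h := M.abs_sub_nodalMean_le hΩ hc v hy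
  rw [← sq_abs, ← Real.sq_sqrt (M.jumpSum_nonneg v y), ← mul_pow]
  exact pow_le_pow_left₀ (abs_nonneg _) h 2

end Connectivity

end Mesh

/-! ### The polynomial spaces -/

section PolynomialSpaces

open Function Polynomial

variable {d p : ℕ}

lemma eval_update_eq (q : MvPolynomial (Fin d) ℝ) (i : Fin d) (x : Fin d → ℝ) (t : ℝ) :
    MvPolynomial.eval (update x i t) q =
      (∑ m ∈ q.support, C (q.coeff m * ∏ j ∈ Finset.univ.erase i, x j ^ m j) * X ^ m i).eval t := by
  rw [MvPolynomial.eval_eq', eval_finsetSum]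
  refine Finset.sum_congr rfl fun m _ => ?_
  rw [← Finset.mul_prod_erase _ _ (Finset.mem_univ i), update_self]
  simp only [eval_mul, eval_C, eval_pow, eval_X]
  rw [Finset.prod_congr rfl fun j hj => by rw [update_of_ne (Finset.ne_of_mem_erase hj)]]
  ring

lemma isSepPoly_of_mem_Qp {f : E d → ℝ} (hf : f ∈ Qp d p) :
    IsSepPoly p fun x : Fin d → ℝ => f (WithLp.toLp 2 x) := by
  obtain ⟨q, hq, hfq⟩ := hf
  simp only [hfq]
  refine ⟨MvPolynomial.continuous_eval q, fun i x => ⟨_, ?_, fun t => eval_update_eq q i x t⟩⟩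
  refine natDegree_sum_le_of_forall_le _ _ fun m hm => (natDegree_C_mul_X_pow_le _ _).trans ?_
  exact (MvPolynomial.mem_restrictDegree _ _ _).1 hq m hm i

lemma contDiff_of_mem_Qp {f : E d → ℝ} (hf : f ∈ Qp d p) : ContDiff ℝ 1 f := by
  obtain ⟨q, -, hfq⟩ := hf
  have : f = fun x : E d => ∑ m ∈ q.support, q.coeff m * ∏ i, x i ^ m i := by
    funext x; rw [hfq, MvPolynomial.eval_eq']
  rw [this]
  fun_prop

lemma degreeOf_toMvPolynomial_le (P : ℝ[X]) (i j : Fin d) :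
    (P.toMvPolynomial i).degreeOf j ≤ if j = i then P.natDegree else 0 := by
  rw [Polynomial.toMvPolynomial, aeval_eq_sum_range]
  refine (MvPolynomial.degreeOf_sum_le _ _ _).trans (Finset.sup_le fun k hk => ?_)
  rw [MvPolynomial.smul_eq_C_mul]
  refine (MvPolynomial.degreeOf_C_mul_le _ _ _).trans ?_
  split_ifs with h
  · subst h
    rw [MvPolynomial.degreeOf_X_self_pow]
    exact Nat.lt_succ_iff.1 (Finset.mem_range.1 hk)
  · rw [MvPolynomial.degreeOf_X_pow_of_ne k h]

lemma refLagrange_mem_Qp (hp : 0 < p) {ξ : Fin d → ℝ} (hξ : ξ ∈ refNodes d p) :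
    (refLagrange p ξ : E d → ℝ) ∈ Qp d p := by
  refine ⟨∏ i, (gllBasis p (ξ i)).toMvPolynomial i, ?_, fun x => ?_⟩
  · rw [MvPolynomial.mem_restrictDegree]
    intro m hm j
    refine MvPolynomial.degreeOf_le_iff.1 ?_ m hm
    refine (MvPolynomial.degreeOf_prod_le _ _ _).trans ?_
    refine (Finset.sum_le_sum fun i _ => degreeOf_toMvPolynomial_le _ i j).trans ?_
    rw [Finset.sum_ite_eq, if_pos (Finset.mem_univ j), natDegree_gllBasis hp (mem_refNodes.1 hξ j)]
  · rw [map_prod]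
    simp only [MvPolynomial.eval_toMvPolynomial, refLagrange]

lemma refLagrange_node {ξ η : Fin d → ℝ} (hη : η ∈ refNodes d p) :
    refLagrange p ξ (WithLp.toLp 2 η) = if ξ = η then 1 else 0 := by
  split_ifs with h
  · subst h
    exact Finset.prod_eq_one fun i _ => gllBasis_self (mem_refNodes.1 hη i)
  · obtain ⟨i, hi⟩ := Function.ne_iff.1 h
    exact Finset.prod_eq_zero (Finset.mem_univ i) (gllBasis_of_ne (mem_refNodes.1 hη i) hi)

end PolynomialSpaces

namespace Mesh

/-! ### The Oswald operator -/

section Oswald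

open Function Filter Topology

variable {d : ℕ} {Ω : Set (E d)} (M : Mesh Ω) {p : ℕ}

lemma isSepPoly_chart {v : M.Broken} (hv : v ∈ M.Vhp p) (k : Fin M.n) :
    IsSepPoly p fun ξ => v k (M.chart k ξ) :=
  isSepPoly_of_mem_Qp (hv k)

lemma contDiff_of_mem_Vhp {v : M.Broken} (hv : v ∈ M.Vhp p) (k : Fin M.n) : ContDiff ℝ 1 (v k) := by
  have h1 : v k = (v k ∘ M.F k) ∘ (M.F k).symm := by
    funext x; simp
  have h2 : ((M.F k).symm : E d → E d) =
      ((M.F k).symm.toContinuousAffineEquiv.toContinuousAffineMap : E d → E d) := rfl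
  rw [h1, h2]
  exact (contDiff_of_mem_Qp (hv k)).comp (ContinuousAffineMap.contDiff _)

lemma continuous_of_mem_Vhp {v : M.Broken} (hv : v ∈ M.Vhp p) (k : Fin M.n) : Continuous (v k) :=
  (M.contDiff_of_mem_Vhp hv k).continuous

lemma Qh_mem_Vhp (hp : 0 < p) (v : M.Broken) : M.Qh p v ∈ M.Vhp p := fun k => by
  have : (M.Qh p v k ∘ M.F k) =
      ∑ ξ ∈ refNodes d p, M.nodalMean v (M.node k ξ) • refLagrange p ξ := by
    funext x
    simp [Qh, Finset.sum_apply]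
  rw [this]
  exact Submodule.sum_mem _ fun ξ hξ => Submodule.smul_mem _ _ (refLagrange_mem_Qp hp hξ)

lemma Qh_node (v : M.Broken) (k : Fin M.n) {ξ : Fin d → ℝ} (hξ : ξ ∈ refNodes d p) :
    M.Qh p v k (M.chart k ξ) = M.nodalMean v (M.chart k ξ) := by
  have h1 : (M.F k).symm (M.chart k ξ) = WithLp.toLp 2 ξ := (M.F k).symm_apply_apply _
  rw [Qh, Finset.sum_eq_single ξ]
  · rw [h1, refLagrange_node hξ, if_pos rfl, mul_one, chart_eq_node]
  · intro η _ hη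
    rw [h1, refLagrange_node hξ, if_neg hη, mul_zero]
  · exact fun h => absurd hξ h

/-- Finite element functions whose nodal values are given by a common function agree where closed
elements meet, because the nodes of the common face coincide. -/
lemma eq_of_nodal_values (hp : 0 < p) {u : M.Broken} (hu : u ∈ M.Vhp p) {g : E d → ℝ}
    (hg : ∀ k, ∀ ξ ∈ refNodes d p, u k (M.chart k ξ) = g (M.chart k ξ)) {k l : Fin M.n} {y : E d}
    (hk : y ∈ closure (M.elem k)) (hl : y ∈ closure (M.elem l)) : u k y = u l y := by
  by_cases hkl : k = l
  · rw [hkl]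
  obtain ⟨s, t, hys, ⟨m⟩⟩ := M.exists_common_faceMatch hkl hk hl
  have key := eq_zero_on_faceHull (p := p) hp (s := s)
    (f := fun x => u k (M.chart k x) - u l (M.chart l (M.transition k l x))) ?_ ?_ hys.2
  · rw [transition_coord, AffineEquiv.apply_symm_apply, AffineEquiv.apply_symm_apply] at key
    exact sub_eq_zero.1 key
  · intro i hi x hx
    obtain ⟨P, hP, hPe⟩ := (M.isSepPoly_chart hu k).exists_poly i x
    obtain ⟨R, hR, hRe⟩ := (M.isSepPoly_chart hu l).exists_poly (m.equiv ⟨i, hi⟩)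
      (M.transition k l x)
    refine ⟨P - R.comp (Polynomial.C (m.sign ⟨i, hi⟩) * Polynomial.X), ?_, fun c => ?_⟩
    · refine (Polynomial.natDegree_sub_le _ _).trans (max_le hP (Polynomial.natDegree_comp_le.trans ?_))
      have := (Polynomial.natDegree_C_mul_le (m.sign ⟨i, hi⟩) Polynomial.X).trans
        Polynomial.natDegree_X_le
      nlinarith
    · rw [m.apply_update hx hi, hPe, hRe]
      simp
  · intro ξ hξ hξs
    have h1 := hg k ξ hξ
    have h2 := hg l _ (m.mem_refNodes hp hξs hξ)
    rw [transition_apply, AffineEquiv.apply_symm_apply] at h2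
    rw [transition_apply, AffineEquiv.apply_symm_apply, h1, h2, sub_self]

/-- Finite element functions that vanish at the nodes on the boundary of a convex domain vanish on the
boundary. -/
lemma eq_zero_of_nodal_values (hΩ : IsOpen Ω) (hc : Convex ℝ Ω) (hp : 0 < p) {u : M.Broken}
    (hu : u ∈ M.Vhp p) {k : Fin M.n}
    (hg : ∀ ξ ∈ refNodes d p, M.chart k ξ ∈ frontier Ω → u k (M.chart k ξ) = 0) {y : E d}
    (hk : y ∈ closure (M.elem k)) (hy : y ∈ frontier Ω) : u k y = 0 := by
  have hIcc := M.mem_closure_elem.1 hk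
  have hsub := M.chart_image_subset_frontier hΩ hc hy (mem_faceHull_facePattern (M.coord k y))
    fun i hi => mem_Ioo_of_facePattern hIcc hi
  have key := eq_zero_on_faceHull (p := p) hp (s := facePattern (M.coord k y))
    (f := fun x => u k (M.chart k x))
    (fun i _ x _ => (M.isSepPoly_chart hu k).exists_poly i x)
    (fun ξ hξ hξs => hg ξ hξ (hsub (Set.mem_image_of_mem _
      ⟨fun i => mem_Icc_of_mem_gllNodes hp (mem_refNodes.1 hξ i), hξs⟩)))
    (mem_faceHull_facePattern (M.coord k y))
  simpa using key

lemma Qh_eq_of_mem (hp : 0 < p) (v : M.Broken) {k l : Fin M.n} {y : E d}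
    (hk : y ∈ closure (M.elem k)) (hl : y ∈ closure (M.elem l)) : M.Qh p v k y = M.Qh p v l y :=
  M.eq_of_nodal_values hp (M.Qh_mem_Vhp hp v) (fun k _ hξ => M.Qh_node v k hξ) hk hl

lemma Qh_eq_zero (hΩ : IsOpen Ω) (hc : Convex ℝ Ω) (hp : 0 < p) (v : M.Broken) {k : Fin M.n}
    {y : E d} (hk : y ∈ closure (M.elem k)) (hy : y ∈ frontier Ω) : M.Qh p v k y = 0 :=
  M.eq_zero_of_nodal_values hΩ hc hp (M.Qh_mem_Vhp hp v)
    (fun ξ hξ hfr => by rw [M.Qh_node v k hξ, nodalMean, if_pos hfr]) hk hy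

lemma Qh_mem_VC (hΩ : IsOpen Ω) (hc : Convex ℝ Ω) (hp : 0 < p) (v : M.Broken) :
    M.Qh p v ∈ M.VC p := by
  classical
  set g : E d → ℝ := fun y =>
    if h : ∃ k, y ∈ closure (M.elem k) then M.Qh p v h.choose y else 0 with hg
  have hgk : ∀ k, ∀ y ∈ closure (M.elem k), g y = M.Qh p v k y := fun k y hy => by
    have h : ∃ k, y ∈ closure (M.elem k) := ⟨k, hy⟩
    rw [hg]
    dsimp only
    rw [dif_pos h]
    exact M.Qh_eq_of_mem hp v h.choose_spec hy
  refine ⟨M.Qh_mem_Vhp hp v, g, ?_, fun y hy => ?_, fun k y hy => (hgk k y (subset_closure hy)).symm⟩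
  · rw [← M.cover]
    exact (locallyFinite_of_finite _).continuousOn_iUnion (fun _ => isClosed_closure) fun k =>
      (M.continuous_of_mem_Vhp (M.Qh_mem_Vhp hp v) k).continuousOn.congr (hgk k)
  · obtain ⟨k, hk⟩ := M.exists_mem_closure_elem (frontier_subset_closure hy)
    rw [hgk k y hk, M.Qh_eq_zero hΩ hc hp v hk hy]

lemma nodalMean_of_mem_elem (hΩ : IsOpen Ω) (hc : Convex ℝ Ω) (v : M.Broken) {k : Fin M.n} {y : E d}
    (hy : y ∈ M.elem k) : M.nodalMean v y = v k y := by
  classical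
  have h1 : y ∉ frontier Ω := fun h => by
    rw [hΩ.frontier_eq] at h
    exact h.2 (M.elem_subset hΩ hc k hy)
  have h2 : (Finset.univ.filter fun l => y ∈ closure (M.elem l)) = {k} := by
    ext l
    simp only [Finset.mem_filter, Finset.mem_univ, true_and, Finset.mem_singleton]
    constructor
    · intro hl; exact (M.eq_of_mem_elem_of_mem_closure hy hl).symm
    · rintro rfl; exact subset_closure hy
  rw [nodalMean, if_neg h1]
  convert_to ((({k} : Finset (Fin M.n)).card : ℝ))⁻¹ * ∑ l ∈ ({k} : Finset (Fin M.n)), v l y = v k y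
  · rw [← h2]
  · simp

lemma sub_Qh_mem_VB (hΩ : IsOpen Ω) (hc : Convex ℝ Ω) (hp : 0 < p) {v : M.Broken}
    (hv : v ∈ M.Vhp p) : v - M.Qh p v ∈ M.VB p := by
  refine ⟨Submodule.sub_mem _ hv (M.Qh_mem_Vhp hp v), fun k ξ hξ hint => ?_⟩
  rw [← chart_eq_node, Pi.sub_apply, Pi.sub_apply, M.Qh_node v k hξ,
    M.nodalMean_of_mem_elem hΩ hc v (M.chart_mem_elem.2 hint), sub_self]

lemma jump_Qh (hΩ : IsOpen Ω) (hc : Convex ℝ Ω) (hp : 0 < p) (v : M.Broken) {f : Set (E d)}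
    (hf : f ∈ M.faces) {x : E d} (hx : x ∈ f) : M.jump (M.Qh p v) f x = 0 := by
  obtain ⟨s, rfl⟩ := M.mem_faces.1 hf
  rcases M.sides_eq s with h | ⟨s', hne, he, h⟩
  · rw [M.jump_of_sides_eq_singleton _ h, M.Qh_eq_zero hΩ hc hp v (M.sideSet_subset s hx)
      (M.sideSet_subset_frontier hΩ hc h hx), zero_smul]
  · rw [M.jump_of_sides_eq_pair _ hne he h, M.Qh_eq_of_mem hp v (M.sideSet_subset s hx)
      (M.sideSet_subset s' (he ▸ hx)), sub_self, zero_smul]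

lemma jump_sub (v w : M.Broken) (f : Set (E d)) (x : E d) :
    M.jump (v - w) f x = M.jump v f x - M.jump w f x := by
  simp only [jump, Pi.sub_apply, sub_smul, Finset.sum_sub_distrib]

lemma sq_sub_Qh_node_le (hΩ : IsOpen Ω) (hc : Convex ℝ Ω) (hp : 0 < p) (v : M.Broken) (k : Fin M.n)
    {ξ : Fin d → ℝ} (hξ : ξ ∈ refNodes d p) :
    (v - M.Qh p v) k (M.chart k ξ) ^ 2 ≤
      (M.starCard (M.chart k ξ) : ℝ) ^ 2 * M.jumpSum v (M.chart k ξ) := by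
  rw [Pi.sub_apply, Pi.sub_apply, M.Qh_node v k hξ]
  exact M.sq_sub_nodalMean_le hΩ hc v (M.chart_mem_closure_elem.2 fun i =>
    mem_Icc_of_mem_gllNodes hp (mem_refNodes.1 hξ i))

end Oswald

end Mesh

/-! ### Comparison of integrals with integrals over the reference cube -/

section MeasureComparison

open scoped NNReal ENNReal

variable {n d : ℕ} {φ : E n → E d} {S : Set (E n)} {K : ℝ≥0}

lemma euclideanHausdorffMeasure_image_le (hφ : LipschitzWith K φ) (S : Set (E n)) :
    μHE[n] (φ '' S) ≤ (K : ℝ≥0∞) ^ n * volume S := by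
  have h := hφ.hausdorffMeasure_image_le (d := n) (Nat.cast_nonneg n) S
  rw [← EuclideanSpace.euclideanHausdorffMeasure_eq_volume]
  simp only [Measure.euclideanHausdorffMeasure_def, Measure.smul_apply]
  rw [ENNReal.rpow_natCast] at h
  rw [mul_smul_comm]
  exact smul_le_smul_of_nonneg_left h zero_le

lemma volume_le_euclideanHausdorffMeasure_image (hφ : AntilipschitzWith K φ) (S : Set (E n)) :
    volume S ≤ (K : ℝ≥0∞) ^ n * μHE[n] (φ '' S) := by
  have h := hφ.le_hausdorffMeasure_image (d := n) (Nat.cast_nonneg n) S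
  rw [← EuclideanSpace.euclideanHausdorffMeasure_eq_volume]
  simp only [Measure.euclideanHausdorffMeasure_def, Measure.smul_apply]
  rw [ENNReal.rpow_natCast] at h
  rw [mul_smul_comm]
  exact smul_le_smul_of_nonneg_left h zero_le

/-- The measure of the cube, transported to the Euclidean space. -/
def euclCubeMeasure (n : ℕ) : Measure (E n) := (cubeMeasure n).map (WithLp.toLp 2)

lemma restrict_image_le (hφ : LipschitzWith K φ)
    (hS : volume.restrict S = euclCubeMeasure n) :
    (μHE[n] : Measure (E d)).restrict (φ '' S) ≤ (K ^ n) • (euclCubeMeasure n).map φ := by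
  refine Measure.le_iff.2 fun A hA => ?_
  have hm := hφ.continuous.measurable
  rw [Measure.restrict_apply hA, Measure.smul_apply, Measure.map_apply hm hA, ← hS,
    Measure.restrict_apply (hm hA), Set.inter_comm, ← Set.image_inter_preimage, Set.inter_comm]
  refine (euclideanHausdorffMeasure_image_le hφ _).trans (le_of_eq ?_)
  rw [ENNReal.smul_def, smul_eq_mul, ENNReal.coe_pow]

lemma map_le_restrict_image (hφ : AntilipschitzWith K φ) (hc : Continuous φ)
    (hS : volume.restrict S = euclCubeMeasure n) :
    (euclCubeMeasure n).map φ ≤ (K ^ n) • (μHE[n] : Measure (E d)).restrict (φ '' S) := by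
  refine Measure.le_iff.2 fun A hA => ?_
  have hm := hc.measurable
  rw [Measure.smul_apply, Measure.restrict_apply hA, Measure.map_apply hm hA, ← hS,
    Measure.restrict_apply (hm hA), Set.inter_comm, Set.inter_comm A, ← Set.image_inter_preimage]
  refine (volume_le_euclideanHausdorffMeasure_image hφ _).trans (le_of_eq ?_)
  rw [ENNReal.smul_def, smul_eq_mul, ENNReal.coe_pow]

lemma measurable_toLp (n : ℕ) : Measurable (WithLp.toLp 2 : (Fin n → ℝ) → E n) :=
  (PiLp.continuous_toLp 2 _).measurable

lemma integrable_map_euclCubeMeasure (hc : Continuous φ) {g : E d → ℝ} (hg : Continuous g) :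
    Integrable g ((euclCubeMeasure n).map φ) := by
  rw [euclCubeMeasure, Measure.map_map hc.measurable (measurable_toLp n)]
  have hm : Measurable (φ ∘ WithLp.toLp 2) := hc.measurable.comp (measurable_toLp n)
  rw [integrable_map_measure hg.aestronglyMeasurable hm.aemeasurable]
  exact integrable_cubeMeasure (hg.comp (hc.comp (PiLp.continuous_toLp 2 _)))

lemma integral_map_euclCubeMeasure (hc : Continuous φ) {g : E d → ℝ} (hg : Continuous g) :
    ∫ x, g x ∂(euclCubeMeasure n).map φ = ∫ ξ, g (φ (WithLp.toLp 2 ξ)) ∂cubeMeasure n := by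
  rw [euclCubeMeasure, Measure.map_map hc.measurable (measurable_toLp n)]
  exact integral_map (hc.measurable.comp (measurable_toLp n)).aemeasurable hg.aestronglyMeasurable

lemma integrableOn_image (hφ : LipschitzWith K φ)
    (hS : volume.restrict S = euclCubeMeasure n) {g : E d → ℝ} (hg : Continuous g) :
    IntegrableOn g (φ '' S) μHE[n] :=
  ((integrable_map_euclCubeMeasure hφ.continuous hg).smul_measure_nnreal).mono_measure
    (restrict_image_le hφ hS)

lemma setIntegral_image_le (hφ : LipschitzWith K φ)
    (hS : volume.restrict S = euclCubeMeasure n) {g : E d → ℝ} (hg : Continuous g)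
    (h0 : ∀ x, 0 ≤ g x) :
    ∫ x in φ '' S, g x ∂μHE[n] ≤ (K : ℝ) ^ n * ∫ ξ, g (φ (WithLp.toLp 2 ξ)) ∂cubeMeasure n := by
  have h := integral_mono_measure (restrict_image_le hφ hS) (Filter.Eventually.of_forall h0)
    ((integrable_map_euclCubeMeasure hφ.continuous hg).smul_measure_nnreal)
  rwa [integral_smul_nnreal_measure, integral_map_euclCubeMeasure hφ.continuous hg, NNReal.smul_def,
    smul_eq_mul, NNReal.coe_pow] at h

lemma le_setIntegral_image (hφ : AntilipschitzWith K φ) {K' : ℝ≥0} (hc : LipschitzWith K' φ)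
    (hS : volume.restrict S = euclCubeMeasure n) {g : E d → ℝ} (hg : Continuous g)
    (h0 : ∀ x, 0 ≤ g x) :
    ∫ ξ, g (φ (WithLp.toLp 2 ξ)) ∂cubeMeasure n ≤ (K : ℝ) ^ n * ∫ x in φ '' S, g x ∂μHE[n] := by
  have h := integral_mono_measure (map_le_restrict_image hφ hc.continuous hS)
    (Filter.Eventually.of_forall h0) ((integrableOn_image hc hS hg).smul_measure_nnreal)
  rwa [integral_smul_nnreal_measure, integral_map_euclCubeMeasure hc.continuous hg, NNReal.smul_def,
    smul_eq_mul, NNReal.coe_pow] at h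

lemma restrict_preimage_ofLp {T : Set (Fin n → ℝ)}
    (hT : (volume : Measure (Fin n → ℝ)).restrict T = cubeMeasure n) :
    (volume : Measure (E n)).restrict ((fun x i => x i) ⁻¹' T) = euclCubeMeasure n := by
  have hmp := PiLp.volume_preserving_toLp (Fin n)
  have hemb : MeasurableEmbedding (WithLp.toLp 2 : (Fin n → ℝ) → E n) :=
    (MeasurableEquiv.toLp 2 (Fin n → ℝ)).measurableEmbedding
  rw [euclCubeMeasure, ← hT, ← hmp.map_eq, hemb.restrict_map]
  rfl

lemma restrict_refCube (n : ℕ) : volume.restrict (refCube n) = euclCubeMeasure n := by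
  have h := restrict_preimage_ofLp (T := Set.univ.pi fun _ : Fin n => Set.Ioo (-1 : ℝ) 1) ?_
  · rw [← h]; congr 1; ext x; simp [refCube]
  · rw [cubeMeasure_eq]
    exact Measure.restrict_congr_set Measure.pi_Ioo_ae_eq_pi_Icc

lemma restrict_closedCube (n : ℕ) :
    volume.restrict {x : E n | ∀ i, x i ∈ Set.Icc (-1 : ℝ) 1} = euclCubeMeasure n := by
  rw [← restrict_preimage_ofLp (cubeMeasure_eq n).symm]
  congr 1
  ext x
  simp only [Set.mem_preimage, Set.mem_univ_pi]
  rfl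

end MeasureComparison

/-! ### Scaling of quasi-uniform meshes -/

lemma norm_map_le_of_ball {V W : Type*} [NormedAddCommGroup V] [NormedSpace ℝ V]
    [NormedAddCommGroup W] [NormedSpace ℝ W] (L : V →ₗ[ℝ] W) {r C : ℝ} (hr : 0 < r)
    (h : ∀ u, ‖u‖ < r → ‖L u‖ ≤ C) (u : V) : ‖L u‖ ≤ 2 * C / r * ‖u‖ := by
  by_cases hu : u = 0
  · simp [hu]
  have hu' : 0 < ‖u‖ := norm_pos_iff.2 hu
  have h1 := h ((r / (2 * ‖u‖)) • u) (by
    rw [norm_smul, Real.norm_of_nonneg (by positivity)]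
    field_simp
    linarith)
  rw [map_smul, norm_smul, Real.norm_of_nonneg (by positivity)] at h1
  rw [div_mul_eq_mul_div, le_div_iff₀ hr]
  rw [div_mul_eq_mul_div, div_le_iff₀ (by positivity)] at h1
  linarith

lemma norm_sq_eq_sum {d : ℕ} (x : E d) : ‖x‖ ^ 2 = ∑ i, x i ^ 2 := by
  rw [EuclideanSpace.norm_sq_eq]; simp

lemma norm_sub_le_of_mem_refCube {d : ℕ} {x y : E d} (hx : x ∈ refCube d) (hy : y ∈ refCube d) :
    ‖x - y‖ ≤ 2 * d := by
  refine abs_le_of_sq_le_sq' ?_ (by positivity) |>.2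
  rw [norm_sq_eq_sum]
  have h1 : ∀ i ∈ Finset.univ, (x - y) i ^ 2 ≤ (4 : ℝ) := fun i _ => by
    have h1 := hx i
    have h2 := hy i
    rw [PiLp.sub_apply]
    have h3 : |x i - y i| ≤ 2 := abs_le.2 ⟨by linarith [h1.1, h2.2], by linarith [h1.2, h2.1]⟩
    nlinarith [sq_abs (x i - y i), abs_nonneg (x i - y i)]
  have h2 := Finset.sum_le_card_nsmul _ _ _ h1
  rw [Finset.card_univ, Fintype.card_fin, nsmul_eq_mul] at h2
  have h3 : (d : ℝ) ≤ (d : ℝ) ^ 2 := by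
    exact_mod_cast Nat.le_self_pow two_ne_zero d
  nlinarith

namespace Mesh

section Scaling

open scoped NNReal ENNReal

variable {d : ℕ} {Ω : Set (E d)} (M : Mesh Ω)

/-- The elements have size `H` and bounded distortion, up to the factor `a`: the linear parts of the
element maps and their inverses have norms at most `a H` and `a / H`. -/
structure Scaled (H a : ℝ) : Prop where
  pos : 0 < H
  one_le : 1 ≤ a
  norm_linear_le : ∀ k u, ‖(M.F k).linear u‖ ≤ a * H * ‖u‖
  norm_symm_le : ∀ k u, ‖(M.F k).linear.symm u‖ ≤ a / H * ‖u‖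
  le_h : ∀ k, H ≤ a * M.h k
  h_le : ∀ k, M.h k ≤ a * H

lemma isBounded_elem (k : Fin M.n) : Bornology.IsBounded (M.elem k) :=
  (M.isCompact_closure_elem k).isBounded.subset subset_closure

lemma F_sub_F (k : Fin M.n) (x y : E d) : M.F k x - M.F k y = (M.F k).linear (x - y) := by
  have := (M.F k).toAffineMap.linearMap_vsub x y
  simpa using this.symm

/-- Shape-regular, quasi-uniform meshes are uniformly scaled. -/
lemma exists_scaled (hd : 0 < d) (hΩ : Ω.Nonempty) {γ q : ℝ} (hγ : M.ShapeRegular γ)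
    (hq : M.QuasiUniform q) : ∃ H, M.Scaled H (2 * q + 4 * d * γ * q) := by
  obtain ⟨y, hy⟩ := hΩ
  obtain ⟨k₀, -⟩ := M.exists_mem_closure_elem (subset_closure hy)
  have hpos : ∀ k, 0 < M.h k := fun k => by
    obtain ⟨x, r, hr, hb, -⟩ := hγ k
    have h1 : x + EuclideanSpace.single (⟨0, hd⟩ : Fin d) (r / 2) ∈ M.elem k := hb (by
      simp [abs_of_pos hr, hr])
    have h2 := Metric.dist_le_diam_of_mem (M.isBounded_elem k) h1 (hb (Metric.mem_ball_self hr))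
    refine lt_of_lt_of_le ?_ h2
    simp [hr.ne']
  have hd1 : (1 : ℝ) ≤ d := by exact_mod_cast hd
  have hq1 : 1 ≤ q := by
    have := hq k₀ k₀
    nlinarith [hpos k₀]
  have hγ0 : 0 < γ := by
    obtain ⟨x, r, hr, -, h⟩ := hγ k₀
    by_contra hneg
    nlinarith [hpos k₀]
  have hγq : 0 < d * γ * q := by positivity
  have hH := hpos k₀
  have h0 : (0 : E d) ∈ refCube d := fun i => by simp
  refine ⟨M.h k₀, hH, by nlinarith, fun k u => ?_, fun k u => ?_, fun k => ?_, fun k => ?_⟩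
  · have h1 := norm_map_le_of_ball ((M.F k).linear : E d →ₗ[ℝ] E d) one_pos (C := M.h k)
      (fun u hu => by
        have hu' : u ∈ refCube d := fun i => by
          have := (PiLp.norm_apply_le u i).trans_lt hu
          rw [Real.norm_eq_abs] at this
          exact abs_lt.1 this
        have h2 := Metric.dist_le_diam_of_mem (M.isBounded_elem k)
          (Set.mem_image_of_mem (M.F k) hu') (Set.mem_image_of_mem (M.F k) h0)
        rwa [dist_eq_norm, F_sub_F, sub_zero] at h2) u
    refine h1.trans (mul_le_mul_of_nonneg_right ?_ (norm_nonneg _))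
    have := hq k k₀
    nlinarith
  · obtain ⟨x, r, hr, hb, hh⟩ := hγ k
    have h1 := norm_map_le_of_ball ((M.F k).linear.symm : E d →ₗ[ℝ] E d) hr (C := 2 * d)
      (fun w hw => by
        obtain ⟨z, hz, hz'⟩ := hb (Metric.mem_ball_self hr)
        obtain ⟨z₁, hz₁, hz₁'⟩ := hb (show x + w ∈ Metric.ball x r by simpa using hw)
        have h2 : ((M.F k).linear.symm : E d →ₗ[ℝ] E d) w = z₁ - z := by
          rw [LinearEquiv.coe_coe, LinearEquiv.symm_apply_eq, ← F_sub_F, hz', hz₁']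
          simp
        rw [h2]
        exact norm_sub_le_of_mem_refCube hz₁ hz) u
    refine h1.trans (mul_le_mul_of_nonneg_right ?_ (norm_nonneg _))
    have h2 := hq k₀ k
    rw [div_le_div_iff₀ hr hH]
    have h3 : M.h k₀ ≤ q * (γ * r) := h2.trans (mul_le_mul_of_nonneg_left hh (by linarith))
    have h4 : 0 ≤ 2 * q * r := by positivity
    nlinarith
  · have h2 := hq k₀ k
    nlinarith [hpos k]
  · have h2 := hq k k₀
    nlinarith

namespace Scaled

variable {M} {H a : ℝ}

lemma nonneg (hS : M.Scaled H a) : 0 ≤ a := zero_le_one.trans hS.one_le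

lemma lipschitz (hS : M.Scaled H a) (k : Fin M.n) : LipschitzWith (a * H).toNNReal (M.F k) :=
  LipschitzWith.of_dist_le_mul fun x y => by
    rw [dist_eq_norm, dist_eq_norm, F_sub_F,
      Real.coe_toNNReal _ (mul_nonneg hS.nonneg hS.pos.le)]
    exact hS.norm_linear_le k _

lemma antilipschitz (hS : M.Scaled H a) (k : Fin M.n) :
    AntilipschitzWith (a / H).toNNReal (M.F k) :=
  AntilipschitzWith.of_le_mul_dist fun x y => by
    rw [dist_eq_norm, dist_eq_norm, F_sub_F,
      Real.coe_toNNReal _ (div_nonneg hS.nonneg hS.pos.le)]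
    have := hS.norm_symm_le k ((M.F k).linear (x - y))
    rwa [LinearEquiv.symm_apply_apply] at this

lemma integral_elem_le (hS : M.Scaled H a) (k : Fin M.n) {g : E d → ℝ} (hg : Continuous g)
    (h0 : ∀ x, 0 ≤ g x) :
    ∫ x in M.elem k, g x ≤ (a * H) ^ d * ∫ ξ, g (M.chart k ξ) ∂cubeMeasure d := by
  have h := setIntegral_image_le (hS.lipschitz k) (restrict_refCube d) hg h0
  rwa [EuclideanSpace.euclideanHausdorffMeasure_eq_volume,
    Real.coe_toNNReal _ (mul_nonneg hS.nonneg hS.pos.le)] at h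

lemma integral_cube_le (hS : M.Scaled H a) (k : Fin M.n) {g : E d → ℝ} (hg : Continuous g)
    (h0 : ∀ x, 0 ≤ g x) :
    ∫ ξ, g (M.chart k ξ) ∂cubeMeasure d ≤ (a / H) ^ d * ∫ x in M.elem k, g x := by
  have h := le_setIntegral_image (hS.antilipschitz k) (hS.lipschitz k) (restrict_refCube d) hg h0
  rwa [EuclideanSpace.euclideanHausdorffMeasure_eq_volume,
    Real.coe_toNNReal _ (div_nonneg hS.nonneg hS.pos.le)] at h

/-- The number of elements around a point is bounded, because they are disjoint, not too small, and
contained in a ball. -/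
lemma starCard_le (hS : M.Scaled H a) (y : E d) :
    (M.starCard y : ℝ) ≤ a ^ (2 * d) * (volume : Measure (E d)).real (Metric.ball 0 1) := by
  classical
  set V := (volume : Measure (E d)).real (Metric.ball 0 1) with hV
  have hH := hS.pos
  have ha := hS.nonneg
  have hpair : Pairwise (Function.onFun Disjoint fun l : {l // y ∈ closure (M.elem l)} => M.elem l.1) :=
    fun l l' h => M.disj _ _ fun e => h (Subtype.ext e)
  have hsub : (⋃ l : {l // y ∈ closure (M.elem l)}, M.elem l.1) ⊆ Metric.closedBall y (a * H) := by
    refine Set.iUnion_subset fun l x hx => Metric.mem_closedBall.2 ?_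
    have h1 := Metric.dist_le_diam_of_mem (M.isBounded_elem l).closure (subset_closure hx) l.2
    rw [Metric.diam_closure] at h1
    exact h1.trans (hS.h_le _)
  have h1 : ∀ l : {l // y ∈ closure (M.elem l)}, (1 : ℝ) ≤ (a / H) ^ d * volume.real (M.elem l.1) := by
    intro l
    have h := hS.integral_cube_le l.1 (g := fun _ => 1) continuous_const fun _ => zero_le_one
    rw [integral_const, setIntegral_const, smul_eq_mul, smul_eq_mul, mul_one, mul_one] at h
    refine le_trans ?_ h
    rw [cubeMeasure_eq, measureReal_restrict_apply_univ, measureReal_def, volume_pi_pi]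
    simp only [Real.volume_Icc, Finset.prod_const, Finset.card_univ, Fintype.card_fin,
      ENNReal.toReal_pow]
    rw [ENNReal.toReal_ofReal (by norm_num)]
    exact one_le_pow₀ (by norm_num)
  have hfin : ∀ l : {l // y ∈ closure (M.elem l)}, volume (M.elem l.1) ≠ ⊤ := fun l =>
    (M.isBounded_elem l.1).measure_lt_top.ne
  have h2 : ∑ l : {l // y ∈ closure (M.elem l)}, volume.real (M.elem l.1) ≤ (a * H) ^ d * V := by
    rw [← measureReal_iUnion_fintype hpair (fun l => (M.isOpen_elem l.1).measurableSet) hfin]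
    refine (measureReal_mono hsub (measure_closedBall_lt_top.ne)).trans (le_of_eq ?_)
    rw [measureReal_def, Measure.addHaar_closedBall _ _ (mul_nonneg ha hH.le), ENNReal.toReal_mul,
      ENNReal.toReal_ofReal (by positivity), finrank_euclideanSpace_fin, hV, measureReal_def]
  have h3 := Finset.sum_le_sum fun l (_ : l ∈ Finset.univ) => h1 l
  rw [← Finset.mul_sum, Finset.sum_const, Finset.card_univ, nsmul_eq_mul, mul_one] at h3
  have hcard : Fintype.card {l // y ∈ closure (M.elem l)} = M.starCard y :=
    Fintype.card_congr (Equiv.refl _)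
  have h4 : (M.starCard y : ℝ) ≤ (a / H) ^ d * ((a * H) ^ d * V) :=
    (hcard ▸ h3).trans (mul_le_mul_of_nonneg_left h2 (by positivity))
  refine h4.trans (le_of_eq ?_)
  rw [← mul_assoc, ← mul_pow, pow_mul]
  congr 2
  field_simp

end Scaled

end Scaling

section FaceScaling

variable {n : ℕ} {Ω : Set (E (n + 1))} (M : Mesh Ω)

/-- The parametrization of a side by the cube of dimension one less. -/
def sideParam (s : M.Side) (y : Fin n → ℝ) : E (n + 1) :=
  M.chart s.1 (s.2.1.insertNth (sgn s.2.2) y)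

lemma continuous_sideParam (s : M.Side) : Continuous (M.sideParam s) :=
  (M.continuous_chart _).comp ((continuous_insertNth s.2.1).comp
    (continuous_const.prodMk continuous_id : Continuous fun y : Fin n → ℝ => (sgn s.2.2, y)))

/-- The embedding of the lower-dimensional space onto the hyperplane through a face of the cube. -/
def faceEmb (i : Fin (n + 1)) (t : ℝ) (y : E n) : E (n + 1) :=
  WithLp.toLp 2 (i.insertNth t fun j => y j)

lemma isometry_faceEmb (i : Fin (n + 1)) (t : ℝ) : Isometry (faceEmb (n := n) i t) :=
  Isometry.of_dist_eq fun x y => by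
    rw [EuclideanSpace.dist_eq, EuclideanSpace.dist_eq, Fin.sum_univ_succAbove _ i]
    simp [faceEmb]

lemma sideSet_eq_image (s : M.Side) : M.sideSet s =
    (M.F s.1 ∘ faceEmb s.2.1 (sgn s.2.2)) '' {x : E n | ∀ i, x i ∈ Set.Icc (-1 : ℝ) 1} := by
  rw [Set.image_comp, sideSet]
  congr 1
  ext x
  constructor
  · rintro ⟨h1, h2⟩
    refine ⟨WithLp.toLp 2 fun j => x (s.2.1.succAbove j), fun j => h1 _, ?_⟩
    rw [faceEmb, ← h2]
    ext j
    exact congrFun (Fin.insertNth_self_removeNth s.2.1 (fun j => x j)) j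
  · rintro ⟨y, hy, rfl⟩
    refine ⟨fun j => ?_, by simp [faceEmb]⟩
    induction j using Fin.succAboveCases s.2.1 with
    | x =>
      rw [show faceEmb s.2.1 (sgn s.2.2) y s.2.1 = sgn s.2.2 by simp [faceEmb]]
      rcases sgn_eq_one_or s.2.2 with e | e <;> rw [e] <;> norm_num
    | p j => simpa [faceEmb] using hy j

namespace Scaled

variable {M} {H a : ℝ}

lemma lipschitz_side (hS : M.Scaled H a) (s : M.Side) :
    LipschitzWith (a * H).toNNReal (M.F s.1 ∘ faceEmb (n := n) s.2.1 (sgn s.2.2)) := by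
  simpa using (hS.lipschitz s.1).comp (isometry_faceEmb s.2.1 (sgn s.2.2)).lipschitz

lemma antilipschitz_side (hS : M.Scaled H a) (s : M.Side) :
    AntilipschitzWith (a / H).toNNReal (M.F s.1 ∘ faceEmb (n := n) s.2.1 (sgn s.2.2)) := by
  simpa using (hS.antilipschitz s.1).comp (isometry_faceEmb s.2.1 (sgn s.2.2)).antilipschitz

lemma integrableOn_side (hS : M.Scaled H a) (s : M.Side) {g : E (n + 1) → ℝ} (hg : Continuous g) :
    IntegrableOn g (M.sideSet s) μHE[n + 1 - 1] := by
  rw [sideSet_eq_image]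
  exact integrableOn_image (hS.lipschitz_side s) (restrict_closedCube n) hg

lemma faceIntegral_le (hS : M.Scaled H a) (s : M.Side) {g : E (n + 1) → ℝ} (hg : Continuous g)
    (h0 : ∀ x, 0 ≤ g x) :
    faceIntegral (M.sideSet s) g ≤ (a * H) ^ n * ∫ y, g (M.sideParam s y) ∂cubeMeasure n := by
  have h := setIntegral_image_le (hS.lipschitz_side s) (restrict_closedCube n) hg h0
  rw [Real.coe_toNNReal _ (mul_nonneg hS.nonneg hS.pos.le), ← sideSet_eq_image] at h
  exact h

lemma integral_sideParam_le (hS : M.Scaled H a) (s : M.Side) {g : E (n + 1) → ℝ}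
    (hg : Continuous g) (h0 : ∀ x, 0 ≤ g x) :
    ∫ y, g (M.sideParam s y) ∂cubeMeasure n ≤ (a / H) ^ n * faceIntegral (M.sideSet s) g := by
  have h := le_setIntegral_image (hS.antilipschitz_side s) (hS.lipschitz_side s)
    (restrict_closedCube n) hg h0
  rw [Real.coe_toNNReal _ (div_nonneg hS.nonneg hS.pos.le), ← sideSet_eq_image] at h
  exact h

/-- The trace inequality on an element. -/
lemma faceIntegral_sq_le (hS : M.Scaled H a) {p : ℕ} (hp : 1 < p) {v : M.Broken} (hv : v ∈ M.Vhp p)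
    (s : M.Side) : faceIntegral (M.sideSet s) (fun x => v s.1 x ^ 2) ≤
      3 * a ^ (2 * n + 1) * (p ^ 2 / H) * ∫ x in M.elem s.1, v s.1 x ^ 2 := by
  have hc : Continuous fun x => v s.1 x ^ 2 := (M.continuous_of_mem_Vhp hv s.1).pow 2
  have hH := hS.pos
  have ha := hS.nonneg
  have h1 := hS.faceIntegral_le s hc fun _ => sq_nonneg _
  have h2 := integral_face_sq_le hp (M.isSepPoly_chart hv s.1) s.2.1 (sgn_eq_one_or s.2.2)
  have h3 := hS.integral_cube_le s.1 hc fun _ => sq_nonneg _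
  refine h1.trans ((mul_le_mul_of_nonneg_left (h2.trans
    (mul_le_mul_of_nonneg_left h3 (by positivity))) (by positivity)).trans (le_of_eq ?_))
  rw [mul_pow, div_pow]
  field_simp
  ring

/-- The inverse inequality on an element, with the `L²` norm of `v` taken on the reference cube, where
it is comparable with the nodal values. -/
lemma integral_gradient_sq_le (hS : M.Scaled H a) {p : ℕ} (hp : 1 < p) {v : M.Broken}
    (hv : v ∈ M.Vhp p) (k : Fin M.n) :
    ∫ x in M.elem k, ‖gradient (v k) x‖ ^ 2 ≤
      96 * (n + 1) * a ^ (n + 3) * (p ^ 4 * H ^ n / H) *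
        ∫ ξ, v k (M.chart k ξ) ^ 2 ∂cubeMeasure (n + 1) := by
  have hd := M.contDiff_of_mem_Vhp hv k
  have hcg : Continuous (gradient (v k)) :=
    (InnerProductSpace.toDual ℝ (E (n + 1))).symm.continuous.comp (hd.continuous_fderiv one_ne_zero)
  have hH := hS.pos
  have ha := hS.nonneg
  have h1 := hS.integral_elem_le k (g := fun x => ‖gradient (v k) x‖ ^ 2) (hcg.norm.pow 2)
    fun _ => sq_nonneg _
  set A := (M.F k).linear with hA
  set g : Fin (n + 1) → (Fin (n + 1) → ℝ) → ℝ :=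
    fun i ξ => ⟪gradient (v k) (M.chart k ξ), A (EuclideanSpace.single i 1)⟫ with hg
  have hgc : ∀ i, Continuous (g i) := fun i =>
    (hcg.comp (M.continuous_chart k)).inner continuous_const
  have hpart : ∀ i ξ, HasDerivAt (fun t => v k (M.chart k (Function.update ξ i t))) (g i ξ) (ξ i) := by
    intro i ξ
    have hlin : ∀ t, M.chart k (Function.update ξ i t) =
        M.chart k ξ + (t - ξ i) • A (EuclideanSpace.single i 1) := fun t => by
      rw [← sub_eq_iff_eq_add', chart_eq_node, chart_eq_node, node, node, F_sub_F, ← map_smul]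
      congr 1
      ext j
      by_cases hj : j = i
      · subst hj; simp
      · simp [hj]
    have hcurve : HasDerivAt (fun t => M.chart k (Function.update ξ i t))
        (A (EuclideanSpace.single i 1)) (ξ i) := by
      simp only [hlin]
      have := (((hasDerivAt_id (ξ i)).sub_const (ξ i)).smul_const
        (A (EuclideanSpace.single i 1))).const_add (M.chart k ξ)
      simpa using this
    have hgrad : HasGradientAt (v k) (gradient (v k) (M.chart k ξ))
        (M.chart k (Function.update ξ i (ξ i))) := by
      rw [Function.update_eq_self]
      exact (hd.differentiable one_ne_zero _).hasGradientAt
    have h := hgrad.hasFDerivAt.comp_hasDerivAt (ξ i) hcurve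
    rw [InnerProductSpace.toDual_apply_apply] at h
    exact h
  have hpt : ∀ ξ, ‖gradient (v k) (M.chart k ξ)‖ ^ 2 ≤ (a / H) ^ 2 * ∑ i, g i ξ ^ 2 := fun ξ => by
    set G := gradient (v k) (M.chart k ξ) with hG
    set y : E (n + 1) := WithLp.toLp 2 fun i => g i ξ with hy
    have e1 : ‖G‖ ^ 2 = ⟪A.symm G, y⟫ := by
      have : G = ∑ i, A.symm G i • A (EuclideanSpace.single i 1) := by
        conv_lhs => rw [← A.apply_symm_apply G]
        simp only [← map_smul]
        rw [← map_sum]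
        congr 1
        ext j
        simp [Finset.sum_apply, Pi.single_apply]
      have e : ⟪A.symm G, y⟫ = ∑ i, A.symm G i * g i ξ := by
        simp [PiLp.inner_apply, hy, mul_comm]
      have e' : ⟪G, G⟫ = ⟪∑ i, A.symm G i • A (EuclideanSpace.single i 1), G⟫ := by rw [← this]
      rw [← real_inner_self_eq_norm_sq, e', e, sum_inner]
      exact Finset.sum_congr rfl fun i _ => by rw [real_inner_smul_left, real_inner_comm]
    have e2 : ‖G‖ ^ 2 ≤ a / H * ‖G‖ * ‖y‖ := by
      rw [e1]
      exact (real_inner_le_norm _ _).trans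
        (mul_le_mul_of_nonneg_right (hS.norm_symm_le k G) (norm_nonneg _))
    have e3 : ‖y‖ ^ 2 = ∑ i, g i ξ ^ 2 := by rw [norm_sq_eq_sum]
    rw [← e3, ← mul_pow]
    refine pow_le_pow_left₀ (norm_nonneg _) ?_ 2
    rcases (norm_nonneg G).eq_or_lt with h | h
    · rw [← h]; positivity
    · nlinarith
  have h2 : ∫ ξ, ‖gradient (v k) (M.chart k ξ)‖ ^ 2 ∂cubeMeasure (n + 1) ≤
      (a / H) ^ 2 * ((n + 1) * (96 * p ^ 4 * ∫ ξ, v k (M.chart k ξ) ^ 2 ∂cubeMeasure (n + 1))) := by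
    refine (integral_mono (integrable_cubeMeasure ((hcg.comp (M.continuous_chart k)).norm.pow 2))
      (integrable_cubeMeasure (f := fun ξ => (a / H) ^ 2 * ∑ i, g i ξ ^ 2) (by fun_prop)) hpt).trans ?_
    rw [integral_const_mul, integral_finsetSum (f := fun i ξ => g i ξ ^ 2) _
      fun i _ => integrable_cubeMeasure ((hgc i).pow 2)]
    refine mul_le_mul_of_nonneg_left ?_ (by positivity)
    have := Finset.sum_le_card_nsmul Finset.univ _ _ fun i (_ : i ∈ Finset.univ) =>
      integral_partialDeriv_sq_le hp (M.isSepPoly_chart hv k) (hgc i) i (hpart i)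
    rw [Finset.card_univ, Fintype.card_fin, nsmul_eq_mul] at this
    exact_mod_cast this
  refine h1.trans ((mul_le_mul_of_nonneg_left h2 (by positivity)).trans (le_of_eq ?_))
  rw [mul_pow, div_pow]
  field_simp
  ring

end Scaled

end FaceScaling

end Mesh

namespace Mesh

/-! ### The nodal estimate of the Oswald operator -/

section OswaldEstimate

variable {n : ℕ} {Ω : Set (E (n + 1))} (M : Mesh Ω) {p : ℕ}

/-- The trace of a finite element function from the other element of an internal face is a polynomial in
the coordinates of the face. -/
lemma isSepPoly_sideParam_of_eq {v : M.Broken} (hv : v ∈ M.Vhp p) {s s' : M.Side}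
    (h : M.sideSet s = M.sideSet s') : IsSepPoly p fun y => v s'.1 (M.sideParam s y) where
  continuous := (M.continuous_of_mem_Vhp hv _).comp (M.continuous_sideParam s)
  exists_poly j y := by
    obtain ⟨m⟩ := M.sideSet_faceMatch h
    have hx : s.2.1.insertNth (sgn s.2.2) y ∈ faceHull (sideSign s.2.1 s.2.2) :=
      mem_faceHull_sideSign.2 (by simp)
    have hj : sideSign s.2.1 s.2.2 (s.2.1.succAbove j) = 0 :=
      sideSign_of_ne (Fin.succAbove_ne s.2.1 j)
    obtain ⟨R, hR, hRe⟩ := (M.isSepPoly_chart hv s'.1).exists_poly (m.equiv ⟨_, hj⟩)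
      (M.transition s.1 s'.1 (s.2.1.insertNth (sgn s.2.2) y))
    refine ⟨R.comp (Polynomial.C (m.sign ⟨_, hj⟩) * Polynomial.X),
      Polynomial.natDegree_comp_le.trans ?_, fun t => ?_⟩
    · have := (Polynomial.natDegree_C_mul_le (m.sign ⟨_, hj⟩) Polynomial.X).trans
        Polynomial.natDegree_X_le
      nlinarith
    · rw [sideParam, ← AffineEquiv.apply_symm_apply (M.chart s'.1)
        (M.chart s.1 (s.2.1.insertNth (sgn s.2.2) (Function.update y j t))), ← transition_apply,
        Fin.insertNth_update, m.apply_update hx hj, hRe]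
      simp

lemma coord_mem_refNodes (hp : 1 < p) {k l : Fin M.n} {ξ : Fin (n + 1) → ℝ}
    (hξ : ξ ∈ refNodes (n + 1) p) (hl : M.chart k ξ ∈ closure (M.elem l)) :
    M.coord l (M.chart k ξ) ∈ refNodes (n + 1) p ∧
      tensorWeight p (M.coord l (M.chart k ξ)) = tensorWeight p ξ := by
  have hp0 : 0 < p := by omega
  by_cases hkl : k = l
  · subst hkl
    rw [AffineEquiv.symm_apply_apply]
    exact ⟨hξ, rfl⟩
  · have hk : M.chart k ξ ∈ closure (M.elem k) :=
      M.chart_mem_closure_elem.2 fun i => mem_Icc_of_mem_gllNodes hp0 (mem_refNodes.1 hξ i)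
    obtain ⟨s, t, hs, ⟨m⟩⟩ := M.exists_common_faceMatch hkl hk hl
    rw [AffineEquiv.symm_apply_apply] at hs
    exact ⟨m.mem_refNodes hp0 hs.2 hξ, m.tensorWeight_eq hp hs.2 hξ⟩

open Classical in
/-- The nodes of all elements that lie on a face are nodes of the face, with the same weights, and each
of them occurs once for each element that contains it. -/
lemma sum_nodes_le (hp : 1 < p) {N : ℝ} (hN : ∀ y, (M.starCard y : ℝ) ≤ N) (s : M.Side)
    {φ : E (n + 1) → ℝ} (hφ : ∀ y, 0 ≤ φ y) :
    ∑ q ∈ (Finset.univ ×ˢ refNodes (n + 1) p).filter (fun q => M.chart q.1 q.2 ∈ M.sideSet s),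
      tensorWeight p q.2 * φ (M.chart q.1 q.2) ≤
      N * (2 / p ^ 2) * ∑ ζ ∈ refNodes n p, tensorWeight p ζ * φ (M.sideParam s ζ) := by
  set T := (Finset.univ ×ˢ refNodes (n + 1) p).filter
    (fun q : Fin M.n × (Fin (n + 1) → ℝ) => M.chart q.1 q.2 ∈ M.sideSet s) with hT
  set m : Fin M.n × (Fin (n + 1) → ℝ) → (Fin n → ℝ) :=
    fun q => s.2.1.removeNth (M.coord s.1 (M.chart q.1 q.2)) with hm
  have hA : ∀ q ∈ T, s.2.1.insertNth (sgn s.2.2) (m q) = M.coord s.1 (M.chart q.1 q.2) :=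
    fun q hq => by
      rw [hT, Finset.mem_filter] at hq
      rw [← (M.mem_sideSet.1 hq.2).2, hm]
      exact Fin.insertNth_self_removeNth _ _
  have hB : ∀ q ∈ T, M.coord s.1 (M.chart q.1 q.2) ∈ refNodes (n + 1) p ∧
      tensorWeight p (M.coord s.1 (M.chart q.1 q.2)) = tensorWeight p q.2 := fun q hq => by
    rw [hT, Finset.mem_filter, Finset.mem_product] at hq
    exact M.coord_mem_refNodes hp hq.1.2 (M.sideSet_subset s hq.2)
  have hmaps : ∀ q ∈ T, m q ∈ refNodes n p := fun q hq => by
    have := (hB q hq).1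
    rw [← hA q hq, insertNth_mem_refNodes] at this
    exact this.2
  rw [← Finset.sum_fiberwise_of_maps_to hmaps, Finset.mul_sum]
  refine Finset.sum_le_sum fun ζ hζ => ?_
  have hW := tensorWeight_pos hp hζ
  have hp' : (0 : ℝ) < p := by exact_mod_cast (by omega : 0 < p)
  have hN0 : 0 ≤ N := (Nat.cast_nonneg _).trans (hN (M.sideParam s ζ))
  have hparam : ∀ q ∈ T.filter (fun q => m q = ζ), M.chart q.1 q.2 = M.sideParam s ζ :=
    fun q hq => by
      rw [Finset.mem_filter] at hq
      rw [sideParam, ← hq.2, hA q hq.1, AffineEquiv.apply_symm_apply]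
  have hterm : ∀ q ∈ T.filter (fun q => m q = ζ), tensorWeight p q.2 * φ (M.chart q.1 q.2) ≤
      2 / p ^ 2 * (tensorWeight p ζ * φ (M.sideParam s ζ)) := fun q hq => by
    rw [hparam q hq]
    rw [Finset.mem_filter] at hq
    have hw : gllWeight p (sgn s.2.2) = 2 / (p * (p + 1)) := by
      rcases sgn_eq_one_or s.2.2 with e | e <;> rw [e]
      exacts [gllWeight_one hp, gllWeight_neg_one hp]
    rw [← (hB q hq.1).2, ← hA q hq.1, tensorWeight_insertNth, hq.2, hw, mul_assoc]
    refine mul_le_mul_of_nonneg_right ?_ (mul_nonneg hW.le (hφ _))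
    exact div_le_div_of_nonneg_left (by norm_num) (by positivity) (by nlinarith)
  refine (Finset.sum_le_card_nsmul _ _ _ hterm).trans ?_
  rw [nsmul_eq_mul, mul_assoc]
  refine mul_le_mul_of_nonneg_right (le_trans ?_ (hN (M.sideParam s ζ)))
    (mul_nonneg (by positivity) (mul_nonneg hW.le (hφ _)))
  have hmem : ∀ q ∈ T.filter (fun q => m q = ζ), M.sideParam s ζ ∈ closure (M.elem q.1) :=
    fun q hq => by
      rw [← hparam q hq]
      rw [Finset.mem_filter, hT, Finset.mem_filter, Finset.mem_product] at hq
      exact M.chart_mem_closure_elem.2 fun i =>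
        mem_Icc_of_mem_gllNodes (by omega) (mem_refNodes.1 hq.1.1.2 i)
  have hcard : (T.filter (fun q => m q = ζ)).card ≤
      Fintype.card {l // M.sideParam s ζ ∈ closure (M.elem l)} := by
    rw [← Fintype.card_coe]
    refine Fintype.card_le_of_injective (fun q => ⟨q.1.1, hmem q.1 q.2⟩) fun q q' h => ?_
    have h1 : q.1.1 = q'.1.1 := congrArg Subtype.val h
    have h2 := (hparam q.1 q.2).trans (hparam q'.1 q'.2).symm
    rw [h1] at h2
    exact Subtype.ext (Prod.ext h1 ((M.chart q'.1.1).injective h2))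
  have e : Fintype.card {l // M.sideParam s ζ ∈ closure (M.elem l)} = M.starCard (M.sideParam s ζ) :=
    Fintype.card_congr (Equiv.refl _)
  exact_mod_cast e ▸ hcard

/-- The sum of the squared `L²` norms of the jumps over the faces. -/
def jumpEnergy (v : M.Broken) : ℝ :=
  ∑ f ∈ M.faces, faceIntegral f fun x => ‖M.jump v f x‖ ^ 2

lemma continuous_jump {v : M.Broken} (hv : v ∈ M.Vhp p) (f : Set (E (n + 1))) :
    Continuous (M.jump v f) :=
  continuous_finsetSum _ fun s _ => (M.continuous_of_mem_Vhp hv s.1).smul continuous_const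

namespace Scaled

variable {M} {H a : ℝ}

lemma quadrature_jump_le (hS : M.Scaled H a) (hp : 1 < p) {v : M.Broken} (hv : v ∈ M.Vhp p)
    (s : M.Side) :
    ∑ ζ ∈ refNodes n p, tensorWeight p ζ * ‖M.jump v (M.sideSet s) (M.sideParam s ζ)‖ ^ 2 ≤
      3 ^ n * (a / H) ^ n *
        faceIntegral (M.sideSet s) fun x => ‖M.jump v (M.sideSet s) x‖ ^ 2 := by
  obtain ⟨u, hu, hju⟩ : ∃ u : (Fin n → ℝ) → ℝ, IsSepPoly p u ∧
      ∀ y, ‖M.jump v (M.sideSet s) (M.sideParam s y)‖ ^ 2 = u y ^ 2 := by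
    rcases M.sides_eq s with h | ⟨s', hne, he, -⟩
    · exact ⟨_, M.isSepPoly_sideParam_of_eq hv (s := s) rfl, fun y => by
        rw [M.norm_jump_of_singleton v h, sq_abs]⟩
    · exact ⟨_, (M.isSepPoly_sideParam_of_eq hv (s := s) rfl).sub (M.isSepPoly_sideParam_of_eq hv he),
        fun y => by rw [M.norm_jump_of_pair v hne he, sq_abs]⟩
  have h := hS.integral_sideParam_le s (g := fun x => ‖M.jump v (M.sideSet s) x‖ ^ 2)
    ((M.continuous_jump hv _).norm.pow 2) fun _ => sq_nonneg _
  simp only [hju] at h ⊢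
  refine (quadrature_le_integral_sq hp hu).trans ?_
  rw [mul_assoc]
  exact mul_le_mul_of_nonneg_left h (by positivity)

/-- The gradient of `v - Q_h v` is controlled by the jumps of `v`. -/
lemma sum_integral_gradient_sub_Qh_le (hS : M.Scaled H a) (hΩ : IsOpen Ω) (hc : Convex ℝ Ω)
    (hp : 1 < p) {N : ℝ} (hN : ∀ y, (M.starCard y : ℝ) ≤ N) {v : M.Broken} (hv : v ∈ M.Vhp p) :
    ∑ k, ∫ x in M.elem k, ‖gradient ((v - M.Qh p v) k) x‖ ^ 2 ≤
      192 * (n + 1) * 3 ^ n * a ^ (2 * n + 3) * N ^ 3 * (p ^ 2 / H * M.jumpEnergy v) := by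
  classical
  have hp0 : 0 < p := by omega
  have hp' : (0 : ℝ) < p := by exact_mod_cast hp0
  have hH := hS.pos
  have ha := hS.nonneg
  have hw : v - M.Qh p v ∈ M.Vhp p := (M.Vhp p).sub_mem hv (M.Qh_mem_Vhp hp0 v)
  have hW : ∀ ξ ∈ refNodes (n + 1) p, 0 < tensorWeight p ξ := fun ξ hξ => tensorWeight_pos hp hξ
  have step1 : ∀ k, ∫ ξ, (v - M.Qh p v) k (M.chart k ξ) ^ 2 ∂cubeMeasure (n + 1) ≤
      ∑ ξ ∈ refNodes (n + 1) p, tensorWeight p ξ * (N ^ 2 * M.jumpSum v (M.chart k ξ)) := fun k => by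
    refine (integral_sq_le_quadrature hp (M.isSepPoly_chart hw k)).trans
      (Finset.sum_le_sum fun ξ hξ => mul_le_mul_of_nonneg_left ?_ (hW ξ hξ).le)
    refine (M.sq_sub_Qh_node_le hΩ hc hp0 v k hξ).trans
      (mul_le_mul_of_nonneg_right ?_ (M.jumpSum_nonneg _ _))
    exact pow_le_pow_left₀ (Nat.cast_nonneg _) (hN _) 2
  -- exchange the sums over the nodes and over the faces
  have step2 : ∑ k, ∑ ξ ∈ refNodes (n + 1) p, tensorWeight p ξ * M.jumpSum v (M.chart k ξ) =
      ∑ f ∈ M.faces, ∑ q ∈ (Finset.univ ×ˢ refNodes (n + 1) p).filter (fun q => M.chart q.1 q.2 ∈ f),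
        tensorWeight p q.2 * ‖M.jump v f (M.chart q.1 q.2)‖ ^ 2 := by
    rw [← Finset.sum_product']
    simp only [jumpSum, Finset.mul_sum, Finset.sum_filter]
    rw [Finset.sum_comm]
    exact Finset.sum_congr rfl fun f _ => Finset.sum_congr rfl fun q _ => by split_ifs <;> simp
  have step3 : ∀ f ∈ M.faces,
      ∑ q ∈ (Finset.univ ×ˢ refNodes (n + 1) p).filter (fun q => M.chart q.1 q.2 ∈ f),
        tensorWeight p q.2 * ‖M.jump v f (M.chart q.1 q.2)‖ ^ 2 ≤
      N * (2 / p ^ 2) * (3 ^ n * (a / H) ^ n * faceIntegral f fun x => ‖M.jump v f x‖ ^ 2) := by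
    intro f hf
    obtain ⟨s, rfl⟩ := M.mem_faces.1 hf
    have hN0 : 0 ≤ N := (Nat.cast_nonneg _).trans (hN 0)
    exact (M.sum_nodes_le hp hN s (φ := fun y => ‖M.jump v (M.sideSet s) y‖ ^ 2)
      fun _ => sq_nonneg _).trans
      (mul_le_mul_of_nonneg_left (hS.quadrature_jump_le hp hv s) (by positivity))
  have step4 : ∑ k, ∫ ξ, (v - M.Qh p v) k (M.chart k ξ) ^ 2 ∂cubeMeasure (n + 1) ≤
      N ^ 2 * (N * (2 / p ^ 2) * (3 ^ n * (a / H) ^ n * M.jumpEnergy v)) := by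
    refine (Finset.sum_le_sum fun k _ => step1 k).trans ?_
    have e : ∑ k, ∑ ξ ∈ refNodes (n + 1) p, tensorWeight p ξ * (N ^ 2 * M.jumpSum v (M.chart k ξ)) =
        N ^ 2 * ∑ k, ∑ ξ ∈ refNodes (n + 1) p, tensorWeight p ξ * M.jumpSum v (M.chart k ξ) := by
      simp only [Finset.mul_sum]
      exact Finset.sum_congr rfl fun k _ => Finset.sum_congr rfl fun ξ _ => by ring
    rw [e, step2]
    refine mul_le_mul_of_nonneg_left ((Finset.sum_le_sum step3).trans (le_of_eq ?_)) (sq_nonneg _)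
    rw [← Finset.mul_sum, ← Finset.mul_sum, jumpEnergy]
  refine (Finset.sum_le_sum fun k _ => hS.integral_gradient_sq_le hp hw k).trans ?_
  rw [← Finset.mul_sum]
  refine (mul_le_mul_of_nonneg_left step4 (by positivity)).trans (le_of_eq ?_)
  rw [div_pow]
  field_simp
  ring

end Scaled

end OswaldEstimate

end Mesh

namespace Mesh

/-! ### The `L²` product of vector fields -/

section VecIntegral

variable {d : ℕ} {Ω : Set (E d)} (M : Mesh Ω) {p : ℕ}

lemma integrableOn_elem (k : Fin M.n) {g : E d → ℝ} (hg : Continuous g) :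
    IntegrableOn g (M.elem k) :=
  (hg.continuousOn.integrableOn_compact (M.isCompact_closure_elem k)).mono_set subset_closure

lemma vecIntegral_comm (τ η : M.BrokenVec) : M.vecIntegral τ η = M.vecIntegral η τ := by
  simp only [vecIntegral, real_inner_comm]

lemma vecIntegral_self (τ : M.BrokenVec) :
    M.vecIntegral τ τ = ∑ k, ∫ x in M.elem k, ‖τ k x‖ ^ 2 := by
  simp only [vecIntegral, real_inner_self_eq_norm_sq]

lemma vecIntegral_self_nonneg (τ : M.BrokenVec) : 0 ≤ M.vecIntegral τ τ := by
  rw [vecIntegral_self]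
  exact Finset.sum_nonneg fun k _ => integral_nonneg fun x => sq_nonneg _

lemma vecIntegral_add_left {τ τ' η : M.BrokenVec} (h : ∀ k, Continuous (τ k))
    (h' : ∀ k, Continuous (τ' k)) (hη : ∀ k, Continuous (η k)) :
    M.vecIntegral (τ + τ') η = M.vecIntegral τ η + M.vecIntegral τ' η := by
  simp only [vecIntegral, ← Finset.sum_add_distrib]
  refine Finset.sum_congr rfl fun k _ => ?_
  rw [← integral_add (M.integrableOn_elem k ((h k).inner (hη k)))
    (M.integrableOn_elem k ((h' k).inner (hη k)))]
  simp only [Pi.add_apply, inner_add_left]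

lemma vecIntegral_smul_left (c : ℝ) (τ η : M.BrokenVec) :
    M.vecIntegral (c • τ) η = c * M.vecIntegral τ η := by
  simp only [vecIntegral, Finset.mul_sum, ← integral_const_mul]
  simp only [Pi.smul_apply, real_inner_smul_left]

lemma vecIntegral_zero_left (η : M.BrokenVec) : M.vecIntegral 0 η = 0 := by
  simp [vecIntegral]

/-- The weighted Cauchy-Schwarz inequality. -/
lemma two_mul_abs_vecIntegral_le {τ η : M.BrokenVec} (h : ∀ k, Continuous (τ k))
    (hη : ∀ k, Continuous (η k)) {ε : ℝ} (hε : 0 < ε) :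
    2 * |M.vecIntegral τ η| ≤ ε * M.vecIntegral τ τ + ε⁻¹ * M.vecIntegral η η := by
  have key : ∀ x y : E d, 2 * |⟪x, y⟫| ≤ ε * ‖x‖ ^ 2 + ε⁻¹ * ‖y‖ ^ 2 := fun x y => by
    have h1 := abs_real_inner_le_norm x y
    have h2 : 0 ≤ ε⁻¹ * (ε * ‖x‖ - ‖y‖) ^ 2 := by positivity
    have h3 : ε⁻¹ * (ε * ‖x‖ - ‖y‖) ^ 2 = ε * ‖x‖ ^ 2 + ε⁻¹ * ‖y‖ ^ 2 - 2 * (‖x‖ * ‖y‖) := by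
      field_simp
      ring
    linarith
  rw [M.vecIntegral_self τ, M.vecIntegral_self η, vecIntegral, Finset.mul_sum, Finset.mul_sum,
    ← Finset.sum_add_distrib]
  refine (mul_le_mul_of_nonneg_left (Finset.abs_sum_le_sum_abs _ _) zero_le_two).trans ?_
  rw [Finset.mul_sum]
  refine Finset.sum_le_sum fun k _ => ?_
  have hi1 := M.integrableOn_elem k (g := fun x => ‖τ k x‖ ^ 2) ((h k).norm.pow 2)
  have hi2 := M.integrableOn_elem k (g := fun x => ‖η k x‖ ^ 2) ((hη k).norm.pow 2)
  have hi3 := M.integrableOn_elem k ((h k).inner (hη k))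
  refine (mul_le_mul_of_nonneg_left (abs_integral_le_integral_abs) zero_le_two).trans ?_
  rw [← integral_const_mul, ← integral_const_mul, ← integral_const_mul,
    ← integral_add (hi1.const_mul ε) (hi2.const_mul _)]
  exact integral_mono (hi3.abs.const_mul 2) ((hi1.const_mul ε).add (hi2.const_mul _))
    fun x => key _ _

/-- `VhpVec` as a submodule. -/
def VhpVecSubmodule (p : ℕ) : Submodule ℝ M.BrokenVec where
  carrier := M.VhpVec p
  add_mem' := fun h h' i => (M.Vhp p).add_mem (h i) (h' i)
  zero_mem' := fun _ => (M.Vhp p).zero_mem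
  smul_mem' := fun c _ h i => (M.Vhp p).smul_mem c (h i)

lemma continuous_of_mem_VhpVec {η : M.BrokenVec} (hη : η ∈ M.VhpVec p) (k : Fin M.n) :
    Continuous (η k) := by
  have h : Continuous fun x => WithLp.toLp 2 fun i => η k x i :=
    (PiLp.continuous_toLp 2 _).comp (continuous_pi fun i => M.continuous_of_mem_Vhp (hη i) k)
  exact h

/-- Unisolvence of the Gauss-Legendre-Lobatto nodes. -/
lemma eq_zero_of_nodes (hp : 0 < p) {v : M.Broken} (hv : v ∈ M.Vhp p) {k : Fin M.n}
    (h : ∀ ξ ∈ refNodes d p, v k (M.chart k ξ) = 0) : v k = 0 := by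
  funext x
  have key := eq_zero_on_faceHull (p := p) hp (s := 0) (f := fun ξ => v k (M.chart k ξ))
    (fun i _ ξ _ => (M.isSepPoly_chart hv k).exists_poly i ξ) (fun ξ hξ _ => h ξ hξ)
    (x := M.coord k x) (fun i hi => absurd rfl hi)
  rwa [AffineEquiv.apply_symm_apply] at key

lemma finiteDimensional_VhpVec (hp : 0 < p) : FiniteDimensional ℝ (M.VhpVecSubmodule p) := by
  let T : M.VhpVecSubmodule p →ₗ[ℝ] (Fin M.n → refNodes d p → Fin d → ℝ) :=
    { toFun := fun η k ξ i => η.1 k (M.chart k ξ.1) i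
      map_add' := fun _ _ => rfl
      map_smul' := fun _ _ => rfl }
  refine FiniteDimensional.of_injective T ((injective_iff_map_eq_zero T).2 fun η h => ?_)
  refine Subtype.ext (funext fun k => funext fun x => ?_)
  ext i
  have := M.eq_zero_of_nodes hp (η.2 i) (k := k) fun ξ hξ =>
    congrFun (congrFun (congrFun h k) ⟨ξ, hξ⟩) i
  exact congrFun this x

lemma Scaled.eq_zero_of_vecIntegral_self {M : Mesh Ω} {H a : ℝ} (hS : M.Scaled H a) (hp : 1 < p)
    {η : M.BrokenVec} (hη : η ∈ M.VhpVec p) (h : M.vecIntegral η η = 0) : η = 0 := by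
  rw [vecIntegral_self, Finset.sum_eq_zero_iff_of_nonneg fun k _ =>
    integral_nonneg fun x => sq_nonneg _] at h
  funext k x
  ext i
  refine congrFun (M.eq_zero_of_nodes (by omega) (hη i) (k := k) fun ξ hξ => ?_) x
  have hc : Continuous fun x => ‖η k x‖ ^ 2 := (M.continuous_of_mem_VhpVec hη k).norm.pow 2
  have h1 := hS.integral_cube_le k hc fun _ => sq_nonneg _
  rw [h k (Finset.mem_univ k), mul_zero] at h1
  have hsep := M.isSepPoly_chart (hη i) k
  have h2 : ∫ ξ, η k (M.chart k ξ) i ^ 2 ∂cubeMeasure d ≤ 0 := by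
    refine (integral_mono (integrable_cubeMeasure hsep.continuous_sq)
      (integrable_cubeMeasure (hc.comp (M.continuous_chart k))) fun ξ => ?_).trans h1
    have := PiLp.norm_apply_le (η k (M.chart k ξ)) i
    rw [Real.norm_eq_abs] at this
    exact sq_le_sq.2 (by rwa [abs_norm])
  have h3 := (quadrature_le_integral_sq hp hsep).trans
    (mul_nonpos_of_nonneg_of_nonpos (by positivity) h2)
  have h4 := Finset.single_le_sum (f := fun ξ => tensorWeight p ξ * η k (M.chart k ξ) i ^ 2)
    (fun ξ hξ => mul_nonneg (tensorWeight_pos hp hξ).le (sq_nonneg _)) hξ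
  have h5 := tensorWeight_pos hp hξ
  have h6 := h4.trans h3
  dsimp only at h6
  by_contra hne
  have : 0 < η k (M.chart k ξ) i ^ 2 := by positivity
  nlinarith

/-- The Riesz representation of linear functionals on `[V_hp]^d`. -/
lemma Scaled.exists_vecIntegral_eq {M : Mesh Ω} {H a : ℝ} (hS : M.Scaled H a) (hp : 1 < p)
    (ℓ : M.BrokenVec → ℝ)
    (hadd : ∀ η ∈ M.VhpVec p, ∀ η' ∈ M.VhpVec p, ℓ (η + η') = ℓ η + ℓ η')
    (hsmul : ∀ (c : ℝ), ∀ η ∈ M.VhpVec p, ℓ (c • η) = c * ℓ η) :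
    ∃ r ∈ M.VhpVec p, ∀ η ∈ M.VhpVec p, M.vecIntegral r η = ℓ η := by
  have := M.finiteDimensional_VhpVec (p := p) (by omega)
  let T : M.VhpVecSubmodule p →ₗ[ℝ] Module.Dual ℝ (M.VhpVecSubmodule p) :=
    LinearMap.mk₂ ℝ (fun r η => M.vecIntegral r.1 η.1)
      (fun r r' η => M.vecIntegral_add_left (M.continuous_of_mem_VhpVec r.2)
        (M.continuous_of_mem_VhpVec r'.2) (M.continuous_of_mem_VhpVec η.2))
      (fun c r η => M.vecIntegral_smul_left c r.1 η.1)
      (fun r η η' => by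
        rw [M.vecIntegral_comm, M.vecIntegral_comm r.1, M.vecIntegral_comm r.1]
        exact M.vecIntegral_add_left (M.continuous_of_mem_VhpVec η.2)
          (M.continuous_of_mem_VhpVec η'.2) (M.continuous_of_mem_VhpVec r.2))
      (fun c r η => by
        rw [M.vecIntegral_comm, M.vecIntegral_comm r.1]
        exact M.vecIntegral_smul_left c η.1 r.1)
  have hinj : Function.Injective T := (injective_iff_map_eq_zero T).2 fun r hr =>
    Subtype.ext (hS.eq_zero_of_vecIntegral_self hp r.2 (LinearMap.congr_fun hr r))
  have hsurj : Function.Surjective T :=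
    (LinearMap.injective_iff_surjective_of_finrank_eq_finrank
      (Subspace.dual_finrank_eq (K := ℝ) (V := M.VhpVecSubmodule p)).symm).1 hinj
  obtain ⟨r, hr⟩ := hsurj
    { toFun := fun η => ℓ η.1
      map_add' := fun η η' => hadd _ η.2 _ η'.2
      map_smul' := fun c η => hsmul c _ η.2 }
  exact ⟨r.1, r.2, fun η hη => LinearMap.congr_fun hr ⟨η, hη⟩⟩

end VecIntegral

end Mesh

namespace Mesh

/-! ### The lifting operators -/

section Lifting

variable {n : ℕ} {Ω : Set (E (n + 1))} (M : Mesh Ω) {p : ℕ}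

lemma liftFaceR_spec {M : Mesh Ω} {f : Set (E (n + 1))} {τ : E (n + 1) → E (n + 1)}
    (h : ∃ r ∈ M.VhpVec p, ∀ η ∈ M.VhpVec p,
      M.vecIntegral r η = -faceIntegral f (fun x => ⟪τ x, M.avgVec η f x⟫)) :
    M.liftFaceR p f τ ∈ M.VhpVec p ∧ ∀ η ∈ M.VhpVec p,
      M.vecIntegral (M.liftFaceR p f τ) η = -faceIntegral f (fun x => ⟪τ x, M.avgVec η f x⟫) := by
  rw [liftFaceR, dif_pos h]
  exact h.choose_spec

lemma liftFaceL_spec {M : Mesh Ω} {f : Set (E (n + 1))} {v : E (n + 1) → ℝ}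
    (h : ∃ r ∈ M.VhpVec p, ∀ η ∈ M.VhpVec p,
      M.vecIntegral r η = -faceIntegral f (fun x => v x * M.jumpVec η f x)) :
    M.liftFaceL p f v ∈ M.VhpVec p ∧ ∀ η ∈ M.VhpVec p,
      M.vecIntegral (M.liftFaceL p f v) η = -faceIntegral f (fun x => v x * M.jumpVec η f x) := by
  rw [liftFaceL, dif_pos h]
  exact h.choose_spec

lemma continuous_avgVec {η : M.BrokenVec} (hη : η ∈ M.VhpVec p) (f : Set (E (n + 1))) :
    Continuous (M.avgVec η f) := by
  have h : Continuous fun x => ∑ s ∈ M.sides f, η s.1 x :=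
    continuous_finsetSum _ fun s _ => M.continuous_of_mem_VhpVec hη s.1
  exact h.const_smul ((M.sides f).card : ℝ)⁻¹

lemma continuous_jumpVec {η : M.BrokenVec} (hη : η ∈ M.VhpVec p) (f : Set (E (n + 1))) :
    Continuous (M.jumpVec η f) :=
  continuous_finsetSum _ fun s _ => (M.continuous_of_mem_VhpVec hη s.1).inner continuous_const

lemma card_sides_le (s : M.Side) : (M.sides (M.sideSet s)).card ≤ 2 := by
  rcases M.sides_eq s with h | ⟨s', -, -, h⟩ <;> rw [h]
  exacts [by simp, Finset.card_le_two]

lemma sq_sum_norm_le {ι V : Type*} [NormedAddCommGroup V] (T : Finset ι) (g : ι → V) :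
    ‖∑ s ∈ T, g s‖ ^ 2 ≤ T.card * ∑ s ∈ T, ‖g s‖ ^ 2 :=
  (pow_le_pow_left₀ (norm_nonneg _) (norm_sum_le _ _) 2).trans sq_sum_le_card_mul_sum_sq

lemma norm_avgVec_sq_le (η : M.BrokenVec) (f : Set (E (n + 1))) (x : E (n + 1)) :
    ‖M.avgVec η f x‖ ^ 2 ≤ ∑ s ∈ M.sides f, ‖η s.1 x‖ ^ 2 := by
  have h0 : 0 ≤ ∑ s ∈ M.sides f, ‖η s.1 x‖ ^ 2 := Finset.sum_nonneg fun _ _ => sq_nonneg _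
  rcases Nat.eq_zero_or_pos (M.sides f).card with h | h
  · rw [avgVec, h]; simpa using h0
  · have h1 : (1 : ℝ) ≤ (M.sides f).card := by exact_mod_cast h
    rw [avgVec, norm_smul, mul_pow, norm_inv, Real.norm_natCast, inv_pow,
      inv_mul_le_iff₀ (by positivity)]
    refine (sq_sum_norm_le _ _).trans (mul_le_mul_of_nonneg_right ?_ h0)
    nlinarith

lemma jumpVec_sq_le (η : M.BrokenVec) (s : M.Side) (x : E (n + 1)) :
    M.jumpVec η (M.sideSet s) x ^ 2 ≤ 2 * ∑ s ∈ M.sides (M.sideSet s), ‖η s.1 x‖ ^ 2 := by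
  have h0 : 0 ≤ ∑ s ∈ M.sides (M.sideSet s), ‖η s.1 x‖ ^ 2 := Finset.sum_nonneg fun _ _ => sq_nonneg _
  refine (sq_sum_le_card_mul_sum_sq).trans ?_
  have h1 : ∑ t ∈ M.sides (M.sideSet s), ⟪η t.1 x, M.normal t⟫ ^ 2 ≤
      ∑ s ∈ M.sides (M.sideSet s), ‖η s.1 x‖ ^ 2 := Finset.sum_le_sum fun t _ => by
    have := abs_real_inner_le_norm (η t.1 x) (M.normal t)
    rw [norm_normal, mul_one] at this
    exact sq_le_sq.2 (by rwa [abs_norm])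
  have h2 : ((M.sides (M.sideSet s)).card : ℝ) ≤ 2 := by exact_mod_cast M.card_sides_le s
  exact mul_le_mul h2 h1 (Finset.sum_nonneg fun _ _ => sq_nonneg _) zero_le_two

lemma abs_mul_le_young {t : ℝ} (ht : 0 < t) (x y : ℝ) :
    |x * y| ≤ t / 2 * x ^ 2 + 1 / (2 * t) * y ^ 2 := by
  have h : t / 2 * x ^ 2 + 1 / (2 * t) * y ^ 2 - |x| * |y| = 1 / (2 * t) * (t * |x| - |y|) ^ 2 := by
    rw [← sq_abs x, ← sq_abs y]
    field_simp
    ring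
  have : 0 ≤ 1 / (2 * t) * (t * |x| - |y|) ^ 2 := by positivity
  rw [abs_mul]
  linarith

/-- The sum of the integrals over a face of the squared traces from its sides. -/
def sideEnergy (η : M.BrokenVec) (f : Set (E (n + 1))) : ℝ :=
  ∑ s ∈ M.sides f, faceIntegral f fun x => ‖η s.1 x‖ ^ 2

lemma sum_sideEnergy (η : M.BrokenVec) : ∑ f ∈ M.faces, M.sideEnergy η f =
    ∑ s : M.Side, faceIntegral (M.sideSet s) fun x => ‖η s.1 x‖ ^ 2 := by
  classical
  rw [← Finset.sum_fiberwise_of_maps_to (s := Finset.univ) (t := M.faces) (g := M.sideSet)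
    fun s _ => M.sideSet_mem_faces s]
  refine Finset.sum_congr rfl fun f _ => ?_
  rw [sideEnergy]
  refine Finset.sum_congr (by ext s; simp [mem_sides]) fun s hs => ?_
  rw [M.mem_sides.1 (by simpa [mem_sides] using hs)]

namespace Scaled

variable {M} {H a : ℝ}

lemma faceIntegral_norm_sq_le (hS : M.Scaled H a) (hp : 1 < p) {η : M.BrokenVec}
    (hη : η ∈ M.VhpVec p) (s : M.Side) :
    faceIntegral (M.sideSet s) (fun x => ‖η s.1 x‖ ^ 2) ≤
      3 * a ^ (2 * n + 1) * (p ^ 2 / H) * ∫ x in M.elem s.1, ‖η s.1 x‖ ^ 2 := by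
  have hc : ∀ i, Continuous fun x => η s.1 x i ^ 2 := fun i =>
    (M.continuous_of_mem_Vhp (hη i) s.1).pow 2
  simp only [norm_sq_eq_sum, faceIntegral]
  rw [integral_finsetSum (f := fun i x => η s.1 x i ^ 2) _ fun i _ => hS.integrableOn_side s (hc i),
    integral_finsetSum (f := fun i x => η s.1 x i ^ 2) _ fun i _ => M.integrableOn_elem _ (hc i),
    Finset.mul_sum]
  exact Finset.sum_le_sum fun i _ => hS.faceIntegral_sq_le hp (hη i) s

lemma sum_sideEnergy_le (hS : M.Scaled H a) (hp : 1 < p) {η : M.BrokenVec}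
    (hη : η ∈ M.VhpVec p) : ∑ f ∈ M.faces, M.sideEnergy η f ≤
      6 * (n + 1) * a ^ (2 * n + 1) * (p ^ 2 / H) * M.vecIntegral η η := by
  rw [sum_sideEnergy, vecIntegral_self]
  refine (Finset.sum_le_sum fun s _ => hS.faceIntegral_norm_sq_le hp hη s).trans (le_of_eq ?_)
  rw [← Finset.mul_sum, Fintype.sum_prod_type]
  simp only [Finset.sum_const, Finset.card_univ, Fintype.card_prod, Fintype.card_fin,
    Fintype.card_bool, nsmul_eq_mul, ← Finset.mul_sum]
  push_cast
  ring

lemma abs_faceIntegral_le (hS : M.Scaled H a) (s : M.Side) {g₁ g₂ g : E (n + 1) → ℝ}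
    (h₁ : Continuous g₁) (h₂ : Continuous g₂) (hg : Continuous g) {b c : ℝ}
    (h : ∀ x, |g x| ≤ b * g₁ x + c * g₂ x) :
    |faceIntegral (M.sideSet s) g| ≤
      b * faceIntegral (M.sideSet s) g₁ + c * faceIntegral (M.sideSet s) g₂ := by
  have i1 := (hS.integrableOn_side s h₁).const_mul b
  have i2 := (hS.integrableOn_side s h₂).const_mul c
  refine abs_integral_le_integral_abs.trans
    ((integral_mono (hS.integrableOn_side s hg).abs (i1.add i2) h).trans (le_of_eq ?_))
  simp only [faceIntegral]
  rw [← integral_const_mul, ← integral_const_mul, ← integral_add i1 i2]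
  rfl

lemma sideEnergy_eq (hS : M.Scaled H a) {η : M.BrokenVec} (hη : η ∈ M.VhpVec p) (s : M.Side) :
    M.sideEnergy η (M.sideSet s) =
      faceIntegral (M.sideSet s) fun x => ∑ t ∈ M.sides (M.sideSet s), ‖η t.1 x‖ ^ 2 := by
  have hi : ∀ t ∈ M.sides (M.sideSet s),
      IntegrableOn (fun x => ‖η t.1 x‖ ^ 2) (M.sideSet s) μHE[n + 1 - 1] := fun t _ =>
    hS.integrableOn_side s ((M.continuous_of_mem_VhpVec hη t.1).norm.pow 2)
  rw [sideEnergy]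
  unfold faceIntegral
  exact (integral_finsetSum _ hi).symm

lemma abs_faceIntegral_avgVec_le (hS : M.Scaled H a) {v : M.Broken} (hv : v ∈ M.Vhp p)
    {η : M.BrokenVec} (hη : η ∈ M.VhpVec p) {t : ℝ} (ht : 0 < t) (s : M.Side) :
    |faceIntegral (M.sideSet s) fun x => ⟪M.jump v (M.sideSet s) x, M.avgVec η (M.sideSet s) x⟫| ≤
      t / 2 * faceIntegral (M.sideSet s) (fun x => ‖M.jump v (M.sideSet s) x‖ ^ 2) +
        1 / (2 * t) * M.sideEnergy η (M.sideSet s) := by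
  rw [hS.sideEnergy_eq hη]
  refine hS.abs_faceIntegral_le s ((M.continuous_jump hv _).norm.pow 2)
    (continuous_finsetSum _ fun t _ => (M.continuous_of_mem_VhpVec hη t.1).norm.pow 2)
    ((M.continuous_jump hv _).inner (M.continuous_avgVec hη _)) fun x => ?_
  refine (abs_real_inner_le_norm _ _).trans ?_
  have h1 := abs_mul_le_young ht ‖M.jump v (M.sideSet s) x‖ ‖M.avgVec η (M.sideSet s) x‖
  refine ((le_abs_self _).trans h1).trans (add_le_add le_rfl
    (mul_le_mul_of_nonneg_left (M.norm_avgVec_sq_le η _ x) (by positivity)))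

lemma abs_faceIntegral_jumpVec_le (hS : M.Scaled H a) {v : M.Broken} (hv : v ∈ M.Vhp p)
    {η : M.BrokenVec} (hη : η ∈ M.VhpVec p) {t : ℝ} (ht : 0 < t) {b : E (n + 1)} {B : ℝ}
    (hb : ‖b‖ ≤ B) (s : M.Side) :
    |faceIntegral (M.sideSet s) fun x =>
        ⟪b, M.jump v (M.sideSet s) x⟫ * M.jumpVec η (M.sideSet s) x| ≤
      t / 2 * B ^ 2 * faceIntegral (M.sideSet s) (fun x => ‖M.jump v (M.sideSet s) x‖ ^ 2) +
        1 / t * M.sideEnergy η (M.sideSet s) := by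
  rw [hS.sideEnergy_eq hη]
  refine hS.abs_faceIntegral_le s ((M.continuous_jump hv _).norm.pow 2)
    (continuous_finsetSum _ fun t _ => (M.continuous_of_mem_VhpVec hη t.1).norm.pow 2)
    ((continuous_const.inner (M.continuous_jump hv _)).mul (M.continuous_jumpVec hη _)) fun x => ?_
  have h1 := abs_mul_le_young ht ⟪b, M.jump v (M.sideSet s) x⟫ (M.jumpVec η (M.sideSet s) x)
  have h2 : ⟪b, M.jump v (M.sideSet s) x⟫ ^ 2 ≤ B ^ 2 * ‖M.jump v (M.sideSet s) x‖ ^ 2 := by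
    rw [← mul_pow, ← sq_abs]
    exact pow_le_pow_left₀ (abs_nonneg _) ((abs_real_inner_le_norm _ _).trans
      (mul_le_mul_of_nonneg_right hb (norm_nonneg _))) 2
  refine h1.trans (add_le_add ?_ ?_)
  · rw [mul_assoc]
    exact mul_le_mul_of_nonneg_left h2 (by positivity)
  · refine (mul_le_mul_of_nonneg_left (M.jumpVec_sq_le η s x) (by positivity)).trans (le_of_eq ?_)
    field_simp

lemma liftFaceR_jump_spec (hS : M.Scaled H a) (hp : 1 < p) {v : M.Broken} (hv : v ∈ M.Vhp p)
    (s : M.Side) : M.liftFaceR p (M.sideSet s) (M.jump v (M.sideSet s)) ∈ M.VhpVec p ∧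
      ∀ η ∈ M.VhpVec p, M.vecIntegral (M.liftFaceR p (M.sideSet s) (M.jump v (M.sideSet s))) η =
        -faceIntegral (M.sideSet s)
          (fun x => ⟪M.jump v (M.sideSet s) x, M.avgVec η (M.sideSet s) x⟫) := by
  refine liftFaceR_spec (hS.exists_vecIntegral_eq hp _ (fun η hη η' hη' => ?_) fun c η hη => ?_)
  · have e : ∀ x, M.avgVec (η + η') (M.sideSet s) x =
        M.avgVec η (M.sideSet s) x + M.avgVec η' (M.sideSet s) x := fun x => by
      simp only [avgVec, Pi.add_apply, Finset.sum_add_distrib, smul_add]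
    simp only [e, inner_add_right, faceIntegral]
    rw [integral_add (hS.integrableOn_side s ((M.continuous_jump hv _).inner (M.continuous_avgVec hη _)))
      (hS.integrableOn_side s ((M.continuous_jump hv _).inner (M.continuous_avgVec hη' _))), neg_add]
  · have e : ∀ x, M.avgVec (c • η) (M.sideSet s) x = c • M.avgVec η (M.sideSet s) x := fun x => by
      simp only [avgVec, Pi.smul_apply, ← Finset.smul_sum, smul_comm c]
    simp only [e, real_inner_smul_right, faceIntegral]
    rw [integral_const_mul, mul_neg]

lemma liftFaceL_jump_spec (hS : M.Scaled H a) (hp : 1 < p) {v : M.Broken} (hv : v ∈ M.Vhp p)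
    (b : E (n + 1)) (s : M.Side) :
    M.liftFaceL p (M.sideSet s) (fun x => ⟪b, M.jump v (M.sideSet s) x⟫) ∈ M.VhpVec p ∧
      ∀ η ∈ M.VhpVec p,
        M.vecIntegral (M.liftFaceL p (M.sideSet s) (fun x => ⟪b, M.jump v (M.sideSet s) x⟫)) η =
          -faceIntegral (M.sideSet s)
            (fun x => ⟪b, M.jump v (M.sideSet s) x⟫ * M.jumpVec η (M.sideSet s) x) := by
  have hcb : Continuous fun x => ⟪b, M.jump v (M.sideSet s) x⟫ :=
    continuous_const.inner (M.continuous_jump hv _)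
  refine liftFaceL_spec (hS.exists_vecIntegral_eq hp _ (fun η hη η' hη' => ?_) fun c η hη => ?_)
  · have e : ∀ x, M.jumpVec (η + η') (M.sideSet s) x =
        M.jumpVec η (M.sideSet s) x + M.jumpVec η' (M.sideSet s) x := fun x => by
      simp only [jumpVec, Pi.add_apply, Finset.sum_add_distrib, inner_add_left]
    simp only [e, mul_add, faceIntegral]
    have hi : ∀ τ ∈ M.VhpVec p, IntegrableOn (fun x => ⟪b, M.jump v (M.sideSet s) x⟫ *
        M.jumpVec τ (M.sideSet s) x) (M.sideSet s) μHE[n + 1 - 1] := fun τ hτ =>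
      hS.integrableOn_side s (hcb.mul (M.continuous_jumpVec hτ _))
    rw [integral_add (hi η hη) (hi η' hη'), neg_add]
  · have e : ∀ x, M.jumpVec (c • η) (M.sideSet s) x = c * M.jumpVec η (M.sideSet s) x := fun x => by
      simp only [jumpVec, Pi.smul_apply, real_inner_smul_left, Finset.mul_sum]
    simp only [e, mul_left_comm _ c, faceIntegral]
    rw [integral_const_mul, mul_neg]

lemma lift_mem_VhpVec (hS : M.Scaled H a) (hp : 1 < p) {v : M.Broken} (hv : v ∈ M.Vhp p)
    (β : Set (E (n + 1)) → E (n + 1)) : M.lift p β v ∈ M.VhpVec p := by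
  refine (M.VhpVecSubmodule p).add_mem (Submodule.sum_mem _ fun f hf => ?_)
    (Submodule.sum_mem _ fun f hf => ?_)
  · obtain ⟨s, rfl⟩ := M.mem_faces.1 hf
    exact (hS.liftFaceR_jump_spec hp hv s).1
  · obtain ⟨s, rfl⟩ := M.mem_faces.1 (Finset.mem_filter.1 hf).1
    exact (hS.liftFaceL_jump_spec hp hv _ s).1

lemma vecIntegral_sum_left {d : ℕ} {Ω : Set (E d)} {M : Mesh Ω} {ι : Type*} (T : Finset ι)
    (r : ι → M.BrokenVec) {η : M.BrokenVec} (hr : ∀ f ∈ T, r f ∈ M.VhpVec p)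
    (hη : η ∈ M.VhpVec p) :
    M.vecIntegral (∑ f ∈ T, r f) η = ∑ f ∈ T, M.vecIntegral (r f) η := by
  classical
  induction T using Finset.induction_on with
  | empty => simp [vecIntegral_zero_left]
  | insert f T hf ih =>
    rw [Finset.sum_insert hf, Finset.sum_insert hf, M.vecIntegral_add_left
      (M.continuous_of_mem_VhpVec (hr f (Finset.mem_insert_self _ _)))
      (M.continuous_of_mem_VhpVec (Submodule.sum_mem (M.VhpVecSubmodule p) fun g hg =>
        hr g (Finset.mem_insert_of_mem hg))) (M.continuous_of_mem_VhpVec hη),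
      ih fun g hg => hr g (Finset.mem_insert_of_mem hg)]

/-- The liftings are bounded by the jumps, by duality and the trace inequality. -/
lemma vecIntegral_lift_le (hS : M.Scaled H a) (hp : 1 < p) {v : M.Broken} (hv : v ∈ M.Vhp p)
    {β : Set (E (n + 1)) → E (n + 1)} {B : ℝ} (hβ : ∀ f, ‖β f‖ ≤ B) :
    M.vecIntegral (M.lift p β v) (M.lift p β v) ≤
      18 * (n + 1) * a ^ (2 * n + 1) * (1 + B ^ 2) * (p ^ 2 / H * M.jumpEnergy v) := by
  set Λ := M.lift p β v with hΛ
  have hΛm : Λ ∈ M.VhpVec p := hS.lift_mem_VhpVec hp hv β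
  have hH := hS.pos
  have ha : 0 < a := zero_lt_one.trans_le hS.one_le
  have hp' : (0 : ℝ) < p := by exact_mod_cast (by omega : 0 < p)
  set t : ℝ := 18 * (n + 1) * a ^ (2 * n + 1) * (p ^ 2 / H) with ht
  have ht0 : 0 < t := by positivity
  have hintsub : M.intFaces ⊆ M.faces := Finset.filter_subset _ _
  have hR : ∀ f ∈ M.faces, M.liftFaceR p f (M.jump v f) ∈ M.VhpVec p := fun f hf => by
    obtain ⟨s, rfl⟩ := M.mem_faces.1 hf
    exact (hS.liftFaceR_jump_spec hp hv s).1
  have hL : ∀ f ∈ M.intFaces, M.liftFaceL p f (fun x => ⟪β f, M.jump v f x⟫) ∈ M.VhpVec p :=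
    fun f hf => by
      obtain ⟨s, rfl⟩ := M.mem_faces.1 (hintsub hf)
      exact (hS.liftFaceL_jump_spec hp hv _ s).1
  set J : Set (E (n + 1)) → ℝ := fun f => faceIntegral f fun x => ‖M.jump v f x‖ ^ 2 with hJ
  have hJ0 : ∀ f, 0 ≤ J f := fun f => integral_nonneg fun _ => sq_nonneg _
  have hE0 : ∀ f, 0 ≤ M.sideEnergy Λ f := fun f =>
    Finset.sum_nonneg fun _ _ => integral_nonneg fun _ => sq_nonneg _
  have e : M.vecIntegral Λ Λ = ∑ f ∈ M.faces, M.vecIntegral (M.liftFaceR p f (M.jump v f)) Λ +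
      ∑ f ∈ M.intFaces, M.vecIntegral (M.liftFaceL p f (fun x => ⟪β f, M.jump v f x⟫)) Λ := by
    conv_lhs => rw [hΛ, lift]
    rw [M.vecIntegral_add_left
      (M.continuous_of_mem_VhpVec (Submodule.sum_mem (M.VhpVecSubmodule p) hR))
      (M.continuous_of_mem_VhpVec (Submodule.sum_mem (M.VhpVecSubmodule p) hL))]
    · rw [← lift, ← hΛ, vecIntegral_sum_left _ _ hR hΛm, vecIntegral_sum_left _ _ hL hΛm]
    · rw [← lift, ← hΛ]
      exact M.continuous_of_mem_VhpVec hΛm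
  have b1 : ∀ f ∈ M.faces, M.vecIntegral (M.liftFaceR p f (M.jump v f)) Λ ≤
      t / 2 * J f + 1 / (2 * t) * M.sideEnergy Λ f := fun f hf => by
    obtain ⟨s, rfl⟩ := M.mem_faces.1 hf
    rw [(hS.liftFaceR_jump_spec hp hv s).2 Λ hΛm]
    exact (neg_le_abs _).trans (hS.abs_faceIntegral_avgVec_le hv hΛm ht0 s)
  have b2 : ∀ f ∈ M.intFaces,
      M.vecIntegral (M.liftFaceL p f (fun x => ⟪β f, M.jump v f x⟫)) Λ ≤
      t / 2 * B ^ 2 * J f + 1 / t * M.sideEnergy Λ f := fun f hf => by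
    obtain ⟨s, rfl⟩ := M.mem_faces.1 (hintsub hf)
    rw [(hS.liftFaceL_jump_spec hp hv _ s).2 Λ hΛm]
    exact (neg_le_abs _).trans (hS.abs_faceIntegral_jumpVec_le hv hΛm ht0 (hβ _) s)
  have c1 := Finset.sum_le_sum b1
  have c2 := (Finset.sum_le_sum b2).trans (Finset.sum_le_sum_of_subset_of_nonneg hintsub
    fun f _ _ => add_nonneg (mul_nonneg (by positivity) (hJ0 f))
      (mul_nonneg (by positivity) (hE0 f)))
  rw [Finset.sum_add_distrib, ← Finset.mul_sum, ← Finset.mul_sum] at c1 c2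
  have c3 := hS.sum_sideEnergy_le hp hΛm
  have hJs : ∑ f ∈ M.faces, J f = M.jumpEnergy v := rfl
  rw [hJs] at c1 c2
  -- the parameter `t` makes the energy of the traces absorbable
  have c4 : 1 / (2 * t) * ∑ f ∈ M.faces, M.sideEnergy Λ f + 1 / t * ∑ f ∈ M.faces, M.sideEnergy Λ f ≤
      1 / 2 * M.vecIntegral Λ Λ := by
    have h1 : 1 / (2 * t) * ∑ f ∈ M.faces, M.sideEnergy Λ f +
        1 / t * ∑ f ∈ M.faces, M.sideEnergy Λ f =
        3 / (2 * t) * ∑ f ∈ M.faces, M.sideEnergy Λ f := by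
      field_simp
      ring
    rw [h1]
    refine (mul_le_mul_of_nonneg_left c3 (by positivity)).trans (le_of_eq ?_)
    rw [ht]
    field_simp
    ring
  have c5 : M.vecIntegral Λ Λ ≤ t * (1 + B ^ 2) * M.jumpEnergy v := by
    rw [e] at c4 ⊢
    linarith
  refine c5.trans (le_of_eq ?_)
  rw [ht]
  ring

lemma sigma_ge (hS : M.Scaled H a) {α : ℝ} (hα : 0 ≤ α) {f : Set (E (n + 1))} (hf : f ∈ M.faces) :
    α * (p ^ 2 / H) ≤ a * M.sigma p α f := by
  obtain ⟨s, rfl⟩ := M.mem_faces.1 hf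
  have hH := hS.pos
  have ha : 0 < a := zero_lt_one.trans_le hS.one_le
  set T : Set ℝ := (fun s : M.Side => M.h s.1) '' (M.sides (M.sideSet s) : Set M.Side) with hT
  have hsT : M.h s.1 ∈ T := ⟨s, M.mem_sides.2 rfl, rfl⟩
  have hfin : T.Finite := (Finset.finite_toSet _).image _
  have h1 : sInf T ≤ a * H := (csInf_le hfin.bddBelow hsT).trans (hS.h_le _)
  have h2 : 0 < sInf T := by
    obtain ⟨s', -, h⟩ := Set.Nonempty.csInf_mem ⟨_, hsT⟩ hfin
    rw [← h]
    have := hS.le_h s'.1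
    dsimp only
    by_contra hneg
    nlinarith
  rw [sigma, ← hT, mul_div_assoc', mul_div_assoc', div_le_div_iff₀ hH h2]
  have : 0 ≤ α * (p : ℝ) ^ 2 := by positivity
  nlinarith

end Scaled

end Lifting

end Mesh

namespace Mesh

/-! ### Stability of the Oswald decomposition in the energy -/

section Energy

variable {n : ℕ} {Ω : Set (E (n + 1))} (M : Mesh Ω) {p : ℕ}

/-- The penalty part of the bilinear form on the diagonal. -/
def penalty (p : ℕ) (α : ℝ) (v : M.Broken) : ℝ :=
  ∑ f ∈ M.faces, faceIntegral f fun x => M.sigma p α f * ‖M.jump v f x‖ ^ 2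

lemma A_self (α θ : ℝ) (β : Set (E (n + 1)) → E (n + 1)) (v : M.Broken) :
    M.A p α θ β v v = M.vecIntegral (M.brokenGrad v) (M.brokenGrad v) +
      2 * M.vecIntegral (M.brokenGrad v) (M.lift p β v) + M.penalty p α v +
      θ * M.vecIntegral (M.lift p β v) (M.lift p β v) := by
  rw [A, M.vecIntegral_comm (M.lift p β v) (M.brokenGrad v), penalty]
  simp only [real_inner_self_eq_norm_sq]
  ring

lemma penalty_congr {α : ℝ} {u v : M.Broken}
    (h : ∀ f ∈ M.faces, ∀ x ∈ f, M.jump u f x = M.jump v f x) :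
    M.penalty p α u = M.penalty p α v :=
  Finset.sum_congr rfl fun f hf => by
    obtain ⟨s, rfl⟩ := M.mem_faces.1 hf
    exact setIntegral_congr_fun (M.isCompact_sideSet s).measurableSet fun x hx => by
      simp only [h _ hf x hx]

lemma jump_zero (f : Set (E (n + 1))) (x : E (n + 1)) : M.jump 0 f x = 0 := by
  simp [jump]

lemma penalty_zero (α : ℝ) : M.penalty p α 0 = 0 := by
  simp [penalty, jump_zero, faceIntegral]

lemma jumpEnergy_nonneg (v : M.Broken) : 0 ≤ M.jumpEnergy v :=
  Finset.sum_nonneg fun _ _ => integral_nonneg fun _ => sq_nonneg _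

lemma continuous_brokenGrad {v : M.Broken} (hv : v ∈ M.Vhp p) (k : Fin M.n) :
    Continuous (M.brokenGrad v k) :=
  (InnerProductSpace.toDual ℝ (E (n + 1))).symm.continuous.comp
    ((M.contDiff_of_mem_Vhp hv k).continuous_fderiv one_ne_zero)

lemma vecIntegral_brokenGrad_le {u v : M.Broken} (hu : u ∈ M.Vhp p) (hv : v ∈ M.Vhp p) :
    M.vecIntegral (M.brokenGrad u) (M.brokenGrad u) ≤
      2 * M.vecIntegral (M.brokenGrad v) (M.brokenGrad v) +
        2 * M.vecIntegral (M.brokenGrad (v - u)) (M.brokenGrad (v - u)) := by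
  have hw := (M.Vhp p).sub_mem hv hu
  have hsub : ∀ k x, M.brokenGrad u k x = M.brokenGrad v k x - M.brokenGrad (v - u) k x := by
    intro k x
    have hdu := (M.contDiff_of_mem_Vhp hu k).differentiable one_ne_zero x
    have hdv := (M.contDiff_of_mem_Vhp hv k).differentiable one_ne_zero x
    have : fderiv ℝ ((v - u) k) x = fderiv ℝ (v k) x - fderiv ℝ (u k) x := fderiv_sub hdv hdu
    simp only [brokenGrad, gradient, this, map_sub]
    abel
  have hi : ∀ {w}, w ∈ M.Vhp p → ∀ k, IntegrableOn (fun x => ‖M.brokenGrad w k x‖ ^ 2) (M.elem k) :=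
    fun hw k => M.integrableOn_elem k ((M.continuous_brokenGrad hw k).norm.pow 2)
  simp only [vecIntegral_self, Finset.mul_sum]
  rw [← Finset.sum_add_distrib]
  refine Finset.sum_le_sum fun k _ => ?_
  rw [← integral_const_mul, ← integral_const_mul,
    ← integral_add ((hi hv k).const_mul 2) ((hi hw k).const_mul 2)]
  refine integral_mono (hi hu k) (((hi hv k).const_mul 2).add ((hi hw k).const_mul 2)) fun x => ?_
  have h1 := norm_sub_le (M.brokenGrad v k x) (M.brokenGrad (v - u) k x)
  rw [← hsub] at h1
  dsimp only
  nlinarith [norm_nonneg (M.brokenGrad u k x),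
    sq_nonneg (‖M.brokenGrad v k x‖ - ‖M.brokenGrad (v - u) k x‖)]

namespace Scaled

variable {M} {H a : ℝ}

lemma jumpEnergy_le_penalty (hS : M.Scaled H a) {α : ℝ} (hα : 0 ≤ α) (v : M.Broken) :
    α * (p ^ 2 / H * M.jumpEnergy v) ≤ a * M.penalty p α v := by
  rw [← mul_assoc, jumpEnergy, penalty, Finset.mul_sum, Finset.mul_sum]
  refine Finset.sum_le_sum fun f hf => ?_
  have h0 : 0 ≤ faceIntegral f fun x => ‖M.jump v f x‖ ^ 2 := integral_nonneg fun _ => sq_nonneg _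
  have e : faceIntegral f (fun x => M.sigma p α f * ‖M.jump v f x‖ ^ 2) =
      M.sigma p α f * faceIntegral f fun x => ‖M.jump v f x‖ ^ 2 := integral_const_mul _ _
  rw [e, ← mul_assoc]
  exact mul_le_mul_of_nonneg_right (hS.sigma_ge hα hf) h0

lemma A_self_le (hS : M.Scaled H a) (hp : 1 < p) {v : M.Broken} (hv : v ∈ M.Vhp p) (α : ℝ) {θ : ℝ}
    (hθ : θ ≤ 1) (β : Set (E (n + 1)) → E (n + 1)) :
    M.A p α θ β v v ≤ 2 * M.vecIntegral (M.brokenGrad v) (M.brokenGrad v) +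
      2 * M.vecIntegral (M.lift p β v) (M.lift p β v) + M.penalty p α v := by
  have h1 := M.two_mul_abs_vecIntegral_le (M.continuous_brokenGrad hv)
    (M.continuous_of_mem_VhpVec (hS.lift_mem_VhpVec hp hv β)) one_pos
  have h2 := le_abs_self (M.vecIntegral (M.brokenGrad v) (M.lift p β v))
  have h3 := M.vecIntegral_self_nonneg (M.lift p β v)
  rw [A_self]
  nlinarith

/-- Coercivity: the lifting terms are absorbed by the penalty, for the interior penalty form because
the penalty is large, for the local discontinuous Galerkin form because the form contains the square
of `∇v + Λ(v)`. The constant `D` bounds the liftings in terms of the penalty divided by `α`. -/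
lemma le_A_self (hS : M.Scaled H a) (hp : 1 < p) {v : M.Broken} (hv : v ∈ M.Vhp p) {α θ B D : ℝ}
    {β : Set (E (n + 1)) → E (n + 1)} (hD : 1 ≤ D)
    (hL : α * M.vecIntegral (M.lift p β v) (M.lift p β v) ≤ D * M.penalty p α v)
    (h : IsSIPG (4 * D) α θ β ∨ IsLDG B α θ β) :
    M.vecIntegral (M.brokenGrad v) (M.brokenGrad v) + M.penalty p α v ≤
      (2 * D + 1) * M.A p α θ β v v := by
  have hα : 1 ≤ α := by
    rcases h with h | h
    exacts [h.2.2.1, h.2.2]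
  set G := M.vecIntegral (M.brokenGrad v) (M.brokenGrad v) with hG
  set L := M.vecIntegral (M.lift p β v) (M.lift p β v) with hLdef
  set X := M.vecIntegral (M.brokenGrad v) (M.lift p β v) with hX
  set S := M.penalty p α v with hSdef
  have hG0 : 0 ≤ G := M.vecIntegral_self_nonneg _
  have hL0 : 0 ≤ L := M.vecIntegral_self_nonneg _
  have young : ∀ ε : ℝ, 0 < ε → -(ε * G + ε⁻¹ * L) ≤ 2 * X := fun ε hε => by
    have h1 := M.two_mul_abs_vecIntegral_le (M.continuous_brokenGrad hv)
      (M.continuous_of_mem_VhpVec (hS.lift_mem_VhpVec hp hv β)) hε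
    have h2 := neg_abs_le X
    linarith
  have hLS : L ≤ D * S := by nlinarith
  have hS0 : 0 ≤ S := by nlinarith
  have hA := M.A_self (p := p) α θ β v
  rw [← hG, ← hX, ← hLdef, ← hSdef] at hA
  rcases h with ⟨hθ, -, -, hα'⟩ | ⟨hθ, -, -⟩
  · have h1 := young (1 / 2) (by norm_num)
    have h2 : 4 * L ≤ S := by
      have : 4 * D * L ≤ D * S := (mul_le_mul_of_nonneg_right hα' hL0).trans hL
      nlinarith
    have h3 : (1 / 2) * (G + S) ≤ M.A p α θ β v v := by
      rw [hA, hθ]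
      norm_num at h1
      linarith
    nlinarith
  · have hpos : 0 < 2 * D + 1 := by linarith
    have h1 := young (2 * D / (2 * D + 1)) (by positivity)
    have h2 : (2 * D / (2 * D + 1))⁻¹ * L = L + L / (2 * D) := by
      rw [inv_div]
      field_simp
    have h3 : L / (2 * D) ≤ S / 2 := by
      rw [div_le_div_iff₀ (by positivity) two_pos]
      linarith
    have h4 : 2 * D / (2 * D + 1) * G = G - G / (2 * D + 1) := by
      field_simp
      ring
    have h5 : G / (2 * D + 1) + S / 2 ≤ M.A p α θ β v v := by
      rw [hA, hθ]
      rw [h2, h4] at h1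
      linarith
    have h6 := mul_le_mul_of_nonneg_left h5 hpos.le
    rw [mul_add, mul_div_cancel₀ _ hpos.ne'] at h6
    nlinarith

/-- The energy is nonnegative, and the splitting `v = (v - Q_h v) + Q_h v` is stable in it. -/
lemma A_Qh_le (hS : M.Scaled H a) (hΩ : IsOpen Ω) (hc : Convex ℝ Ω) (hp : 1 < p) {N B : ℝ}
    (hN : ∀ y, (M.starCard y : ℝ) ≤ N) {v : M.Broken} (hv : v ∈ M.Vhp p) {α θ D K : ℝ}
    {β : Set (E (n + 1)) → E (n + 1)}
    (hD : D = 18 * (n + 1) * a ^ (2 * n + 1) * (1 + B ^ 2) * a)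
    (hK : K = 192 * (n + 1) * 3 ^ n * a ^ (2 * n + 3) * N ^ 3 * a)
    (h : IsSIPG (4 * D) α θ β ∨ IsLDG B α θ β) :
    0 ≤ M.A p α θ β v v ∧
    M.A p α θ β (v - M.Qh p v) (v - M.Qh p v) + M.A p α θ β (M.Qh p v) (M.Qh p v) ≤
      (6 * K + 2 * D + 4) * (2 * D + 1) * M.A p α θ β v v := by
  have hp0 : 0 < p := by omega
  have hα : 1 ≤ α := by
    rcases h with h | h
    exacts [h.2.2.1, h.2.2]
  have hθ : θ ≤ 1 := by
    rcases h with h | h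
    exacts [h.1.le.trans zero_le_one, h.1.le]
  have ha := hS.one_le
  have ha0 : 0 ≤ a := hS.nonneg
  have hN0 : 0 ≤ N := (Nat.cast_nonneg _).trans (hN 0)
  have hβ : ∀ f, ‖β f‖ ≤ |B| := fun f => by
    rcases h with h | h
    · rw [h.2.1 f, norm_zero]; exact abs_nonneg _
    · exact (h.2.1 f).trans (le_abs_self _)
  have hD1 : 1 ≤ D := by
    have h1 : (1 : ℝ) ≤ a ^ (2 * n + 1) := one_le_pow₀ ha
    have h2 : (1 : ℝ) ≤ 18 * (n + 1) := by
      have : (0 : ℝ) ≤ n := Nat.cast_nonneg n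
      linarith
    have h3 : (1 : ℝ) ≤ 1 + B ^ 2 := by nlinarith [sq_nonneg B]
    rw [hD]
    exact one_le_mul_of_one_le_of_one_le (one_le_mul_of_one_le_of_one_le
      (one_le_mul_of_one_le_of_one_le h2 h1) h3) ha
  have hK0 : 0 ≤ K := by rw [hK]; positivity
  set Q := M.Qh p v with hQ
  have hQm : Q ∈ M.Vhp p := M.Qh_mem_Vhp hp0 v
  have hwm : v - Q ∈ M.Vhp p := (M.Vhp p).sub_mem hv hQm
  -- the liftings and the gradient of `v - Q_h v` in terms of the penalty
  have jle : ∀ u : M.Broken, p ^ 2 / H * M.jumpEnergy u ≤ α * (p ^ 2 / H * M.jumpEnergy u) :=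
    fun u => by
      have hH := hS.pos
      have := M.jumpEnergy_nonneg u
      exact le_mul_of_one_le_left (by positivity) hα
  have hlift : ∀ u ∈ M.Vhp p, α * M.vecIntegral (M.lift p β u) (M.lift p β u) ≤
      D * M.penalty p α u := fun u hu => by
    have h1 := hS.vecIntegral_lift_le hp hu hβ
    have h2 := hS.jumpEnergy_le_penalty (p := p) (zero_le_one.trans hα) u
    rw [sq_abs] at h1
    have hc0 : 0 ≤ 18 * (n + 1) * a ^ (2 * n + 1) * (1 + B ^ 2) := by positivity
    have h3 := mul_le_mul_of_nonneg_left h2 hc0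
    have h4 := mul_le_mul_of_nonneg_left h1 (zero_le_one.trans hα)
    rw [hD]
    linarith
  have hlift' : ∀ u ∈ M.Vhp p, M.vecIntegral (M.lift p β u) (M.lift p β u) ≤
      D * M.penalty p α u := fun u hu =>
    (le_mul_of_one_le_left (M.vecIntegral_self_nonneg _) hα).trans (hlift u hu)
  have hjw : ∀ f ∈ M.faces, ∀ x ∈ f, M.jump (v - Q) f x = M.jump v f x := fun f hf x hx => by
    rw [M.jump_sub, M.jump_Qh hΩ hc hp0 v hf hx, sub_zero]
  have hjQ : ∀ f ∈ M.faces, ∀ x ∈ f, M.jump Q f x = M.jump 0 f x := fun f hf x hx => by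
    rw [M.jump_Qh hΩ hc hp0 v hf hx, jump_zero]
  have hSw := M.penalty_congr (p := p) (α := α) hjw
  have hSQ := (M.penalty_congr (p := p) (α := α) hjQ).trans (M.penalty_zero α)
  have hgrad : M.vecIntegral (M.brokenGrad (v - Q)) (M.brokenGrad (v - Q)) ≤
      K * M.penalty p α v := by
    rw [vecIntegral_self]
    refine (hS.sum_integral_gradient_sub_Qh_le hΩ hc hp hN hv).trans ?_
    have h1 := (jle v).trans (hS.jumpEnergy_le_penalty (p := p) (zero_le_one.trans hα) v)
    have hc0 : 0 ≤ 192 * (n + 1) * 3 ^ n * a ^ (2 * n + 3) * N ^ 3 := by positivity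
    refine (mul_le_mul_of_nonneg_left h1 hc0).trans (le_of_eq ?_)
    rw [hK]
    ring
  have hcoer := hS.le_A_self hp hv hD1 (hlift v hv) h
  have hG0 := M.vecIntegral_self_nonneg (M.brokenGrad v)
  have hS0 : 0 ≤ M.penalty p α v := by
    have := (M.vecIntegral_self_nonneg (M.lift p β v)).trans (hlift' v hv)
    nlinarith
  refine ⟨by nlinarith, ?_⟩
  have u1 := hS.A_self_le hp hwm α hθ β
  have u2 := hS.A_self_le hp hQm α hθ β
  have l1 := hlift' _ hwm
  have l2 := hlift' _ hQm
  have g2 := M.vecIntegral_brokenGrad_le hQm hv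
  rw [hSw] at u1 l1
  rw [hSQ] at u2 l2
  have hsum : M.A p α θ β (v - Q) (v - Q) + M.A p α θ β Q Q ≤
      (6 * K + 2 * D + 4) *
        (M.vecIntegral (M.brokenGrad v) (M.brokenGrad v) + M.penalty p α v) := by
    nlinarith [mul_nonneg hK0 hG0, mul_nonneg (zero_le_one.trans hD1) hG0]
  refine hsum.trans ?_
  rw [mul_assoc]
  exact mul_le_mul_of_nonneg_left hcoer (by linarith)

end Scaled

end Energy

end Mesh

end HpDG

end

theorem theorem4p4 (d : ℕ) (hd : d = 2 ∨ d = 3) (Ω : Set (HpDG.E d))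
    (hΩ : HpDG.IsConvexPolytopeDomain Ω) (γ q B : ℝ) :
    ∃ α₀ C : ℝ, 0 < C ∧
      ∀ M : HpDG.Mesh Ω, M.ShapeRegular γ → M.QuasiUniform q →
      ∀ p : ℕ, 1 < p → ∀ (α θ : ℝ) (β : Set (HpDG.E d) → HpDG.E d),
        (HpDG.IsSIPG α₀ α θ β ∨ HpDG.IsLDG B α θ β) →
        (∀ v ∈ M.Vhp p,
          M.Qh p v ∈ M.VC p ∧ v - M.Qh p v ∈ M.VB p ∧
          M.A p α θ β (v - M.Qh p v) (v - M.Qh p v) + M.A p α θ β (M.Qh p v) (M.Qh p v)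
            ≤ C * M.A p α θ β v v) ∧
        M.VB p ⊔ M.VC p = M.Vhp p ∧
        ∀ v ∈ M.Vhp p, ∃ m : ℝ,
          IsGLB {a : ℝ | ∃ vB ∈ M.VB p, ∃ vC ∈ M.VC p, vB + vC = v ∧
            a = M.A p α θ β vB vB + M.A p α θ β vC vC} m ∧
          m ≤ C * M.A p α θ β v v := by
  obtain ⟨n, rfl⟩ : ∃ n, d = n + 1 := by
    rcases hd with rfl | rfl
    exacts [⟨1, rfl⟩, ⟨2, rfl⟩]
  obtain ⟨hne, S, hS⟩ := hΩ
  have hopen : IsOpen Ω := hS ▸ isOpen_interior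
  have hconv : Convex ℝ Ω := hS ▸ (convex_convexHull ℝ _).interior
  set a : ℝ := 2 * q + 4 * (n + 1 : ℕ) * γ * q with ha
  set N : ℝ := a ^ (2 * (n + 1)) *
    (MeasureTheory.volume : MeasureTheory.Measure (HpDG.E (n + 1))).real (Metric.ball 0 1) with hN
  set D : ℝ := 18 * (n + 1) * a ^ (2 * n + 1) * (1 + B ^ 2) * a with hD
  set K : ℝ := 192 * (n + 1) * 3 ^ n * a ^ (2 * n + 3) * N ^ 3 * a with hK
  -- the maximum only serves to make the constant positive when there are no admissible meshes
  refine ⟨4 * D, max 1 ((6 * K + 2 * D + 4) * (2 * D + 1)), lt_max_of_lt_left one_pos,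
    fun M hγ hq p hp α θ β h => ?_⟩
  obtain ⟨H, hH⟩ := M.exists_scaled n.succ_pos hne hγ hq
  have hp0 : 0 < p := by omega
  have hA : ∀ v ∈ M.Vhp p, 0 ≤ M.A p α θ β v v ∧
      M.A p α θ β (v - M.Qh p v) (v - M.Qh p v) + M.A p α θ β (M.Qh p v) (M.Qh p v) ≤
        max 1 ((6 * K + 2 * D + 4) * (2 * D + 1)) * M.A p α θ β v v := fun v hv => by
    have h1 := hH.A_Qh_le hopen hconv hp (fun y => hH.starCard_le y) hv hD hK h
    exact ⟨h1.1, h1.2.trans (mul_le_mul_of_nonneg_right (le_max_right _ _) h1.1)⟩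
  have hVC : ∀ v, M.Qh p v ∈ M.VC p := fun v => M.Qh_mem_VC hopen hconv hp0 v
  have hVB : ∀ v ∈ M.Vhp p, v - M.Qh p v ∈ M.VB p := fun v hv => M.sub_Qh_mem_VB hopen hconv hp0 hv
  refine ⟨fun v hv => ⟨hVC v, hVB v hv, (hA v hv).2⟩, ?_, fun v hv => ?_⟩
  · refine le_antisymm (sup_le (fun v hv => hv.1) fun v hv => hv.1) fun v hv => ?_
    rw [← sub_add_cancel v (M.Qh p v)]
    exact Submodule.add_mem_sup (hVB v hv) (hVC v)
  · set T : Set ℝ := {a : ℝ | ∃ vB ∈ M.VB p, ∃ vC ∈ M.VC p, vB + vC = v ∧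
      a = M.A p α θ β vB vB + M.A p α θ β vC vC} with hT
    have hmem : M.A p α θ β (v - M.Qh p v) (v - M.Qh p v) +
        M.A p α θ β (M.Qh p v) (M.Qh p v) ∈ T :=
      ⟨_, hVB v hv, _, hVC v, sub_add_cancel _ _, rfl⟩
    have hbdd : BddBelow T := ⟨0, by
      rintro _ ⟨vB, hB, vC, hC, -, rfl⟩
      exact add_nonneg (hA vB hB.1).1 (hA vC hC.1).1⟩
    exact ⟨sInf T, isGLB_csInf ⟨_, hmem⟩ hbdd, (csInf_le hbdd hmem).trans (hA v hv).2⟩
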